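/- **Theorem.** Every $\mathrm{P}$-constructibly bi-infinite counting property of circuits is $\mathrm{SPP}$-hard. That is: let $A\subseteq\mathbb{N}$ be $\mathrm{P}$-constructibly bi-infinite. Then every language $L\in\mathrm{SPP}$ satisfies $L\le^{p}_{T}\mathtt{Counting}(A)$. Here $\Sigma=\{0,1\}$, $\mathrm{FP}$ is the class of polynomial-time computable functions $\Sigma^*\to\Sigma^*$, and $\le^{p}_{T}$ is polynomial-time Turing reducibility (by deterministic polynomial-time oracle Turing machines). * A set $B\subseteq\Sigma^*$ is *$\mathrm{P}$-constructibly infinite* if there is $f\in\mathrm{FP}$ such that for all $x\in\Sigma^*$: $f(x)\in B$ and $|f(x)|\ge|x|$. A set $A\subseteq\mathbb{N}$ is $\mathrm{P}$-constructibly infinite if it is so when viewed as a subset of $\Sigma^*$ via the standard length-lexicographic bijection $0\leftrightarrow\epsilon,\ 1\leftrightarrow 0,\ 2\leftrightarrow 1,\ 3\leftrightarrow 00,\dots$; and $A$ is *$\mathrm{P}$-constructibly bi-infinite* if both $A$ and $\mathbb{N}\setminus A$ are $\mathrm{P}$-constructibly infinite. * For a Boolean circuit $c$ with $n$ inputs,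 $\#(c)$ is the number of the $2^n$ inputs on which $c$ evaluates to $1$; $\mathtt{Counting}(A)$ is the set of all (encodings of) circuits $c$ with $\#(c)\in A$. * $\#\mathrm{P}$ is the class of functions $f:\Sigma^*\to\mathbb{N}$ for which some nondeterministic polynomial-time Turing machine has, on each input $x$, exactly $f(x)$ accepting paths. $\mathrm{SPP}$ is the class of languages $L\subseteq\Sigma^*$ for which there are $f\in\#\mathrm{P}$ and $g\in\mathrm{FP}$ such that for all $x\in\Sigma^*$: $x\notin L\iff f(x)=2^{|g(x)|}$, and $x\in L\iff f(x)=2^{|g(x)|}+1$. -/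

import Mathlib

namespace CircuitRice

open Turing

/-! ### Strings and polynomial-time functions -/

/-- Strings over the alphabet `{0, 1}`, where `false` is `0` and `true` is `1`. -/
abbrev Str : Type := List Bool

/-- The standard bijection from strings to natural numbers given by the length-lexicographic
order: `ε ↦ 0`, `0 ↦ 1`, `1 ↦ 2`, `00 ↦ 3`, `01 ↦ 4`, and so on. -/
def strToNat (w : Str) : ℕ :=
  w.foldl (fun n b => 2 * n + (if b then 2 else 1)) 0

theorem strToNat_append (w : Str) (b : Bool) :
    strToNat (w ++ [b]) = 2 * strToNat w + (if b then 2 else 1) := by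
  simp [strToNat, List.foldl_append]

theorem strToNat_bijective : Function.Bijective strToNat := by
  constructor
  · intro u
    induction u using List.reverseRecOn with
    | nil =>
      intro v h
      rcases List.eq_nil_or_concat' v with rfl | ⟨v', b, rfl⟩
      · rfl
      · rw [strToNat_append] at h
        have h0 : strToNat [] = 0 := rfl
        cases b <;> simp at h <;> omega
    | append_singleton u a ih =>
      intro v h
      rcases List.eq_nil_or_concat' v with rfl | ⟨v', b, rfl⟩
      · rw [strToNat_append] at h
        have h0 : strToNat [] = 0 := rfl
        cases a <;> simp at h <;> omega
      · rw [strToNat_append, strToNat_append] at h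
        have hab : a = b := by
          cases a <;> cases b <;> simp at h ⊢ <;> omega
        subst hab
        rw [ih (show strToNat u = strToNat v' by omega)]
  · intro n
    induction n using Nat.strong_induction_on with
    | _ n ih =>
      rcases Nat.eq_zero_or_pos n with rfl | hn
      · exact ⟨[], rfl⟩
      · rcases Nat.even_or_odd' n with ⟨k, rfl | rfl⟩
        · obtain ⟨w, hw⟩ := ih (k - 1) (by omega)
          refine ⟨w ++ [true], ?_⟩
          rw [strToNat_append, hw]
          simp
          omega
        · obtain ⟨w, hw⟩ := ih k (by omega)
          refine ⟨w ++ [false], ?_⟩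
          rw [strToNat_append, hw]
          simp

/-- `FP`: the functions from strings to strings that are computed in polynomial time by a
deterministic multi-stack Turing machine with finite alphabets. -/
def FP : Set (Str → Str) :=
  {f | ∃ M : TM2ComputableInPolyTime (id : Str → Str) (id : Str → Str) f,
    ∀ k, Finite (M.tm.Γ k)}

/-! ### Nondeterministic machines, `#P` and `SPP` -/

/-- A nondeterministic Turing machine with binary input alphabet. When the machine is about to
execute the label `l`, it executes the statement `tm.m l` or, if there is one, the alternative
statement `alt l`: the step branches exactly if `alt l` is not `none`.  A halted
machine accepts if its internal state satisfies `accept`. -/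
structure NTM where
  tm : FinTM2
  finite_alphabet : ∀ k, Finite (tm.Γ k)
  inputAlphabet : tm.Γ tm.k₀ ≃ Bool
  alt : tm.Λ → Option (TM2.Stmt tm.Γ tm.Λ tm.σ)
  accept : tm.σ → Bool

namespace NTM

variable (N : NTM)

/-- The initial configuration on the input `x`. -/
def init (x : Str) : N.tm.Cfg :=
  initList N.tm (x.map N.inputAlphabet.symm)

/-- The successors of a configuration, one for each possible choice. A configuration
is halted, and has no successors, exactly if it has no current label. -/
def succ (c : N.tm.Cfg) : List N.tm.Cfg :=
  match c.l with
  | none => []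
  | some l => (N.tm.m l :: (N.alt l).toList).map fun q => TM2.stepAux q c.var c.stk

/-- Every computation path that starts in `c` halts within `t` steps. -/
def HaltsIn : ℕ → N.tm.Cfg → Prop
  | 0, c => c.l = none
  | t + 1, c => ∀ c' ∈ N.succ c, HaltsIn t c'

/-- The number of computation paths that start in `c` and that halt within `t` steps and
accept. -/
def accPaths : ℕ → N.tm.Cfg → ℕ
  | 0, c => if c.l.isNone && N.accept c.var then 1 else 0
  | t + 1, c =>
    if c.l.isNone then (if N.accept c.var then 1 else 0)
    else ((N.succ c).map fun c' => accPaths t c').sum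

end NTM

/-- `#P`: the functions that count the accepting paths of a nondeterministic Turing machine all of
whose computation paths have polynomially bounded length. -/
def SharpP : Set (Str → ℕ) :=
  {f | ∃ (N : NTM) (p : Polynomial ℕ), ∀ x : Str,
    N.HaltsIn (p.eval x.length) (N.init x) ∧
      N.accPaths (p.eval x.length) (N.init x) = f x}

/-- The class `SPP`. -/
def SPP : Set (Set Str) :=
  {L | ∃ f ∈ SharpP, ∃ g ∈ FP, ∀ x : Str,
    (x ∉ L ↔ f x = 2 ^ (g x).length) ∧ (x ∈ L ↔ f x = 2 ^ (g x).length + 1)}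

/-! ### Oracle machines and polynomial-time Turing reductions -/

/-- A deterministic oracle Turing machine with binary input alphabet.  When the current label is
`query`, the machine asks whether the string on the stack `kq` (read from the top)
belongs to the oracle; in one step that stack is erased and the machine goes on at the label `yes`
or `no`, according to the answer. A halted machine accepts if its internal state
satisfies `accept`. -/
structure OracleTM where
  tm : FinTM2
  finite_alphabet : ∀ k, Finite (tm.Γ k)
  inputAlphabet : tm.Γ tm.k₀ ≃ Bool
  kq : tm.K
  queryAlphabet : tm.Γ kq ≃ Bool
  query : tm.Λ
  yes : tm.Λ
  no : tm.Λ
  accept : tm.σ → Bool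

namespace OracleTM

variable (M : OracleTM)

/-- The initial configuration on the input `x`. -/
def init (x : Str) : M.tm.Cfg :=
  initList M.tm (x.map M.inputAlphabet.symm)

open Classical in
/-- One step with the oracle `B`; the result is `none` exactly if the machine has halted. -/
noncomputable def step (B : Set Str) (c : M.tm.Cfg) : Option M.tm.Cfg :=
  if c.l = some M.query then
    some
      { l := some (if (c.stk M.kq).map M.queryAlphabet ∈ B then M.yes else M.no)
        var := c.var
        stk := Function.update c.stk M.kq [] }
  else M.tm.step c

end OracleTM

/-- Polynomial-time Turing reducibility of `L` to `B`: some deterministic polynomial-time machine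
with the oracle `B` halts on every input and accepts exactly the elements of `L`. -/
def PolyTuringReduces (L B : Set Str) : Prop :=
  ∃ (M : OracleTM) (p : Polynomial ℕ), ∀ x : Str, ∃ c : M.tm.Cfg,
    Nonempty (StateTransition.EvalsToInTime (M.step B) (M.init x) (some c) (p.eval x.length)) ∧
      c.l = none ∧ (x ∈ L ↔ M.accept c.var = true)

/-- `B` is hard for the class `C` with respect to polynomial-time Turing reductions. -/
def IsHard (C : Set (Set Str)) (B : Set Str) : Prop :=
  ∀ L ∈ C, PolyTuringReduces L B

/-! ### Boolean circuits -/

/-- A gate of a Boolean circuit. The arguments of `not`, `and`, `or` are the positions of gates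
in the list of all gates, the argument of `input` is the number of an input variable. -/
inductive Gate where
  | input (i : ℕ)
  | const (b : Bool)
  | not (i : ℕ)
  | and (i j : ℕ)
  | or (i j : ℕ)

namespace Gate

/-- The gate may stand at position `k` of a circuit with `n` input variables: it refers
only to existing variables and to earlier gates. -/
def Valid (n k : ℕ) : Gate → Prop
  | input i => i < n
  | const _ => True
  | not i => i < k
  | and i j => i < k ∧ j < k
  | or i j => i < k ∧ j < k

/-- The value of a gate, given the input `x` and the values `w` of the earlier gates. -/
def eval (x w : List Bool) : Gate → Bool
  | input i => x.getD i false
  | const b => b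
  | not i => !(w.getD i false)
  | and i j => w.getD i false && w.getD j false
  | or i j => w.getD i false || w.getD j false

end Gate

/-- A Boolean circuit: a nonempty list of gates in topological order. The last gate is the output
gate. -/
structure Circuit where
  arity : ℕ
  gates : List Gate
  nonempty : gates ≠ []
  valid : ∀ (k : ℕ) (hk : k < gates.length), (gates[k]).Valid arity k

/-- The values of all gates of a list of gates on the input `x`, in order. -/
def gateValues (x : List Bool) (gs : List Gate) : List Bool :=
  gs.foldl (fun w g => w ++ [g.eval x w]) []

namespace Circuit

/-- The Boolean function represented by a circuit. -/
def eval (c : Circuit) (x : Fin c.arity → Bool) : Bool :=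
  (gateValues (List.ofFn x) c.gates).getLastD false

/-- `#(c)`: the number of inputs on which the circuit `c` evaluates to `1`. -/
def count (c : Circuit) : ℕ :=
  (Finset.univ.filter fun x : Fin c.arity → Bool => c.eval x = true).card

end Circuit

/-- The self-delimiting unary code `1ⁿ0` of `n`. -/
def unary (n : ℕ) : Str := List.replicate n true ++ [false]

theorem unary_append_inj {m n : ℕ} {u v : Str} (h : unary m ++ u = unary n ++ v) :
    m = n ∧ u = v := by
  induction m generalizing n with
  | zero =>
    cases n with
    | zero => simpa [unary] using h
    | succ n => simp [unary, List.replicate_succ] at h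
  | succ m ih =>
    cases n with
    | zero => simp [unary, List.replicate_succ] at h
    | succ n =>
      have := ih (n := n) (by simpa [unary, List.replicate_succ] using h)
      exact ⟨by omega, this.2⟩

/-- The code of a gate: a tag, then the arguments. -/
def Gate.encode : Gate → Str
  | input i => [false, false, false] ++ unary i
  | const b => [false, false, true, b]
  | not i => [false, true, false] ++ unary i
  | and i j => [false, true, true] ++ unary i ++ unary j
  | or i j => [true, false, false] ++ unary i ++ unary j

theorem Gate.encode_append_inj {g h : Gate} {u v : Str}
    (e : g.encode ++ u = h.encode ++ v) : g = h ∧ u = v := by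
  cases g <;> cases h <;>
    simp only [Gate.encode, List.append_assoc, List.cons_append, List.nil_append, List.cons.injEq,
      true_and, reduceCtorEq, false_and, and_false] at e
  case const.const => exact ⟨by rw [e.1], e.2⟩
  case and.and | or.or =>
    obtain ⟨h1, e1⟩ := unary_append_inj e
    obtain ⟨h2, e2⟩ := unary_append_inj e1
    exact ⟨by rw [h1, h2], e2⟩
  all_goals
    obtain ⟨h1, e1⟩ := unary_append_inj e
    exact ⟨by rw [h1], e1⟩

theorem Gate.encode_ne_nil (g : Gate) : g.encode ≠ [] := by
  cases g <;> simp [Gate.encode]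

/-- The code of a circuit: its number of input variables, then its gates in order. -/
def Circuit.encode (c : Circuit) : Str :=
  unary c.arity ++ c.gates.flatMap Gate.encode

theorem Circuit.encode_injective : Function.Injective Circuit.encode := by
  have aux : ∀ gs hs : List Gate, gs.flatMap Gate.encode = hs.flatMap Gate.encode → gs = hs := by
    intro gs
    induction gs with
    | nil =>
      intro hs e
      cases hs with
      | nil => rfl
      | cons h hs => simp [Gate.encode_ne_nil] at e
    | cons g gs ih =>
      intro hs e
      cases hs with
      | nil => simp [Gate.encode_ne_nil] at e
      | cons h hs =>
        obtain ⟨rfl, e'⟩ := Gate.encode_append_inj (by simpa using e)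
        rw [ih hs e']
  rintro ⟨n, gs, _, _⟩ ⟨m, hs, _, _⟩ e
  obtain ⟨rfl, e'⟩ := unary_append_inj e
  obtain rfl := aux gs hs e'
  rfl

/-- `Counting(A)`: the set of all (codes of) circuits `c` with `#(c) ∈ A`. -/
def Counting (A : Set ℕ) : Set Str :=
  {w | ∃ c : Circuit, c.encode = w ∧ c.count ∈ A}

/-! ### P-constructibly bi-infinite sets -/

/-- A set of strings is P-constructibly infinite. -/
def PConstructiblyInfinite (B : Set Str) : Prop :=
  ∃ f ∈ FP, ∀ x : Str, f x ∈ B ∧ x.length ≤ (f x).length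

/-- A set of natural numbers is P-constructibly infinite, via the standard bijection. -/
def PConstructiblyInfiniteNat (A : Set ℕ) : Prop :=
  PConstructiblyInfinite (strToNat ⁻¹' A)

/-- A set of natural numbers is P-constructibly bi-infinite. -/
def PConstructiblyBiInfinite (A : Set ℕ) : Prop :=
  PConstructiblyInfiniteNat A ∧ PConstructiblyInfiniteNat Aᶜ

end CircuitRice

/-! Let `L` be in SPP, let `n` be the length of `g x`, and let `f x`, which is `2 ^ n` or `2 ^ n +
1`, be the number of accepting paths. Suppose that a number `m` is known such that exactly one of `m
+ 2 ^ n` and `m + 2 ^ n + 1` lies in `A`. Then `f x = 2 ^ n + 1` if and only if the questions `m + 2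
^ n ∈ A` and `m + f x ∈ A` have different answers (`NTM.distinguish`). Both are single questions to
`Counting A`, once there are circuits with `m + 2 ^ n` and with `m + f x` satisfying assignments.

Such an `m` is found by binary search. The two functions that witness bi-infinity, applied to a
string of length `n + 1`, return strings of length at least `n + 1`, whose numbers are at least `2 ^
n`. Subtracting `2 ^ n` gives `a` and `b`, with polynomially many binary digits, such that `a + 2 ^
n ∈ A` and `b + 2 ^ n ∉ A`. Asking about a circuit with `(a + b) / 2 + 2 ^ n` satisfying assignments
tells which end the midpoint may replace (`NTM.SearchInv.step`). In the end `a` and `b` are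
adjacent, in either order, and `m` is the smaller one.

For the circuits, the nondeterministic machine is combined with a comparison of a guessed number
with a binary number `D`. The result is a deterministic system with stacks that consumes one guessed
bit per step. The first bit chooses between simulation and comparison; later bits are forced to be
zero wherever there is no choice. So the accepting bit strings of a sufficient length number exactly
`accPaths + binVal D`, or `binVal D` if the simulation is disabled (`NTM.cnt_start`). A
configuration is a row of cells with a local update rule, and the usual tableau turns this into a
circuit with the same count (`LocalSystem.count_circuit`).

The rest is the proof that all this takes polynomial time on an actual oracle machine. A small
structured language over stacks, with queries and with calls of the given machines, is compiled step
by step (`Exec.steps`). Data are binary trees written in preorder. The predicate `PolyTime` is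
closed under composition, pairing, case distinction and folds with polynomially bounded intermediate
values. The search and the construction of the circuits are built from these operations, and
`polyTuringReduces_of_polyTime` returns to machines. -/

namespace CircuitRice

/-! ### Compilation of structured stack programs to oracle machines -/

open Turing Function

/-! ### Iterated partial steps -/

/-- `n` steps of the partial function `f` lead from `a` to `b`. -/
def Steps {σ : Type*} (f : σ → Option σ) (n : ℕ) (a b : σ) : Prop :=
  (flip bind f)^[n] (some a) = some b

namespace Steps

variable {σ : Type*} {f : σ → Option σ}

theorem zero_iff {a b : σ} : Steps f 0 a b ↔ a = b := by simp [Steps]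

theorem succ_iff {n : ℕ} {a c : σ} :
    Steps f (n + 1) a c ↔ ∃ b, f a = some b ∧ Steps f n b c := by
  have hn : ∀ n, (flip bind f)^[n] (none : Option σ) = none := by
    intro n
    induction n with
    | zero => rfl
    | succ n ih => rw [iterate_succ_apply]; exact ih
  have h : (flip bind f) (some a) = f a := rfl
  rw [Steps, iterate_succ_apply, h]
  cases hfa : f a with
  | none => rw [hn]; simp
  | some b => simp [Steps]

theorem head {n : ℕ} {a b c : σ} (h : f a = some b) (h' : Steps f n b c) :
    Steps f (n + 1) a c := succ_iff.2 ⟨b, h, h'⟩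

theorem single {a b : σ} (h : f a = some b) : Steps f 1 a b := head h (zero_iff.2 rfl)

theorem trans {m n : ℕ} {a b c : σ} (h : Steps f m a b) (h' : Steps f n b c) :
    Steps f (m + n) a c := by
  rw [Steps, add_comm, iterate_add_apply, h, h']

end Steps

/-! ### A structured stack language with an oracle and subroutines -/

/-- Three polynomial-time functions with their machines, and an oracle. -/
structure Env where
  φ : Fin 3 → Str → Str
  mach : ∀ i, TM2ComputableInPolyTime (id : Str → Str) (id : Str → Str) (φ i)
  fin : ∀ i k, Finite ((mach i).tm.Γ k)
  B : Set Str

attribute [instance] FinTM2.kFin FinTM2.ΛFin FinTM2.σFin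

namespace Env

variable (E : Env)

/-- The machine of the `i`-th function. -/
abbrev tm (i : Fin 3) : FinTM2 := (E.mach i).tm

/-- The stacks: one for the input and the queries, four main stacks, and those of the machines. -/
abbrev Stk : Type := Option (Fin 4 ⊕ Σ i : Fin 3, (E.tm i).K)

variable {E} in
/-- The stack for the input and the queries. -/
abbrev io : E.Stk := none

variable {E} in
/-- The main stacks. -/
abbrev main (j : Fin 4) : E.Stk := some (Sum.inl j)

variable {E} in
/-- The stacks of the machine of the `i`-th function. -/
abbrev ext (i : Fin 3) (k : (E.tm i).K) : E.Stk := some (Sum.inr ⟨i, k⟩)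

/-- The alphabets of the stacks; on the main stacks `none` is a separator. -/
abbrev Γ : E.Stk → Type
  | none => Bool
  | some (Sum.inl _) => Option Bool
  | some (Sum.inr ⟨i, k⟩) => (E.tm i).Γ k

/-- The contents of the register and of the stacks. -/
abbrev State : Type := Option Bool × ∀ k : E.Stk, List (E.Γ k)

end Env

/-- Structured programs. -/
inductive Prog (E : Env) where
  | push (k : E.Stk) (f : Option Bool → E.Γ k)
  | pop (k : E.Stk) (f : Option (E.Γ k) → Option Bool)
  | seq (p q : Prog E)
  | ite (f : Option Bool → Bool) (p q : Prog E)
  | while (f : Option Bool → Bool) (p : Prog E)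
  | run (i : Fin 3)
  | query

open Env

variable {E : Env}

open Classical in
/-- `Exec p s t s'`: the program `p`, started in the state `s`, ends after `t` steps in `s'`. -/
inductive Exec : Prog E → E.State → ℕ → E.State → Prop
  | push k f r S : Exec (.push k f) (r, S) 1 (r, update S k (f r :: S k))
  | pop k f r S : Exec (.pop k f) (r, S) 1 (f (S k).head?, update S k (S k).tail)
  | seq {p q s t s' t' s''} : Exec p s t s' → Exec q s' t' s'' → Exec (.seq p q) s (t + t') s''
  | ite_true {f p q r S t s'} : f r = true → Exec p (r, S) t s' →
      Exec (.ite f p q) (r, S) (1 + t) s'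
  | ite_false {f p q r S t s'} : f r = false → Exec q (r, S) t s' →
      Exec (.ite f p q) (r, S) (1 + t) s'
  | while_false {f p r S} : f r = false → Exec (.while f p) (r, S) 1 (r, S)
  | while_true {f p r S t s' t' s''} : f r = true → Exec p (r, S) t s' →
      Exec (.while f p) s' t' s'' → Exec (.while f p) (r, S) (1 + t + t') s''
  | run i r (S S' : ∀ k, List (E.Γ k)) (w : Str) :
      (∀ k, S (ext i k) = (initList (E.tm i) (w.map (E.mach i).inputAlphabet.invFun)).stk k) →
      (∀ k, S' (ext i k) =
        (haltList (E.tm i) ((E.φ i w).map (E.mach i).outputAlphabet.invFun)).stk k) →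
      (∀ k, (∀ k', k ≠ ext i k') → S' k = S k) →
      Exec (.run i) (r, S) ((E.mach i).outputsFun w).steps (r, S')
  | query r S : Exec .query (r, S) 3 (some (decide (S io ∈ E.B)), update S io [])

/-! ### Compilation -/

/-- The labels of a compiled program. -/
def Prog.Lab : Prog E → Type
  | .push _ _ | .pop _ _ | .query => Unit
  | .seq p q => p.Lab ⊕ q.Lab
  | .ite _ p q => Option (p.Lab ⊕ q.Lab)
  | .while _ p => Option p.Lab
  | .run i => (E.tm i).Λ

instance Prog.labFintype : (p : Prog E) → Fintype p.Lab
  | .push _ _ | .pop _ _ | .query => inferInstanceAs (Fintype Unit)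
  | .seq p q => @instFintypeSum _ _ p.labFintype q.labFintype
  | .ite _ p q => @instFintypeOption _ (@instFintypeSum _ _ p.labFintype q.labFintype)
  | .while _ p => @instFintypeOption _ p.labFintype
  | .run i => inferInstanceAs (Fintype (E.tm i).Λ)

/-- The entry point of a compiled program. -/
def Prog.entry : (p : Prog E) → p.Lab
  | .push _ _ | .pop _ _ | .query => ()
  | .seq p _ => Sum.inl p.entry
  | .ite _ _ _ | .while _ _ => none
  | .run i => (E.tm i).main

/-- The internal states of the compiled program: the register, the internal states of the
machines, and the return address of a query. -/
abbrev Var (E : Env) (Λ : Type) : Type := Option Bool × (∀ i, (E.tm i).σ) × Λ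

/-- A statement of the `i`-th machine as a statement of the compiled program. -/
def trStmt {Λ : Type} (i : Fin 3) (emb : (E.tm i).Λ → Λ) (exit : Λ) :
    TM2.Stmt (E.tm i).Γ (E.tm i).Λ (E.tm i).σ → TM2.Stmt E.Γ Λ (Var E Λ)
  | .push k f q => .push (ext i k) (fun s => f (s.2.1 i)) (trStmt i emb exit q)
  | .peek k f q => .peek (ext i k) (fun s a => (s.1, update s.2.1 i (f (s.2.1 i) a), s.2.2))
      (trStmt i emb exit q)
  | .pop k f q => .pop (ext i k) (fun s a => (s.1, update s.2.1 i (f (s.2.1 i) a), s.2.2))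
      (trStmt i emb exit q)
  | .load a q => .load (fun s => (s.1, update s.2.1 i (a (s.2.1 i)), s.2.2))
      (trStmt i emb exit q)
  | .branch f q₁ q₂ => .branch (fun s => f (s.2.1 i)) (trStmt i emb exit q₁)
      (trStmt i emb exit q₂)
  | .goto f => .goto fun s => emb (f (s.2.1 i))
  | .halt => .goto fun _ => exit

/-- The compiled code of a program that continues at the label `exit` and makes its queries at the
label `qry`. -/
def Prog.code {Λ : Type} (qry : Λ) : (p : Prog E) → (p.Lab → Λ) → Λ → p.Lab →
    TM2.Stmt E.Γ Λ (Var E Λ)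
  | .push k f, _, exit, _ => .push k (fun s => f s.1) (.goto fun _ => exit)
  | .pop k f, _, exit, _ => .pop k (fun s a => (f a, s.2)) (.goto fun _ => exit)
  | .seq p q, emb, exit, l =>
    Sum.elim (p.code qry (fun l => emb (Sum.inl l)) (emb (Sum.inr q.entry)))
      (q.code qry (fun l => emb (Sum.inr l)) exit) l
  | .ite f p q, emb, exit, l =>
    Option.elim l
      (.branch (fun s => f s.1) (.goto fun _ => emb (some (Sum.inl p.entry)))
        (.goto fun _ => emb (some (Sum.inr q.entry))))
      (Sum.elim (p.code qry (fun l => emb (some (Sum.inl l))) exit)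
        (q.code qry (fun l => emb (some (Sum.inr l))) exit))
  | .while f p, emb, exit, l =>
    Option.elim l
      (.branch (fun s => f s.1) (.goto fun _ => emb (some p.entry)) (.goto fun _ => exit))
      (p.code qry (fun l => emb (some l)) (emb none))
  | .run i, emb, exit, l => trStmt i emb exit ((E.tm i).m l)
  | .query, _, exit, _ => .load (fun s => (s.1, s.2.1, exit)) (.goto fun _ => qry)

/-- The internal states of the machines between two calls. -/
def inits (E : Env) (i : Fin 3) : (E.tm i).σ := (E.tm i).initialState

/-- A translated statement touches only the stacks and the internal state of machine `i`. Its `halt`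
has become a jump to `exit`, which is why the label is read off by `Option.elim`. -/
theorem trStmt_stepAux {Λ : Type} {i : Fin 3} {emb : (E.tm i).Λ → Λ} {exit : Λ}
    (q : TM2.Stmt (E.tm i).Γ (E.tm i).Λ (E.tm i).σ) (r : Option Bool) (ret : Λ)
    (v : (E.tm i).σ) (stk : ∀ k, List ((E.tm i).Γ k)) (S : ∀ k, List (E.Γ k))
    (hS : ∀ k, S (ext i k) = stk k) :
    let c := TM2.stepAux q v stk
    ∃ S', TM2.stepAux (trStmt i emb exit q) (r, update (inits E) i v, ret) S =
        ⟨some (c.l.elim exit emb), (r, update (inits E) i c.var, ret), S'⟩ ∧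
      (∀ k, S' (ext i k) = c.stk k) ∧ ∀ k, (∀ k', k ≠ ext i k') → S' k = S k := by
  induction q generalizing v stk S with
  | push k f q ih =>
    obtain ⟨S', h1, h2, h3⟩ := ih v (update stk k (f v :: stk k))
      (update S (ext i k) (f v :: S (ext i k))) (by
        intro k'
        by_cases h : k' = k
        · subst h; simp [hS]
        · rw [update_of_ne h, update_of_ne (by simpa using h), hS])
    refine ⟨S', ?_, h2, fun k' hk' => ?_⟩
    · simpa [trStmt] using h1
    · rw [h3 k' hk', update_of_ne (hk' k)]
  | peek k f q ih =>
    obtain ⟨S', h1, h2, h3⟩ := ih (f v (stk k).head?) stk S hS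
    refine ⟨S', ?_, h2, h3⟩
    simpa [trStmt, hS] using h1
  | pop k f q ih =>
    obtain ⟨S', h1, h2, h3⟩ := ih (f v (stk k).head?) (update stk k (stk k).tail)
      (update S (ext i k) (S (ext i k)).tail) (by
        intro k'
        by_cases h : k' = k
        · subst h; simp [hS]
        · rw [update_of_ne h, update_of_ne (by simpa using h), hS])
    refine ⟨S', ?_, h2, fun k' hk' => ?_⟩
    · simpa [trStmt, hS] using h1
    · rw [h3 k' hk', update_of_ne (hk' k)]
  | load a q ih =>
    obtain ⟨S', h1, h2, h3⟩ := ih (a v) stk S hS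
    refine ⟨S', ?_, h2, h3⟩
    simpa [trStmt] using h1
  | branch f q₁ q₂ ih₁ ih₂ =>
    cases h : f v with
    | true =>
      obtain ⟨S', h1, h2, h3⟩ := ih₁ v stk S hS
      refine ⟨S', ?_, ?_, h3⟩
      · simpa [trStmt, h] using h1
      · simpa [h] using h2
    | false =>
      obtain ⟨S', h1, h2, h3⟩ := ih₂ v stk S hS
      refine ⟨S', ?_, ?_, h3⟩
      · simpa [trStmt, h] using h1
      · simpa [h] using h2
  | goto f => exact ⟨S, by simp [trStmt], by simpa using hS, fun _ _ => rfl⟩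
  | halt => exact ⟨S, by simp [trStmt], by simpa using hS, fun _ _ => rfl⟩

section Correctness

variable {Λ : Type} (m : Λ → TM2.Stmt E.Γ Λ (Var E Λ)) (qry yes no : Λ)

open Classical in
/-- One step of a compiled program. -/
noncomputable def cstep (c : TM2.Cfg E.Γ Λ (Var E Λ)) : Option (TM2.Cfg E.Γ Λ (Var E Λ)) :=
  if c.l = some qry then
    some ⟨some (if c.stk io ∈ E.B then yes else no), c.var, update c.stk io []⟩
  else TM2.step m c

theorem cstep_of_ne {l : Λ} (h : l ≠ qry) (v : Var E Λ) (S : ∀ k, List (E.Γ k)) :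
    cstep m qry yes no ⟨some l, v, S⟩ = some (TM2.stepAux (m l) v S) := by
  simp [cstep, h]

theorem steps_run {i : Fin 3} {emb : (E.tm i).Λ → Λ} {exit : Λ}
    (hm : ∀ l, m (emb l) = trStmt i emb exit ((E.tm i).m l)) (hq : ∀ l, emb l ≠ qry)
    (r : Option Bool) (ret : Λ) {n : ℕ} {c c' : (E.tm i).Cfg}
    (h : Steps (E.tm i).step n c c') (S : ∀ k, List (E.Γ k)) (hS : ∀ k, S (ext i k) = c.stk k) :
    ∃ S', Steps (cstep m qry yes no) n
        ⟨some (c.l.elim exit emb), (r, update (inits E) i c.var, ret), S⟩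
        ⟨some (c'.l.elim exit emb), (r, update (inits E) i c'.var, ret), S'⟩ ∧
      (∀ k, S' (ext i k) = c'.stk k) ∧ ∀ k, (∀ k', k ≠ ext i k') → S' k = S k := by
  induction n generalizing c S with
  | zero =>
    obtain rfl := Steps.zero_iff.1 h
    exact ⟨S, Steps.zero_iff.2 rfl, hS, fun _ _ => rfl⟩
  | succ n ih =>
    obtain ⟨b, hb, h'⟩ := Steps.succ_iff.1 h
    rcases c with ⟨l, v, stk⟩
    cases l with
    | none => simp [FinTM2.step] at hb
    | some l =>
      replace hb : TM2.stepAux ((E.tm i).m l) v stk = b := Option.some.inj hb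
      obtain ⟨S₁, h1, h2, h3⟩ := trStmt_stepAux (emb := emb) (exit := exit) ((E.tm i).m l) r ret v
        stk S hS
      rw [hb] at h1 h2
      obtain ⟨S₂, h4, h5, h6⟩ := ih h' S₁ h2
      refine ⟨S₂, Steps.head ?_ h4, h5, fun k hk => (h6 k hk).trans (h3 k hk)⟩
      exact (cstep_of_ne _ _ _ _ (hq l) _ _).trans ((hm l).symm ▸ congrArg some h1)

/-- Correctness of the compiler. Each rule of `Exec` charges exactly the steps that its code takes,
so the two times agree. The embedding of the labels is quantified in the conclusion, so that the
induction hypotheses apply to a subprogram wherever it is placed. The return address is existential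
because queries overwrite it. -/
theorem Exec.steps
    (hyes : m yes = .load (fun s => (some true, s.2)) (.goto fun s => s.2.2))
    (hno : m no = .load (fun s => (some false, s.2)) (.goto fun s => s.2.2))
    (hyq : yes ≠ qry) (hnq : no ≠ qry)
    {p : Prog E} {s s' : E.State} {t : ℕ} (h : Exec p s t s') :
    ∀ (emb : p.Lab → Λ) (exit ret : Λ), (∀ l, m (emb l) = p.code qry emb exit l) →
      (∀ l, emb l ≠ qry) → ∃ ret', Steps (cstep m qry yes no) t
        ⟨some (emb p.entry), (s.1, inits E, ret), s.2⟩
        ⟨some exit, (s'.1, inits E, ret'), s'.2⟩ := by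
  induction h with
  | push k f r S =>
    intro emb exit ret hm hq
    refine ⟨ret, Steps.single ?_⟩
    rw [cstep_of_ne _ _ _ _ (hq _), hm]
    simp [Prog.code]
  | pop k f r S =>
    intro emb exit ret hm hq
    refine ⟨ret, Steps.single ?_⟩
    rw [cstep_of_ne _ _ _ _ (hq _), hm]
    simp [Prog.code]
  | @seq p q s t s' t' s'' _ _ ih₁ ih₂ =>
    intro emb exit ret hm hq
    obtain ⟨ret₁, h₁⟩ := ih₁ (fun l => emb (Sum.inl l)) (emb (Sum.inr q.entry)) ret
      (fun l => hm (Sum.inl l)) (fun l => hq _)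
    obtain ⟨ret₂, h₂⟩ := ih₂ (fun l => emb (Sum.inr l)) exit ret₁
      (fun l => hm (Sum.inr l)) (fun l => hq _)
    exact ⟨ret₂, h₁.trans h₂⟩
  | @ite_true f p q r S t s' hf _ ih =>
    intro emb exit ret hm hq
    obtain ⟨ret₁, h₁⟩ := ih (fun l => emb (some (Sum.inl l))) exit ret
      (fun l => hm (some (Sum.inl l))) (fun l => hq _)
    refine ⟨ret₁, Nat.add_comm t 1 ▸ Steps.head ?_ h₁⟩
    rw [cstep_of_ne _ _ _ _ (hq _), hm]
    simp [Prog.code, Prog.entry, hf]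
  | @ite_false f p q r S t s' hf _ ih =>
    intro emb exit ret hm hq
    obtain ⟨ret₁, h₁⟩ := ih (fun l => emb (some (Sum.inr l))) exit ret
      (fun l => hm (some (Sum.inr l))) (fun l => hq _)
    refine ⟨ret₁, Nat.add_comm t 1 ▸ Steps.head ?_ h₁⟩
    rw [cstep_of_ne _ _ _ _ (hq _), hm]
    simp [Prog.code, Prog.entry, hf]
  | @while_false f p r S hf =>
    intro emb exit ret hm hq
    refine ⟨ret, Steps.single ?_⟩
    rw [cstep_of_ne _ _ _ _ (hq _), hm]
    simp [Prog.code, Prog.entry, hf]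
  | @while_true f p r S t s' t' s'' hf _ _ ih₁ ih₂ =>
    intro emb exit ret hm hq
    obtain ⟨ret₁, h₁⟩ := ih₁ (fun l => emb (some l)) (emb none) ret
      (fun l => hm (some l)) (fun l => hq _)
    obtain ⟨ret₂, h₂⟩ := ih₂ emb exit ret₁ hm hq
    refine ⟨ret₂, Nat.add_comm t 1 ▸ (Steps.head ?_ h₁).trans h₂⟩
    rw [cstep_of_ne _ _ _ _ (hq _), hm]
    simp [Prog.code, Prog.entry, hf]
  | run i r S S' w h₁ h₂ h₃ =>
    intro emb exit ret hm hq
    obtain ⟨S₁, h4, h5, h6⟩ := steps_run m qry yes no (emb := emb) (exit := exit) hm hq r ret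
      ((E.mach i).outputsFun w).evals_in_steps S h₁
    refine ⟨ret, ?_⟩
    have hS : S₁ = S' := by
      funext k
      by_cases hk : ∃ k', k = ext i k'
      · obtain ⟨k', rfl⟩ := hk
        exact (h5 k').trans (h₂ k').symm
      · push Not at hk
        rw [h6 k hk, h₃ k hk]
    subst hS
    -- The final configuration prescribed by `haltList` has the initial internal state, so the
    -- machine is ready for another call.
    have e : update (inits E) i (E.tm i).initialState = inits E := update_eq_self i (inits E)
    have h4' : Steps (cstep m qry yes no) ((E.mach i).outputsFun w).steps
        ⟨some (emb (E.tm i).main), (r, update (inits E) i (E.tm i).initialState, ret), S⟩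
        ⟨some exit, (r, update (inits E) i (E.tm i).initialState, ret), S₁⟩ := h4
    rwa [e] at h4'
  | query r S =>
    classical
    intro emb exit ret hm hq
    refine ⟨exit, Steps.head (b := ⟨some qry, (r, inits E, exit), S⟩) ?_
      (Steps.head (b := ⟨some (if S io ∈ E.B then yes else no), (r, inits E, exit),
        update S io []⟩) ?_ (Steps.single ?_))⟩
    · rw [cstep_of_ne _ _ _ _ (hq _), hm]
      simp [Prog.code]
    · simp [cstep]
    · by_cases hB : S io ∈ E.B
      · simp only [hB, if_true, decide_true]
        rw [cstep_of_ne _ _ _ _ hyq, hyes]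
        simp
      · simp only [hB, if_false, decide_false]
        rw [cstep_of_ne _ _ _ _ hnq, hno]
        simp

end Correctness

/-- The code of the oracle machine of a program. -/
def Prog.machineCode (p : Prog E) :
    p.Lab ⊕ Fin 4 → TM2.Stmt E.Γ (p.Lab ⊕ Fin 4) (Var E (p.Lab ⊕ Fin 4)) :=
  Sum.elim (p.code (Sum.inr 0) Sum.inl (Sum.inr 3))
    -- Label `0` is the query label, whose statement is never executed; labels `1` and `2` record
    -- the answer and return to the stored address; label `3` is the exit.
    ![.halt, .load (fun s => (some true, s.2)) (.goto fun s => s.2.2),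
      .load (fun s => (some false, s.2)) (.goto fun s => s.2.2), .halt]

/-- The oracle machine of a program: it accepts if the register contains `true` in the end. -/
def Prog.toOracleTM (p : Prog E) : OracleTM where
  tm :=
    { K := E.Stk
      k₀ := io
      k₁ := io
      Γ := E.Γ
      Λ := p.Lab ⊕ Fin 4
      main := Sum.inl p.entry
      σ := Var E (p.Lab ⊕ Fin 4)
      initialState := (none, inits E, Sum.inr 0)
      Γk₀Fin := inferInstanceAs (Fintype Bool)
      m := p.machineCode }
  finite_alphabet := by
    rintro (_ | _ | ⟨i, k⟩)
    · exact inferInstanceAs (Finite Bool)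
    · exact inferInstanceAs (Finite (Option Bool))
    · exact E.fin i k
  inputAlphabet := Equiv.refl Bool
  kq := io
  queryAlphabet := Equiv.refl Bool
  query := Sum.inr 0
  yes := Sum.inr 1
  no := Sum.inr 2
  accept := fun s => s.1 == some true

theorem polyTuringReduces_of_exec (p : Prog E) (b : Polynomial ℕ) (L : Set Str)
    (h : ∀ x : Str, ∃ t r S, t ≤ b.eval x.length ∧
      Exec p (none, update (fun _ => []) io x) t (r, S) ∧ (x ∈ L ↔ r = some true)) :
    PolyTuringReduces L E.B := by
  -- The additional step executes `halt` at the exit label.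
  refine ⟨p.toOracleTM, b + 1, fun x => ?_⟩
  obtain ⟨t, r, S, ht, he, hx⟩ := h x
  obtain ⟨ret, hs⟩ := he.steps p.machineCode (Sum.inr 0) (Sum.inr 1) (Sum.inr 2) rfl rfl
    (by simp) (by simp) Sum.inl (Sum.inr 3) (Sum.inr 0) (fun l => rfl) (by simp)
  have hstep : p.toOracleTM.step E.B = cstep p.machineCode (Sum.inr 0) (Sum.inr 1)
      (Sum.inr 2) := by
    funext c
    have : (c.stk p.toOracleTM.kq).map p.toOracleTM.queryAlphabet = c.stk p.toOracleTM.kq :=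
      List.map_id _
    unfold OracleTM.step
    rw [this]
    rfl
  have hinit : p.toOracleTM.init x =
      ⟨some (Sum.inl p.entry), (none, inits E, Sum.inr 0),
        (update (fun _ => []) io x : ∀ k, List (E.Γ k))⟩ := by
    have hx : x.map p.toOracleTM.inputAlphabet.symm = x := List.map_id _
    have hstk : (initList p.toOracleTM.tm x).stk =
        (update (fun _ => []) io x : ∀ k, List (E.Γ k)) := by
      funext k
      rcases k with _ | _ | ⟨i, k⟩ <;> rfl
    unfold OracleTM.init
    rw [hx, ← hstk]
    rfl
  have hlast : cstep p.machineCode (Sum.inr 0) (Sum.inr 1) (Sum.inr 2)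
      ⟨some (Sum.inr 3), (r, inits E, ret), S⟩ = some ⟨none, (r, inits E, ret), S⟩ := by
    rw [cstep_of_ne _ _ _ _ (by simp)]
    rfl
  refine ⟨⟨none, (r, inits E, ret), S⟩, ⟨⟨t + 1, ?_⟩, ?_⟩, rfl, ?_⟩
  · rw [hstep, hinit]
    exact hs.trans (Steps.single hlast)
  · simpa using ht
  · rw [hx]
    exact beq_iff_eq.symm

end CircuitRice

/-! ### Moving, exchanging, removing and duplicating trees on stacks -/

namespace CircuitRice

open Turing Function

open Env

variable {E : Env}

/-! ### Basic programs on the main stacks -/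

/-- The state of the stacks between two calls: only the main stacks are nonempty. -/
def stk (v : Fin 4 → List (Option Bool)) : ∀ k : E.Stk, List (E.Γ k)
  | none => []
  | some (Sum.inl j) => v j
  | some (Sum.inr _) => []

theorem update_stk (v : Fin 4 → List (Option Bool)) (j : Fin 4) (x : List (Option Bool)) :
    update (stk (E := E) v) (main j) x = stk (update v j x) := by
  funext k
  rcases k with _ | j' | ⟨i, k⟩
  · rfl
  · by_cases h : j' = j
    · subst h; simp [stk]
    · rw [update_of_ne (by simpa using h)]
      simp [stk, h]
  · rfl

theorem vec_update_zero {α : Type*} (a b c d x : α) : update ![a, b, c, d] 0 x = ![x, b, c, d] := by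
  ext i; fin_cases i <;> rfl

theorem vec_update_one {α : Type*} (a b c d x : α) : update ![a, b, c, d] 1 x = ![a, x, c, d] := by
  ext i; fin_cases i <;> rfl

theorem vec_update_two {α : Type*} (a b c d x : α) : update ![a, b, c, d] 2 x = ![a, b, x, d] := by
  ext i; fin_cases i <;> rfl

theorem Exec.congr {p : Prog E} {s s' s'' : E.State} {t t' : ℕ} (h : Exec p s t s') (hs : s' = s'')
    (ht : t = t') : Exec p s t' s'' := hs ▸ ht ▸ h

namespace Prog

/-- Push a fixed symbol. -/
abbrev put (j : Fin 4) (b : Option Bool) : Prog E := .push (main j) fun _ => b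

/-- Push the content of the register. -/
abbrev store (j : Fin 4) : Prog E := .push (main j) id

/-- Pop a symbol into the register. -/
abbrev fetch (j : Fin 4) : Prog E := .pop (main j) fun x => x.getD none

/-- The register contains `true`. -/
abbrev isTrue (r : Option Bool) : Bool := r == some true

/-- Move the symbols up to the next separator from the stack `i` to the stack `j`. -/
def flush (i j : Fin 4) : Prog E :=
  .seq (fetch i) (.while Option.isSome (.seq (store j) (fetch i)))

/-- The loop of `mv`. -/
def mvLoop (j : Fin 4) : Prog E :=
  .while isTrue (.seq (fetch 0) (.seq (store j)
    (.ite isTrue (.seq (put 3 (some true)) (.seq (put 3 (some true)) (fetch 3))) (fetch 3))))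

/-- Move a tree, reversed and with a separator, from stack `0` to the stack `j`. -/
def mv (j : Fin 4) : Prog E :=
  .seq (put j none) (.seq (put 3 none) (.seq (put 3 (some true)) (.seq (fetch 3) (mvLoop j))))

end Prog

open Prog

theorem exec_put (j : Fin 4) (b r : Option Bool) (v : Fin 4 → List (Option Bool)) :
    Exec (E := E) (put j b) (r, stk v) 1 (r, stk (update v j (b :: v j))) := by
  rw [← update_stk]; exact Exec.push _ _ _ _

theorem exec_store (j : Fin 4) (r : Option Bool) (v : Fin 4 → List (Option Bool)) :
    Exec (E := E) (store j) (r, stk v) 1 (r, stk (update v j (r :: v j))) := by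
  rw [← update_stk]; exact Exec.push _ _ _ _

theorem exec_fetch (j : Fin 4) (r b : Option Bool) (v : Fin 4 → List (Option Bool))
    {l : List (Option Bool)} (h : v j = b :: l) :
    Exec (E := E) (fetch j) (r, stk v) 1 (b, stk (update v j l)) := by
  rw [← update_stk]
  refine (Exec.pop _ _ _ _).congr ?_ rfl
  simp [stk, h]

theorem exec_flush_loop {i j : Fin 4} (hij : i ≠ j) (rest : List (Option Bool)) (l : List Bool)
    (x : Bool) (v : Fin 4 → List (Option Bool)) (h : v i = l.map some ++ none :: rest) :
    Exec (E := E) (.while Option.isSome (.seq (store j) (fetch i))) (some x, stk v)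
      (3 * (l.length + 1) + 1)
      (none, stk (update (update v i rest) j (l.reverse.map some ++ some x :: v j))) := by
  induction l generalizing x v with
  | nil =>
    refine (Exec.while_true rfl (.seq (exec_store _ _ _) (exec_fetch i _ none _ (l := rest) ?_))
      (.while_false rfl)).congr ?_ rfl
    · simpa [hij] using h
    · rw [update_comm hij]; rfl
  | cons y l ih =>
    have := ih y (update (update v j (some x :: v j)) i (l.map some ++ none :: rest)) (by simp)
    refine (Exec.while_true rfl (.seq (exec_store _ _ _)
      (exec_fetch i _ (some y) _ (l := l.map some ++ none :: rest) ?_)) this).congr ?_ ?_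
    · simpa [hij] using h
    · congr 2
      funext k
      by_cases hi : k = i
      · subst hi; simp [hij]
      by_cases hj : k = j
      · subst hj; simp [hij.symm]
      · simp [hi, hj]
    · simp; ring

/-- A flush reverses a block, and so does `mv`; hence `mv` followed by `flush` restores the original
order. -/
theorem exec_flush {i j : Fin 4} (hij : i ≠ j) (rest : List (Option Bool)) (l : List Bool)
    (r : Option Bool) (v : Fin 4 → List (Option Bool)) (h : v i = l.map some ++ none :: rest) :
    Exec (E := E) (flush i j) (r, stk v) (3 * l.length + 2)
      (none, stk (update (update v i rest) j (l.reverse.map some ++ v j))) := by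
  cases l with
  | nil =>
    refine (Exec.seq (exec_fetch i _ none _ (l := rest) h) (.while_false rfl)).congr ?_ rfl
    congr 1
    funext k
    have : update (update v i rest) j (v j) = update v i rest := by
      rw [update_eq_self_iff, update_of_ne hij.symm]
    simp [this]
  | cons y l =>
    refine (Exec.seq (exec_fetch i _ (some y) _ (l := l.map some ++ none :: rest) h)
      (exec_flush_loop hij rest l y _ (by simp))).congr ?_ ?_
    · rw [update_idem, update_of_ne hij.symm]; simp
    · simp; ring

/-! ### Trees -/

/-- Binary trees, the universal data type. -/
inductive BTree where
  | leaf
  | node (l r : BTree)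

/-- The code of a tree in preorder. -/
def BTree.code : BTree → List Bool
  | leaf => [false]
  | node l r => true :: (l.code ++ r.code)

/-- Preorder codes delimit themselves: the number of subtrees still to be read grows by one at a
node and drops by one at a leaf. The register and stack `3` hold this number in unary, above a
sentinel. The statement is in continuation form: the loop that goes on after the tree is a
hypothesis. In this form the two induction hypotheses for the subtrees of a node can be chained
within one run of the loop. -/
theorem exec_mvLoop {j : Fin 4} (hj : j ≠ 0) (hj3 : j ≠ 3) (t : BTree) :
    ∃ n ≤ 7 * t.code.length, ∀ (v : Fin 4 → List (Option Bool)) (rest : List (Option Bool))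
      (c : Option Bool) (cs : List (Option Bool)) (m : ℕ) (s' : E.State),
      v 0 = t.code.map some ++ rest → v 3 = c :: cs →
      Exec (mvLoop j) (c, stk (update (update (update v 0 rest) 3 cs) j
        (t.code.reverse.map some ++ v j))) m s' →
      Exec (mvLoop j) (some true, stk v) (n + m) s' := by
  induction t with
  | leaf =>
    refine ⟨5, by simp [BTree.code], fun v rest c cs m s' h0 h3 he => ?_⟩
    refine (Exec.while_true (t' := m) rfl (.seq (exec_fetch 0 _ (some false) v (l := rest) ?_)
      (.seq (exec_store _ _ _) (.ite_false rfl (exec_fetch 3 _ c _ (l := cs) ?_)))) ?_).congr rfl ?_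
    · simpa [BTree.code] using h0
    · rw [update_of_ne hj3.symm, update_of_ne (by decide), h3]
    · rw [update_comm hj3, update_of_ne hj]
      exact he
    · ring
  | node l r ihl ihr =>
    obtain ⟨n₁, hn₁, ih₁⟩ := ihl
    obtain ⟨n₂, hn₂, ih₂⟩ := ihr
    refine ⟨7 + n₁ + n₂, by simp [BTree.code]; omega, fun v rest c cs m s' h0 h3 he => ?_⟩
    refine (Exec.while_true rfl (.seq (exec_fetch 0 _ (some true) v
      (l := l.code.map some ++ (r.code.map some ++ rest)) ?_)
      (.seq (exec_store _ _ _) (.ite_true rfl (.seq (exec_put _ _ _ _) (.seq (exec_put _ _ _ _)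
        (exec_fetch 3 _ (some true) _ (l := some true :: c :: cs) ?_)))))) (ih₁ _
          (r.code.map some ++ rest) (some true)
        (c :: cs) _ s' ?_ ?_ (ih₂ _ rest c cs m s' ?_ ?_ ?_))).congr rfl ?_
    · simpa [BTree.code] using h0
    · simp [hj3.symm, h3]
    · simp [hj, hj.symm]
    · simp
    · simp [hj, hj.symm]
    · simp [hj3.symm]
    · convert he using 3
      funext k
      by_cases h0' : k = 0
      · subst h0'; simp [hj.symm]
      by_cases h3' : k = 3
      · subst h3'; simp [hj3.symm]
      by_cases hj' : k = j
      · subst hj'; simp [BTree.code, h0', h3']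
      · simp [h0', h3', hj']
    · ring

theorem exec_mv {j : Fin 4} (hj : j ≠ 0) (hj3 : j ≠ 3) (t : BTree) (r : Option Bool)
    (v : Fin 4 → List (Option Bool)) (rest : List (Option Bool))
    (h0 : v 0 = t.code.map some ++ rest) :
    ∃ n ≤ 7 * t.code.length + 5, Exec (E := E) (mv j) (r, stk v) n
      (none, stk (update (update v 0 rest) j (t.code.reverse.map some ++ none :: v j))) := by
  obtain ⟨n, hn, h⟩ := exec_mvLoop (E := E) hj hj3 t
  refine ⟨n + 5, by omega, ?_⟩
  refine (Exec.seq (exec_put _ _ _ _) (.seq (exec_put _ _ _ _) (.seq (exec_put _ _ _ _)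
    (.seq (exec_fetch 3 _ (some true) _ (l := none :: v 3) (by simp [hj3.symm]))
      (h _ rest none (v 3) 1 _ ?_ (by simp) (.while_false rfl)))))).congr ?_ (by ring)
  · simp [h0, hj.symm]
  · congr 2
    funext k
    by_cases h0' : k = 0
    · subst h0'; simp [hj.symm]
    by_cases h3' : k = 3
    · subst h3'; simp [hj3.symm]
    by_cases hj' : k = j
    · subst hj'; simp [h3']
    · simp [h0', h3', hj']

/-! ### Programs that act on the top of stack `0` -/

/-- Within `n` steps the program `P` replaces `x` by `y` on the top of stack `0`. -/
def Maps (P : Prog E) (n : ℕ) (x y : List Bool) : Prop :=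
  ∀ a b c d r, ∃ r' t, t ≤ n ∧ Exec P (r, stk ![x.map some ++ a, b, c, d]) t
    (r', stk ![y.map some ++ a, b, c, d])

namespace Maps

variable {P Q : Prog E} {n m : ℕ} {x y z w : List Bool}

theorem mono (h : Maps P n x y) (hn : n ≤ m) : Maps P m x y := fun a b c d r => by
  obtain ⟨r', t, ht, he⟩ := h a b c d r
  exact ⟨r', t, ht.trans hn, he⟩

theorem seq (h : Maps P n x y) (h' : Maps Q m y z) : Maps (.seq P Q) (n + m) x z :=
  fun a b c d r => by
    obtain ⟨r', t, ht, he⟩ := h a b c d r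
    obtain ⟨r'', t', ht', he'⟩ := h' a b c d r'
    exact ⟨r'', t + t', by omega, he.seq he'⟩

theorem append (h : Maps P n x y) (w : List Bool) : Maps P n (x ++ w) (y ++ w) :=
  fun a b c d r => by
    obtain ⟨r', t, ht, he⟩ := h (w.map some ++ a) b c d r
    exact ⟨r', t, ht, by simpa using he⟩

theorem put (b : Bool) (x : List Bool) : Maps (E := E) (.put 0 (some b)) 1 x (b :: x) :=
  fun a _ _ _ r => ⟨r, 1, le_rfl, (exec_put _ _ _ _).congr (by simp [vec_update_zero]) rfl⟩

theorem fetch (b : Bool) (x : List Bool) : Maps (E := E) (.fetch 0) 1 (b :: x) x :=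
  fun a _ _ _ r => ⟨some b, 1, le_rfl,
    (exec_fetch 0 r (some b) _ (l := x.map some ++ a) (by simp)).congr
      (by simp [vec_update_zero]) rfl⟩

theorem branch_true (h : Maps P n x y) :
    Maps (.seq (.fetch 0) (.ite isTrue P Q)) (n + 2) (true :: x) y := fun a b c d r => by
  obtain ⟨r', t, ht, he⟩ := h a b c d (some true)
  exact ⟨r', 1 + (1 + t), by omega, .seq
    (exec_fetch 0 r (some true) _ (l := x.map some ++ a) (by simp))
    (.ite_true rfl (by rwa [vec_update_zero]))⟩

theorem branch_false (h : Maps Q n x y) :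
    Maps (.seq (.fetch 0) (.ite isTrue P Q)) (n + 2) (false :: x) y := fun a b c d r => by
  obtain ⟨r', t, ht, he⟩ := h a b c d (some false)
  exact ⟨r', 1 + (1 + t), by omega, .seq
    (exec_fetch 0 r (some false) _ (l := x.map some ++ a) (by simp))
    (.ite_false rfl (by rwa [vec_update_zero]))⟩

/-- Run a program below the top tree. -/
theorem dip (h : Maps P n x y) (t : BTree) :
    Maps (.seq (mv 1) (.seq P (flush 1 0))) (n + 10 * t.code.length + 7)
      (t.code ++ x) (t.code ++ y) := fun a b c d r => by
  obtain ⟨k, hk, h1⟩ := exec_mv (E := E) (j := 1) (by decide) (by decide) t r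
    ![(t.code ++ x).map some ++ a, b, c, d] (x.map some ++ a) (by simp)
  rw [vec_update_zero, vec_update_one] at h1
  obtain ⟨r', k', hk', h2⟩ := h a (t.code.reverse.map some ++ none :: b) c d none
  have h3 := exec_flush (E := E) (i := 1) (j := 0) (by decide) b t.code.reverse r'
    ![y.map some ++ a, t.code.reverse.map some ++ none :: b, c, d] (by simp)
  rw [vec_update_one, vec_update_zero] at h3
  exact ⟨none, _, by simp; omega, (h1.seq (h2.seq h3)).congr (by simp) rfl⟩

end Maps

namespace Prog

/-- Exchange the top two trees. -/
def swap : Prog E := .seq (mv 1) (.seq (mv 2) (.seq (flush 1 0) (flush 2 0)))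

/-- Remove the top tree. -/
def drop : Prog E :=
  .seq (mv 1) (.seq (fetch 1) (.while Option.isSome (fetch 1)))

/-- Duplicate the top tree. -/
def dup : Prog E :=
  .seq (mv 1) (.seq (.seq (put 2 none) (.seq (fetch 1)
    (.while Option.isSome (.seq (store 0) (.seq (store 2) (fetch 1))))))
      (.seq (put 1 none) (.seq (flush 2 1) (flush 1 0))))

end Prog

namespace Maps

/-- The trees are parked on different stacks, and the former top tree is brought back first, so that
it ends up below. -/
theorem swap (s t : BTree) : Maps (E := E) .swap (10 * s.code.length + 10 * t.code.length + 14)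
    (s.code ++ t.code) (t.code ++ s.code) := fun a b c d r => by
  obtain ⟨k, hk, h1⟩ := exec_mv (E := E) (j := 1) (by decide) (by decide) s r
    ![(s.code ++ t.code).map some ++ a, b, c, d] (t.code.map some ++ a) (by simp)
  rw [vec_update_zero, vec_update_one] at h1
  obtain ⟨k', hk', h2⟩ := exec_mv (E := E) (j := 2) (by decide) (by decide) t none
    ![t.code.map some ++ a, s.code.reverse.map some ++ none :: b, c, d] a (by simp)
  rw [vec_update_zero, vec_update_two] at h2
  have h3 := exec_flush (E := E) (i := 1) (j := 0) (by decide) b s.code.reverse none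
    ![a, s.code.reverse.map some ++ none :: b, t.code.reverse.map some ++ none :: c, d] (by simp)
  rw [vec_update_one, vec_update_zero] at h3
  have h4 := exec_flush (E := E) (i := 2) (j := 0) (by decide) c t.code.reverse none
    ![s.code.reverse.reverse.map some ++ a, b, t.code.reverse.map some ++ none :: c, d] (by simp)
  rw [vec_update_two, vec_update_zero] at h4
  exact ⟨none, _, by simp; omega, (h1.seq (h2.seq (h3.seq h4))).congr (by simp) rfl⟩

theorem exec_dropLoop (l : List Bool) (x : Option Bool) (a b c d : List (Option Bool)) :
    Exec (E := E) (.seq (.fetch 1) (.while Option.isSome (.fetch 1)))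
      (x, stk ![a, l.map some ++ none :: b, c, d]) (2 * l.length + 2)
      (none, stk ![a, b, c, d]) := by
  have key : ∀ (l : List Bool) (x : Bool), Exec (E := E) (.while Option.isSome (.fetch 1))
      (some x, stk ![a, l.map some ++ none :: b, c, d]) (2 * l.length + 3)
      (none, stk ![a, b, c, d]) := by
    intro l
    induction l with
    | nil =>
      intro x
      refine (Exec.while_true rfl (exec_fetch 1 _ none _ (l := b) (by simp))
        (.while_false rfl)).congr (by rw [vec_update_one]) rfl
    | cons y l ih =>
      intro x
      refine (Exec.while_true rfl (exec_fetch 1 _ (some y) _ (l := l.map some ++ none :: b)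
        (by simp)) (by rw [vec_update_one]; exact ih y)).congr rfl (by simp; ring)
  cases l with
  | nil =>
    refine (Exec.seq (exec_fetch 1 _ none _ (l := b) (by simp))
        (.while_false rfl)).congr (by rw [vec_update_one]) rfl
  | cons y l =>
    refine (Exec.seq (exec_fetch 1 _ (some y) _ (l := l.map some ++ none :: b)
        (by simp)) (by rw [vec_update_one]; exact key l y)).congr rfl (by simp; ring)

theorem drop (t : BTree) (x : List Bool) :
    Maps (E := E) .drop (9 * t.code.length + 7) (t.code ++ x) x := fun a b c d r => by
  obtain ⟨k, hk, h1⟩ := exec_mv (E := E) (j := 1) (by decide) (by decide) t r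
    ![(t.code ++ x).map some ++ a, b, c, d] (x.map some ++ a) (by simp)
  rw [vec_update_zero, vec_update_one] at h1
  exact ⟨none, _, by simp; omega, h1.seq (exec_dropLoop _ _ _ _ _ _)⟩

theorem exec_dupLoop (l : List Bool) (x : Option Bool) (a b c d : List (Option Bool)) :
    Exec (E := E) (.seq (.fetch 1)
      (.while Option.isSome (.seq (.store 0) (.seq (.store 2) (.fetch 1)))))
      (x, stk ![a, l.map some ++ none :: b, c, d]) (4 * l.length + 2)
      (none, stk ![l.reverse.map some ++ a, b, l.reverse.map some ++ c, d]) := by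
  have key : ∀ (l : List Bool) (x : Bool) (a c : List (Option Bool)), Exec (E := E)
      (.while Option.isSome (.seq (.store 0) (.seq (.store 2) (.fetch 1))))
      (some x, stk ![a, l.map some ++ none :: b, c, d]) (4 * l.length + 5)
      (none, stk ![l.reverse.map some ++ some x :: a, b,
        l.reverse.map some ++ some x :: c, d]) := by
    intro l
    induction l with
    | nil =>
      intro x a c
      refine (Exec.while_true rfl (.seq (exec_store _ _ _) (.seq (exec_store _ _ _)
        (exec_fetch 1 _ none _ (l := b) (by simp)))) (.while_false rfl)).congr ?_ rfl
      simp [vec_update_one, vec_update_zero, vec_update_two]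
    | cons y l ih =>
      intro x a c
      refine (Exec.while_true rfl (.seq (exec_store _ _ _) (.seq (exec_store _ _ _)
        (exec_fetch 1 _ (some y) _ (l := l.map some ++ none :: b) (by simp))))
        (by
          rw [vec_update_zero, vec_update_two, vec_update_one]
          exact ih y _ _)).congr (by simp) (by simp; ring)
  cases l with
  | nil =>
    exact (Exec.seq (exec_fetch 1 _ none _ (l := b) (by simp))
        (.while_false rfl)).congr (by rw [vec_update_one]; rfl) rfl
  | cons y l =>
    refine (Exec.seq (exec_fetch 1 _ (some y) _ (l := l.map some ++ none :: b)
        (by simp)) (by rw [vec_update_one]; exact key l y _ _)).congr (by simp) (by simp; ring)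

/-- The copying loop restores one copy on stack `0` and leaves the other in forward order on stack
`2`; two flushes are needed to bring that one back in the right order. -/
theorem dup (t : BTree) :
    Maps (E := E) .dup (17 * t.code.length + 15) t.code (t.code ++ t.code) := fun a b c d r => by
  obtain ⟨k, hk, h1⟩ := exec_mv (E := E) (j := 1) (by decide) (by decide) t r
    ![t.code.map some ++ a, b, c, d] a (by simp)
  rw [vec_update_zero, vec_update_one] at h1
  have h2 := exec_dupLoop (E := E) t.code.reverse none a b (none :: c) d
  have h2' := (exec_put (E := E) 2 none none
    ![a, t.code.reverse.map some ++ none :: b, c, d]).seq ((vec_update_two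
      a (t.code.reverse.map some ++ none :: b) c d (none :: c)) ▸ h2)
  have h3 := exec_put (E := E) 1 none none
    ![t.code.reverse.reverse.map some ++ a, b, t.code.reverse.reverse.map some ++ none :: c, d]
  rw [vec_update_one] at h3
  have h4 := exec_flush (E := E) (i := 2) (j := 1) (by decide) c t.code none
    ![t.code.reverse.reverse.map some ++ a, none :: b,
      t.code.reverse.reverse.map some ++ none :: c, d] (by simp)
  rw [vec_update_two, vec_update_one] at h4
  have h5 := exec_flush (E := E) (i := 1) (j := 0) (by decide) b t.code.reverse none
    ![t.code.reverse.reverse.map some ++ a, t.code.reverse.map some ++ none :: b, c, d] (by simp)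
  rw [vec_update_one, vec_update_zero] at h5
  exact ⟨none, _, by simp; omega, (h1.seq (h2'.seq (h3.seq (h4.seq h5)))).congr (by simp) rfl⟩

end Maps

end CircuitRice

/-! ### Polynomial-time functions on tree-coded data and their closure properties -/

namespace CircuitRice

open Turing Function

open Env

variable {E : Env}

open Prog

/-! ### Data types and polynomial-time functions -/

/-- A type whose elements are represented by trees. -/
class Data (α : Type) where
  tree : α → BTree

/-- The code of a piece of data. -/
def code {α : Type} [Data α] (a : α) : List Bool := (Data.tree a).code

/-- The length of the code of a piece of data. -/
def size {α : Type} [Data α] (a : α) : ℕ := (code a).length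

instance : Data Unit := ⟨fun _ => .leaf⟩

instance : Data Bool := ⟨fun b => if b then .node .leaf .leaf else .leaf⟩

instance {α β : Type} [Data α] [Data β] : Data (α × β) :=
  ⟨fun x => .node (Data.tree x.1) (Data.tree x.2)⟩

/-- A nonempty list has the same code as the pair of its head and tail, so passing from one to the
other costs nothing. -/
instance {α : Type} [Data α] : Data (List α) :=
  ⟨fun l => l.foldr (fun a t => .node (Data.tree a) t) .leaf⟩

section Data

variable {α β : Type} [Data α] [Data β]

theorem code_unit (u : Unit) : code u = [false] := rfl

theorem code_false : code false = [false] := rfl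

theorem code_true : code true = [true, false, false] := rfl

theorem code_pair (a : α) (b : β) : code (a, b) = true :: (code a ++ code b) := rfl

theorem code_nil : code ([] : List α) = [false] := rfl

theorem code_cons (a : α) (l : List α) : code (a :: l) = true :: (code a ++ code l) := rfl

theorem size_pair (a : α) (b : β) : size (a, b) = size a + size b + 1 := by
  simp [size, code_pair]

theorem size_nil : size ([] : List α) = 1 := rfl

theorem size_cons (a : α) (l : List α) : size (a :: l) = size a + size l + 1 := by
  simp [size, code_cons]

theorem length_le_size (l : List α) : l.length ≤ size l := by
  induction l with
  | nil => simp
  | cons a l ih => rw [size_cons, List.length_cons]; omega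

theorem size_append (l l' : List α) : size (l ++ l') + 1 = size l + size l' := by
  induction l with
  | nil => simp [size_nil, add_comm]
  | cons a l ih => rw [List.cons_append, size_cons, size_cons]; omega

theorem size_le_of_mem {a : α} {l : List α} (h : a ∈ l) : size a ≤ size l := by
  induction l with
  | nil => simp at h
  | cons b l ih =>
    rw [size_cons]
    rcases List.mem_cons.1 h with rfl | h
    · omega
    · have := ih h; omega

theorem size_bools_le (l : List Bool) : size l ≤ 4 * l.length + 1 := by
  induction l with
  | nil => simp [size_nil]
  | cons a l ih =>
    have : size a ≤ 3 := by cases a <;> decide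
    rw [size_cons, List.length_cons]; omega

end Data

theorem polynomial_eval_mono (p : Polynomial ℕ) {m n : ℕ} (h : m ≤ n) : p.eval m ≤ p.eval n := by
  rw [Polynomial.eval_eq_sum, Polynomial.eval_eq_sum]
  exact Finset.sum_le_sum fun i _ => Nat.mul_le_mul_left _ (Nat.pow_le_pow_left h i)

/-- The function `f` can be computed in polynomial time on the top of the first main stack. -/
@[fun_prop]
def PolyTime (E : Env) {α β : Type} [Data α] [Data β] (f : α → β) : Prop :=
  ∃ (P : Prog E) (p : Polynomial ℕ), ∀ a,
    Maps P (p.eval (size a)) (code a) (code (f a)) ∧ size (f a) ≤ p.eval (size a)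

section

variable {α β : Type} [Data α] [Data β]

theorem maps_dup (a : α) : Maps (E := E) .dup (17 * size a + 15) (code a) (code a ++ code a) :=
  Maps.dup (Data.tree a)

theorem maps_drop (a : α) (x : List Bool) :
    Maps (E := E) .drop (9 * size a + 7) (code a ++ x) x :=
  Maps.drop (Data.tree a) x

theorem maps_swap (a : α) (b : β) : Maps (E := E) .swap (10 * size a + 10 * size b + 14)
    (code a ++ code b) (code b ++ code a) :=
  Maps.swap (Data.tree a) (Data.tree b)

end

namespace PolyTime

variable {α β γ δ : Type} [Data α] [Data β] [Data γ] [Data δ]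

theorem intro {f : α → β} (P : Prog E) (p q : Polynomial ℕ)
    (hp : ∀ a, Maps P (p.eval (size a)) (code a) (code (f a)))
    (hq : ∀ a, size (f a) ≤ q.eval (size a)) : PolyTime E f :=
  ⟨P, p + q, fun a => ⟨(hp a).mono (by simp), (hq a).trans (by simp)⟩⟩

/-- A polynomial bound for the size of the values. -/
theorem size_le {f : α → β} (h : PolyTime E f) :
    ∃ p : Polynomial ℕ, ∀ a, size (f a) ≤ p.eval (size a) := by
  obtain ⟨P, p, h⟩ := h
  exact ⟨p, fun a => (h a).2⟩

/-- `PolyTime` sees only codes. A function that acts on codes as `f` does is computed by the same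
program, even if its types are different. -/
theorem of_code_eq {f : α → β} {g : γ → δ} (h : PolyTime E f) (i : γ → α)
    (h₁ : ∀ c, code c = code (i c)) (h₂ : ∀ c, code (g c) = code (f (i c))) : PolyTime E g := by
  obtain ⟨P, p, h⟩ := h
  refine ⟨P, p, fun c => ?_⟩
  have := h (i c)
  simp only [size, h₁, h₂] at this ⊢
  exact this

-- The time of the outer program is polynomial in the size of the intermediate value. The size bound
-- that is part of `PolyTime` makes it polynomial in the size of the input.
@[fun_prop]
theorem comp {f : β → γ} {g : α → β} (hf : PolyTime E f) (hg : PolyTime E g) :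
    PolyTime E fun a => f (g a) := by
  obtain ⟨P, p, hf⟩ := hf
  obtain ⟨Q, q, hg⟩ := hg
  refine .intro (.seq Q P) (q + p.comp q) (p.comp q) (fun a => ?_) fun a => ?_
  · refine ((hg a).1.seq (hf (g a)).1).mono ?_
    simpa using polynomial_eval_mono p (hg a).2
  · simpa using (hf (g a)).2.trans (polynomial_eval_mono p (hg a).2)

@[fun_prop]
theorem id' : PolyTime E fun a : α => a := by
  -- The language has no empty program; pushing and popping a symbol takes its place.
  refine .intro (.seq (.put 0 (some true)) (.fetch 0)) 2 Polynomial.X (fun a => ?_) (by simp)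
  simpa using (Maps.put true (code a)).seq (Maps.fetch true (code a))

theorem exists_putList (l : List Bool) : ∃ (P : Prog E) (n : ℕ), ∀ x, Maps P n x (l ++ x) := by
  induction l with
  | nil =>
    exact ⟨.seq (.put 0 (some true)) (.fetch 0), _, fun x => (Maps.put true x).seq (.fetch _ _)⟩
  | cons b l ih =>
    obtain ⟨P, n, h⟩ := ih
    exact ⟨.seq P (.put 0 (some b)), _, fun x => (h x).seq (Maps.put b _)⟩

@[fun_prop]
theorem const (b : β) : PolyTime E fun _ : α => b := by
  obtain ⟨P, n, h⟩ := exists_putList (E := E) (code b)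
  refine .intro (.seq .drop P) (9 * Polynomial.X + 7 + Polynomial.C n) (Polynomial.C (size b))
    (fun a => ?_) (by simp)
  have := (maps_drop (E := E) a []).seq (h [])
  simp only [List.append_nil] at this
  refine this.mono ?_
  simp

@[fun_prop]
theorem fst : PolyTime E (Prod.fst : α × β → α) := by
  refine .intro (.seq (.fetch 0) (.seq .swap .drop)) (20 * Polynomial.X + 30) Polynomial.X
    (fun a => ?_) fun a => ?_
  · have := (Maps.fetch (E := E) true _).seq ((maps_swap a.1 a.2).seq
      (maps_drop a.2 (code a.1)))
    refine this.mono ?_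
    obtain ⟨a, b⟩ := a
    rw [size_pair]
    simp
    omega
  · obtain ⟨a, b⟩ := a
    simp [size_pair]
    omega

@[fun_prop]
theorem snd : PolyTime E (Prod.snd : α × β → β) := by
  refine .intro (.seq (.fetch 0) .drop) (20 * Polynomial.X + 30) Polynomial.X
    (fun a => ?_) fun a => ?_
  · have := (Maps.fetch (E := E) true _).seq
      (maps_drop a.1 (code a.2))
    refine this.mono ?_
    obtain ⟨a, b⟩ := a
    rw [size_pair]
    simp
    omega
  · obtain ⟨a, b⟩ := a
    simp [size_pair]
    omega

@[fun_prop]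
theorem prodMk {f : α → β} {g : α → γ} (hf : PolyTime E f) (hg : PolyTime E g) :
    PolyTime E fun a => (f a, g a) := by
  obtain ⟨P, p, hf⟩ := hf
  obtain ⟨Q, q, hg⟩ := hg
  refine .intro (.seq .dup (.seq Q (.seq .swap (.seq P (.put 0 (some true))))))
    (27 * Polynomial.X + 30 + 11 * q + p) (p + q + 1) (fun a => ?_) fun a => ?_
  · have := (maps_dup (E := E) a).seq (((hg a).1.append (code a)).seq
      ((maps_swap (g a) a).seq (((hf a).1.append (code (g a))).seq
        (Maps.put true _))))
    refine this.mono ?_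
    have h1 := (hg a).2
    simp
    omega
  · have := (hf a).2
    have := (hg a).2
    simp [size_pair]
    omega

@[fun_prop]
theorem ite {c : α → Bool} {f g : α → β} (hc : PolyTime E c) (hf : PolyTime E f)
    (hg : PolyTime E g) : PolyTime E fun a => if c a then f a else g a := by
  obtain ⟨R, r, hc⟩ := hc
  obtain ⟨P, p, hf⟩ := hf
  obtain ⟨Q, q, hg⟩ := hg
  -- The first symbol of the code of a Boolean is the Boolean itself. The code of `true` has two
  -- more symbols, which the first branch has to remove.
  refine .intro (.seq .dup (.seq R (.seq (.fetch 0) (.ite isTrue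
    (.seq (.fetch 0) (.seq (.fetch 0) P)) Q)))) (17 * Polynomial.X + 30 + r + p + q) (p + q)
    (fun a => ?_) fun a => ?_
  · have h1 := (hc a).1.append (code a)
    cases hca : c a with
    | true =>
      rw [hca] at h1
      refine ((maps_dup a).seq (h1.seq (.branch_true (x := false :: false :: code a)
        ((Maps.fetch _ _).seq ((Maps.fetch _ _).seq (hf a).1))))).mono ?_
      simp
      omega
    | false =>
      rw [hca] at h1
      refine ((maps_dup a).seq (h1.seq (.branch_false (x := code a) (hg a).1))).mono ?_
      simp
      omega
  · have := (hf a).2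
    have := (hg a).2
    cases c a <;> simp <;> omega

/-- Case distinction on a list. -/
theorem listCases {f : α → List γ} {g : α → β} {h : α → γ → List γ → β} (hf : PolyTime E f)
    (hg : PolyTime E g) (hh : PolyTime E fun x : α × γ × List γ => h x.1 x.2.1 x.2.2) :
    PolyTime E fun a => match f a with
      | [] => g a
      | c :: l => h a c l := by
  obtain ⟨R, r, hf⟩ := hf
  obtain ⟨P, p, hh⟩ := hh
  obtain ⟨Q, q, hg⟩ := hg
  -- The tag of the list has been consumed. Pushing `true` turns head and tail into a pair; after
  -- the swap, another `true` pairs the parameter with it.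
  refine .intro (.seq .dup (.seq R (.seq (.fetch 0) (.ite isTrue
    (.seq (.put 0 (some true)) (.seq .swap (.seq (.put 0 (some true)) P))) Q))))
    (30 * Polynomial.X + 40 + 11 * r + p.comp (Polynomial.X + r + 1) + q)
    (p.comp (Polynomial.X + r + 1) + q) (fun a => ?_) fun a => ?_
  · have h1 := (hf a).1.append (code a)
    have h2 := (hf a).2
    cases hca : f a with
    | cons c l =>
      rw [hca] at h1 h2
      have h3 := (hh (a, c, l)).1
      have h4 : size (a, c, l) ≤ size a + r.eval (size a) + 1 := by
        rw [size_pair, size_pair]; rw [size_cons] at h2; omega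
      have h5 := polynomial_eval_mono p h4
      refine ((maps_dup a).seq (h1.seq (.branch_true
        (x := code c ++ code l ++ code a) ((Maps.put _ _).seq ((maps_swap (c, l) a).seq
          ((Maps.put _ _).seq h3)))))).mono ?_
      rw [size_pair] at h4 ⊢
      rw [size_cons] at h2
      simp at h5 ⊢
      omega
    | nil =>
      rw [hca] at h1
      refine ((maps_dup a).seq (h1.seq (.branch_false (x := code a) (hg a).1))).mono ?_
      simp
      omega
  · have h2 := (hf a).2
    cases hca : f a with
    | cons c l =>
      rw [hca, size_cons] at h2
      have h4 : size (a, c, l) ≤ size a + r.eval (size a) + 1 := by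
        rw [size_pair, size_pair]; omega
      have h5 := polynomial_eval_mono p h4
      have h6 := (hh (a, c, l)).2
      simp at h5 ⊢
      simp at h6
      omega
    | nil =>
      have := (hg a).2
      simp
      omega

@[fun_prop]
theorem cons {f : α → β} {g : α → List β} (hf : PolyTime E f) (hg : PolyTime E g) :
    PolyTime E fun a => f a :: g a :=
  (hf.prodMk hg).of_code_eq id (fun _ => rfl) fun _ => rfl

/-- Each round consumes a tag of the list, exchanges the head with the tail, and runs the body on
head and accumulator underneath the tail. Since `N` bounds the list and all intermediate
accumulators, all rounds obey the same time bound. -/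
theorem maps_foldLoop {h : α × β → β} {P : Prog E} {p : Polynomial ℕ}
    (hP : ∀ x, Maps P (p.eval (size x)) (code x) (code (h x))) (N : ℕ) (l : List α) (s : β)
    (hl : size l ≤ N) (hs : ∀ l', l' <+: l → size (l'.foldl (fun s a => h (a, s)) s) ≤ N)
    (c d e : List (Option Bool)) (a : List (Option Bool)) (r : Option Bool) :
    ∃ r' t, t ≤ 2 + l.length * (p.eval (2 * N + 1) + 40 * N + 40) ∧
      Exec (.seq (.fetch 0) (.while isTrue (.seq (.seq .swap (.seq (mv 1) (.seq
        (.seq (.put 0 (some true)) P) (flush 1 0)))) (.fetch 0))))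
      (r, stk ![(code l ++ code s).map some ++ a, c, d, e]) t
      (r', stk ![(code (l.foldl (fun s a => h (a, s)) s)).map some ++ a, c, d, e]) := by
  induction l generalizing s r with
  | nil =>
    refine ⟨some false, 1 + 1, by simp, .seq (exec_fetch 0 _ (some false) _
      (l := (code s).map some ++ a) (by simp [code_nil])) ?_⟩
    rw [vec_update_zero]
    exact .while_false rfl
  | cons x l ih =>
    rw [size_cons] at hl
    have hs1 := hs [] (List.nil_prefix)
    have h1 := (maps_swap (E := E) x l).append (code s)
    have h2 := (((Maps.put (E := E) true _).seq (hP (x, s)))).dip (Data.tree l)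
    have h2' : Maps (.seq (mv 1) (.seq (.seq (.put 0 (some true)) P) (flush 1 0)))
        (1 + p.eval (size (x, s)) + 10 * size l + 7) (code l ++ code x ++ code s)
        (code l ++ code (h (x, s))) := by
      rw [List.append_assoc]; exact h2
    obtain ⟨r₁, t₁, ht₁, e₁⟩ := (h1.seq h2') a c d e (some true)
    obtain ⟨r₂, t₂, ht₂, e₂⟩ := ih (h (x, s)) (by omega) (fun l' hl' => by
      have := hs (x :: l') (by simpa using hl')
      simpa using this) r₁
    -- The run given by the induction hypothesis begins by fetching the next tag. In the actual loop
    -- this fetch closes the current round, so the run is cut after it.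
    cases e₂ with
    | @seq _ _ _ t₃ s₃ t₄ _ e₃ e₄ =>
    refine ⟨r₂, 1 + (1 + (t₁ + t₃) + t₄), ?_, .seq (exec_fetch 0 _ (some true) _
      (l := (code x ++ code l ++ code s).map some ++ a) (by simp [code_cons]))
      (.while_true rfl (.seq ?_ e₃) e₄)⟩
    · have h3 : size (x, s) ≤ 2 * N + 1 := by rw [size_pair]; simp at hs1; omega
      have h4 := polynomial_eval_mono p h3
      rw [List.length_cons, Nat.succ_mul]
      omega
    · rw [vec_update_zero]
      exact e₁

/-- Folding over a list, if the intermediate values are polynomially bounded. -/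
theorem foldl {f : α → List γ} {g : α → β} {h : α → β → γ → β} (hf : PolyTime E f)
    (hg : PolyTime E g) (hh : PolyTime E fun x : α × β × γ => h x.1 x.2.1 x.2.2)
    (q : Polynomial ℕ)
    (hq : ∀ a, ∀ l', l' <+: f a → size (l'.foldl (h a) (g a)) ≤ q.eval (size a)) :
    PolyTime E fun a => (f a).foldl (h a) (g a) := by
  -- The loop body sees only a list element and the accumulator, so the parameter travels inside the
  -- accumulator.
  have hH : PolyTime E fun x : γ × α × β => (x.2.1, h x.2.1 x.2.2 x.1) := by
    refine .prodMk (.comp .fst .snd) (.comp (f := fun x : α × β × γ => h x.1 x.2.1 x.2.2)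
      (g := fun x : γ × α × β => (x.2.1, x.2.2, x.1)) hh ?_)
    fun_prop
  have hfg : PolyTime E fun a => (f a, a, g a) := by fun_prop
  obtain ⟨P, p, hP⟩ := hH
  obtain ⟨F, u, hF⟩ := hfg
  have hfold : ∀ (a : α) (l : List γ) (s : β),
      l.foldl (fun (s : α × β) (c : γ) => (s.1, h s.1 s.2 c)) (a, s) =
      (a, l.foldl (h a) s) := by
    intro a l
    induction l with
    | nil => simp
    | cons c l ih => intro s; exact ih _
  let N : Polynomial ℕ := u + q + Polynomial.X + 1
  refine .intro (.seq F (.seq (.fetch 0) (.seq (.seq (.fetch 0) (.while isTrue (.seq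
    (.seq .swap (.seq (mv 1) (.seq (.seq (.put 0 (some true)) P) (flush 1 0)))) (.fetch 0))))
      (.seq (.fetch 0) .drop)))) (u + 20 + 9 * Polynomial.X +
        N * (p.comp (2 * N + 1) + 40 * N + 40)) q (fun a => ?_) fun a => ?_
  · have h1 := hF a
    have hfa : size (f a) ≤ N.eval (size a) := by
      have := h1.2
      rw [size_pair] at this
      simp [N]
      omega
    have h2 : Maps (.seq (.fetch 0) (.while isTrue (.seq (.seq .swap (.seq (mv 1) (.seq
        (.seq (.put 0 (some true)) P) (flush 1 0)))) (.fetch 0))))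
        (2 + (f a).length * (p.eval (2 * N.eval (size a) + 1) +
        40 * N.eval (size a) + 40)) (code (f a) ++ code (a, g a))
        (code (a, (f a).foldl (h a) (g a))) := fun b c d e r => by
      have := maps_foldLoop (E := E) (fun x => (hP x).1) (N.eval (size a)) (f a) (a, g a) hfa
        (fun l' hl' => by
          rw [hfold, size_pair]
          have := hq a l' hl'
          simp [N]
          omega) c d e b r
      rwa [hfold] at this
    refine (h1.1.seq ((Maps.fetch _ _).seq (h2.seq ((Maps.fetch _ _).seq
      (maps_drop a _))))).mono ?_
    have h3 := Nat.mul_le_mul_right (p.eval (2 * N.eval (size a) + 1) +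
        40 * N.eval (size a) + 40) ((length_le_size _).trans hfa)
    simp only [Polynomial.eval_add, Polynomial.eval_mul, Polynomial.eval_comp, Polynomial.eval_X,
      Polynomial.eval_ofNat, Polynomial.eval_one] at h3 ⊢
    omega
  · exact hq a _ (List.prefix_refl _)

end PolyTime

end CircuitRice

/-! ### Input, oracle queries and subroutine calls as polynomial-time operations -/

namespace CircuitRice

open Turing Function

open Env

variable {E : Env}

open Prog

/-! ### Transfer of strings between stacks -/

theorem update_stk_ext (v : Fin 4 → List (Option Bool)) (j : Fin 4) (x : List (Option Bool))
    {k : E.Stk} (hk : ∀ j, k ≠ main j) (l : List (E.Γ k)) :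
    update (update (stk (E := E) v) k l) (main j) x = update (stk (update v j x)) k l := by
  rw [update_comm (hk j), update_stk]

theorem stk_ext (v : Fin 4 → List (Option Bool)) {k : E.Stk} (hk : ∀ j, k ≠ main j) :
    stk v k = [] := by
  rcases k with _ | j' | ⟨i, k⟩
  · rfl
  · exact absurd rfl (hk j')
  · rfl

theorem update_stk_nil (v : Fin 4 → List (Option Bool)) {k : E.Stk} (hk : ∀ j, k ≠ main j) :
    update (stk (E := E) v) k [] = stk v := by
  rw [update_eq_self_iff, stk_ext v hk]

theorem exec_put_ext {k : E.Stk} (hk : ∀ j, k ≠ main j) (l : List (E.Γ k)) (j : Fin 4)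
    (b r : Option Bool) (v : Fin 4 → List (Option Bool)) :
    Exec (E := E) (put j b) (r, update (stk v) k l) 1
      (r, update (stk (update v j (b :: v j))) k l) := by
  rw [← update_stk_ext _ _ _ hk]
  refine (Exec.push _ _ _ _).congr ?_ rfl
  rw [update_of_ne (hk j).symm]
  rfl

theorem exec_store_ext {k : E.Stk} (hk : ∀ j, k ≠ main j) (l : List (E.Γ k)) (j : Fin 4)
    (r : Option Bool) (v : Fin 4 → List (Option Bool)) :
    Exec (E := E) (store j) (r, update (stk v) k l) 1
      (r, update (stk (update v j (r :: v j))) k l) := by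
  rw [← update_stk_ext _ _ _ hk]
  refine (Exec.push _ _ _ _).congr ?_ rfl
  rw [update_of_ne (hk j).symm]
  rfl

theorem exec_fetch_ext {k : E.Stk} (hk : ∀ j, k ≠ main j) (m : List (E.Γ k)) (j : Fin 4)
    (r b : Option Bool) (v : Fin 4 → List (Option Bool)) {l : List (Option Bool)}
    (h : v j = b :: l) :
    Exec (E := E) (fetch j) (r, update (stk v) k m) 1 (b, update (stk (update v j l)) k m) := by
  rw [← update_stk_ext _ _ _ hk]
  refine (Exec.pop _ _ _ _).congr ?_ rfl
  rw [update_of_ne (hk j).symm]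
  simp [stk, h]

namespace Prog

/-- Push the tree of a Boolean constant. -/
def putBool (b : Bool) : Prog E :=
  if b then .seq (put 0 (some false)) (.seq (put 0 (some false)) (put 0 (some true)))
  else put 0 (some false)

/-- Move a string from the top of stack `0`, reversed, to stack `1`. -/
def unlist : Prog E :=
  .seq (put 1 none) (.seq (fetch 0) (.while isTrue (.seq (fetch 0) (.ite isTrue
    (.seq (store 1) (.seq (fetch 0) (.seq (fetch 0) (fetch 0))))
    (.seq (store 1) (fetch 0))))))

/-- Move a reversed string from stack `1` to stack `0`. -/
def relist : Prog E :=
  .seq (put 0 (some false)) (.seq (fetch 1) (.while Option.isSome (.seq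
    (.ite isTrue (putBool true) (putBool false)) (.seq (put 0 (some true)) (fetch 1)))))

/-- Move a reversed string from stack `1` to an external stack. -/
def storeString (k : E.Stk) (e : Bool → E.Γ k) : Prog E :=
  .seq (fetch 1) (.while Option.isSome (.seq (.push k fun r => e (r.getD false)) (fetch 1)))

/-- Move a string from an external stack, reversed, to stack `1`. -/
def fetchString (k : E.Stk) (e : E.Γ k → Bool) : Prog E :=
  .seq (put 1 none) (.seq (.pop k (Option.map e))
    (.while Option.isSome (.seq (store 1) (.pop k (Option.map e)))))

end Prog

theorem exec_putBool (x r : Bool) (a b c d : List (Option Bool)) :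
    ∃ n ≤ 3, Exec (E := E) (putBool x) (some r, stk ![a, b, c, d]) n
      (some r, stk ![(code x).map some ++ a, b, c, d]) := by
  cases x with
  | false =>
    refine ⟨1, by simp, (exec_put _ _ _ _).congr ?_ rfl⟩
    rw [vec_update_zero]
    rfl
  | true =>
    refine ⟨3, by simp, (Exec.seq (exec_put _ _ _ _) (.seq (exec_put _ _ _ _)
      (exec_put _ _ _ _))).congr ?_ rfl⟩
    rw [vec_update_zero, vec_update_zero, vec_update_zero]
    rfl

theorem exec_unlist (l : List Bool) (r : Option Bool) (a b c d : List (Option Bool)) :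
    ∃ n ≤ 8 * l.length + 3, Exec (E := E) unlist (r, stk ![(code l).map some ++ a, b, c, d]) n
      (some false, stk ![a, l.reverse.map some ++ none :: b, c, d]) := by
  have key : ∀ (l : List Bool) (r : Option Bool) (b : List (Option Bool)),
      ∃ n ≤ 8 * l.length + 2, Exec (E := E)
      (.seq (fetch 0) (.while isTrue (.seq (fetch 0) (.ite isTrue
        (.seq (store 1) (.seq (fetch 0) (.seq (fetch 0) (fetch 0)))) (.seq (store 1) (fetch 0))))))
      (r, stk ![(code l).map some ++ a, b, c, d]) n
      (some false, stk ![a, l.reverse.map some ++ b, c, d]) := by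
    intro l
    induction l with
    | nil =>
      intro r b
      refine ⟨2, by simp, (Exec.seq (exec_fetch 0 _ (some false) _ (l := a) (by simp [code_nil]))
        (.while_false rfl)).congr (by rw [vec_update_zero]; rfl) rfl⟩
    | cons x l ih =>
      intro r b
      obtain ⟨n, hn, h⟩ := ih (some false) (some x :: b)
      cases h with
      | @seq _ _ _ t₃ s₃ t₄ _ e₃ e₄ =>
      cases x with
      | false =>
        refine ⟨1 + (1 + (1 + (1 + (1 + t₃))) + t₄), by simp; omega, Exec.congr (.seq
          (exec_fetch 0 _ (some true) _ (l := some false :: ((code l).map some ++ a))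
            (by simp [code_cons, code_false]))
          (.while_true rfl (.seq (exec_fetch 0 _ (some false) _ (l := (code l).map some ++ a)
            (by simp)) (.ite_false rfl (.seq (exec_store _ _ _) ?_))) e₄)) (by simp) rfl⟩
        rw [vec_update_zero, vec_update_zero, vec_update_one]
        exact e₃
      | true =>
        refine ⟨1 + (1 + (1 + (1 + (1 + (1 + (1 + t₃))))) + t₄), by simp; omega, Exec.congr (.seq
          (exec_fetch 0 _ (some true) _
            (l := some true :: some false :: some false :: ((code l).map some ++ a))
            (by simp [code_cons, code_true]))
          (.while_true rfl (.seq (exec_fetch 0 _ (some true) _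
            (l := some false :: some false :: ((code l).map some ++ a)) (by simp)) (.ite_true rfl
            (.seq (exec_store _ _ _) (.seq (exec_fetch 0 _ (some false) _
            (l := some false :: ((code l).map some ++ a)) (by simp)) (.seq (exec_fetch 0 _
            (some false) _ (l := ((code l).map some ++ a)) (by simp)) ?_))))) e₄)) (by simp) rfl⟩
        rw [vec_update_zero, vec_update_zero, vec_update_one, vec_update_zero, vec_update_zero]
        exact e₃
  obtain ⟨n, hn, h⟩ := key l r (none :: b)
  refine ⟨1 + n, by omega, .seq (exec_put _ _ _ _) ?_⟩
  rw [vec_update_one]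
  exact h

theorem exec_relist (l : List Bool) (r : Option Bool) (a b c d : List (Option Bool)) :
    ∃ n ≤ 7 * l.length + 3, Exec (E := E) relist
      (r, stk ![a, l.reverse.map some ++ none :: b, c, d]) n
      (none, stk ![(code l).map some ++ a, b, c, d]) := by
  have key : ∀ (l m : List Bool) (r : Option Bool),
      ∃ n ≤ 7 * l.length + 2, Exec (E := E)
      (.seq (fetch 1) (.while Option.isSome (.seq
        (.ite isTrue (putBool true) (putBool false)) (.seq (put 0 (some true)) (fetch 1)))))
      (r, stk ![(code m).map some ++ a, l.map some ++ none :: b, c, d]) n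
      (none, stk ![(code (l.reverse ++ m)).map some ++ a, b, c, d]) := by
    intro l
    induction l with
    | nil =>
      intro m r
      refine ⟨2, by simp, (Exec.seq (exec_fetch 1 _ none _ (l := b) (by simp))
        (.while_false rfl)).congr (by rw [vec_update_one]; rfl) rfl⟩
    | cons x l ih =>
      intro m r
      obtain ⟨n, hn, h⟩ := ih (x :: m) (some x)
      cases h with
      | @seq _ _ _ t₃ s₃ t₄ _ e₃ e₄ =>
      obtain ⟨k, hk, h⟩ := exec_putBool (E := E) x x ((code m).map some ++ a)
        (l.map some ++ none :: b) c d
      refine ⟨1 + (1 + (1 + k + (1 + t₃)) + t₄), by simp; omega, Exec.congr (.seq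
        (exec_fetch 1 _ (some x) _ (l := l.map some ++ none :: b) (by simp))
        (.while_true rfl (.seq (s' := (some x, stk ![(code x).map some ++ ((code m).map some ++ a),
          l.map some ++ none :: b, c, d])) ?_ (.seq (exec_put _ _ _ _) ?_)) e₄)) (by simp) rfl⟩
      · rw [vec_update_one]
        cases x with
        | true => exact .ite_true rfl h
        | false => exact .ite_false rfl h
      · rw [vec_update_zero]
        simpa [code_cons] using e₃
  obtain ⟨n, hn, h⟩ := key l.reverse [] r
  refine ⟨1 + n, by simp at hn; omega, .seq (exec_put _ _ _ _) ?_⟩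
  rw [vec_update_zero]
  simpa [code_nil] using h

theorem exec_export {k : E.Stk} (hk : ∀ j, k ≠ main j) (e : Bool → E.Γ k) (l : List Bool)
    (r : Option Bool) (a b c d : List (Option Bool)) :
    Exec (E := E) (storeString k e) (r, stk ![a, l.reverse.map some ++ none :: b, c, d])
      (3 * l.length + 2) (none, update (stk ![a, b, c, d]) k (l.map e)) := by
  have key : ∀ (l : List Bool) (m : List (E.Γ k)) (r : Option Bool), Exec (E := E) (storeString k e)
      (r, update (stk ![a, l.map some ++ none :: b, c, d]) k m) (3 * l.length + 2)
      (none, update (stk ![a, b, c, d]) k (l.reverse.map e ++ m)) := by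
    intro l
    induction l with
    | nil =>
      intro m r
      refine (Exec.seq (exec_fetch_ext hk _ 1 _ none _ (l := b) (by simp))
        (.while_false rfl)).congr (by rw [vec_update_one]; rfl) rfl
    | cons x l ih =>
      intro m r
      have h := ih (e x :: m) (some x)
      generalize hn : 3 * l.length + 2 = n at h
      cases h with
      | @seq _ _ _ t₃ s₃ t₄ _ e₃ e₄ =>
      refine (Exec.seq
        (exec_fetch_ext hk _ 1 _ (some x) _ (l := l.map some ++ none :: b) (by simp))
        (.while_true rfl (.seq (t' := t₃) (.push _ _ _ _) ?_) e₄)).congr (by simp) ?_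
      · rw [vec_update_one, update_idem, update_self]
        exact e₃
      · simp; omega
  have h := key l.reverse [] r
  rw [update_stk_nil _ hk] at h
  simpa using h

theorem exec_import {k : E.Stk} (hk : ∀ j, k ≠ main j) (e : E.Γ k → Bool) (l : List (E.Γ k))
    (r : Option Bool) (a b c d : List (Option Bool)) :
    Exec (E := E) (fetchString k e) (r, update (stk ![a, b, c, d]) k l) (3 * l.length + 3)
      (none, stk ![a, (l.map e).reverse.map some ++ none :: b, c, d]) := by
  have key : ∀ (l : List (E.Γ k)) (b : List (Option Bool)) (r : Option Bool), Exec (E := E)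
      (.seq (.pop k (Option.map e)) (.while Option.isSome (.seq (store 1) (.pop k (Option.map e)))))
      (r, update (stk ![a, b, c, d]) k l) (3 * l.length + 2)
      (none, stk ![a, (l.map e).reverse.map some ++ b, c, d]) := by
    intro l
    induction l with
    | nil =>
      intro b r
      refine (Exec.seq (t := 1) (t' := 1) (Exec.pop _ _ _ _) ?_).congr rfl rfl
      have : (Option.map e (update (stk ![a, b, c, d]) k [] k).head?,
          update (update (stk ![a, b, c, d]) k []) k (update (stk ![a, b, c, d]) k [] k).tail) =
          ((none, stk ![a, b, c, d]) : E.State) := by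
        simp [update_stk_nil _ hk]
      rw [this]
      exact .while_false rfl
    | cons x l ih =>
      intro b r
      have h := ih (some (e x) :: b) (some (e x))
      generalize hn : 3 * l.length + 2 = n at h
      cases h with
      | @seq _ _ _ t₃ s₃ t₄ _ e₃ e₄ =>
      refine (Exec.seq (t := 1) (t' := 1 + (1 + t₃) + t₄) (Exec.pop _ _ _ _) ?_).congr rfl
        (by simp; omega)
      simp only [update_self, update_idem, List.head?_cons, Option.map_some, List.tail_cons]
      refine .while_true rfl (.seq (exec_store_ext hk _ _ _ _) ?_) (e₄.congr (by simp) rfl)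
      rw [vec_update_one]
      exact e₃
  refine (Exec.seq (exec_put_ext hk _ _ _ _ _) (t' := 3 * l.length + 2) ?_).congr rfl (by ring)
  rw [vec_update_one]
  exact key l _ r

/-! ### Oracle queries and calls of the given functions -/

-- The string is unpacked from its tree onto the query stack. The query erases that stack, so only
-- the main stacks are in use again, and the answer is rebuilt from the register as a tree.
open Classical in
theorem PolyTime.query : PolyTime E fun w : Str => decide (w ∈ E.B) := by
  refine .intro (.seq unlist (.seq (storeString io fun b => b) (.seq .query
    (.ite isTrue (putBool true) (putBool false))))) (20 * Polynomial.X + 20) 3 (fun w => ?_)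
    fun w => ?_
  · intro a b c d r
    obtain ⟨n, hn, h⟩ := exec_unlist (E := E) w r a b c d
    have h2 := exec_export (E := E) (k := io) (by simp) (fun b => b) w (some false) a b c d
    have h3 := Exec.query none (update (stk (E := E) ![a, b, c, d]) io (w.map fun b => b))
    rw [update_self, update_idem, update_stk_nil _ (by simp), List.map_id'] at h3
    obtain ⟨m, hm, h4⟩ := exec_putBool (E := E) (decide (w ∈ E.B)) (decide (w ∈ E.B)) a b c d
    refine ⟨some (decide (w ∈ E.B)), n + (3 * w.length + 2 + (3 + (1 + m))), ?_,
      .seq h (.seq h2 (.seq (s' := (some (decide (w ∈ E.B)), stk ![a, b, c, d])) ?_ ?_))⟩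
    · have := length_le_size w
      simp
      omega
    · rw [List.map_id']; exact h3
    · cases hb : decide (w ∈ E.B) with
      | true => rw [hb] at h4; exact .ite_true rfl h4
      | false => rw [hb] at h4; exact .ite_false rfl h4
  · cases decide (w ∈ E.B) <;> simp [size, code_true, code_false]

/-- The maximal number of basic instructions on a path through a statement. -/
def stmtDepth {K : Type*} {Γ : K → Type*} {Λ σ : Type*} : TM2.Stmt Γ Λ σ → ℕ
  | .push _ _ q | .peek _ _ q | .pop _ _ q | .load _ q => stmtDepth q + 1
  | .branch _ q₁ q₂ => max (stmtDepth q₁) (stmtDepth q₂) + 1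
  | .goto _ | .halt => 1

theorem length_stepAux_le {K : Type*} [DecidableEq K] {Γ : K → Type*} {Λ σ : Type*}
    (q : TM2.Stmt Γ Λ σ) (v : σ) (S : ∀ k, List (Γ k)) (k : K) :
    ((TM2.stepAux q v S).stk k).length ≤ (S k).length + stmtDepth q := by
  induction q generalizing v S with
  | push k' f q ih =>
    refine (ih _ _).trans ?_
    by_cases h : k = k'
    · subst h; simp [stmtDepth]; try omega
    · simp [stmtDepth, h]; try omega
  | peek k' f q ih => exact (ih _ _).trans (by simp [stmtDepth])
  | pop k' f q ih =>
    refine (ih _ _).trans ?_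
    by_cases h : k = k'
    · subst h; simp [stmtDepth]; try omega
    · simp [stmtDepth, h]; try omega
  | load a q ih => exact (ih _ _).trans (by simp [stmtDepth])
  | branch f q₁ q₂ ih₁ ih₂ =>
    simp only [TM2.stepAux, stmtDepth]
    cases f v
    · exact (ih₂ v S).trans (by omega)
    · exact (ih₁ v S).trans (by omega)
  | goto f => simp
  | halt => simp

/-- One step runs one statement, and the depth of a statement bounds the number of its pushes. There
are finitely many labels, so one constant serves for all. -/
theorem exists_length_le (tm : FinTM2) : ∃ d, ∀ (n : ℕ) (c c' : tm.Cfg), Steps tm.step n c c' →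
    ∀ k, (c'.stk k).length ≤ (c.stk k).length + d * n := by
  refine ⟨Finset.univ.sup fun l => stmtDepth (tm.m l), fun n => ?_⟩
  induction n with
  | zero =>
    intro c c' h k
    rw [Steps.zero_iff.1 h]
    simp
  | succ n ih =>
    intro c c' h k
    obtain ⟨b, hb, h'⟩ := Steps.succ_iff.1 h
    rcases c with ⟨l, v, S⟩
    cases l with
    | none => exact absurd hb (Option.some_ne_none b).symm
    | some l =>
      replace hb : TM2.stepAux (tm.m l) v S = b := Option.some.inj hb
      have h1 := ih b c' h' k
      have h2 := length_stepAux_le (tm.m l) v S k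
      have h3 : stmtDepth (tm.m l) ≤ Finset.univ.sup fun l => stmtDepth (tm.m l) :=
        Finset.le_sup (f := fun l => stmtDepth (tm.m l)) (Finset.mem_univ l)
      rw [hb] at h2
      rw [Nat.mul_succ]
      have h4 : (TM2.Cfg.stk ⟨some l, v, S⟩ k).length = (S k).length := rfl
      exact h1.trans (by omega)

theorem initList_stk (tm : FinTM2) (s : List (tm.Γ tm.k₀)) (k : tm.K) :
    (initList tm s).stk k = update (fun _ => []) tm.k₀ s k := by
  by_cases h : k = tm.k₀
  · subst h; simp [initList]
  · simp [initList, h]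

theorem haltList_stk (tm : FinTM2) (s : List (tm.Γ tm.k₁)) (k : tm.K) :
    (haltList tm s).stk k = update (fun _ => []) tm.k₁ s k := by
  by_cases h : k = tm.k₁
  · subst h; simp [haltList]
  · simp [haltList, h]

/-- The output is the content of a stack at the end, which can exceed the input length by at most a
constant for each step. This is the source of the size bound for calls. -/
theorem exists_output_length_le (E : Env) (i : Fin 3) : ∃ d, ∀ w,
    (E.φ i w).length ≤ w.length + d * (E.mach i).time.eval w.length := by
  obtain ⟨d, hd⟩ := exists_length_le (E.tm i)
  refine ⟨d, fun w => ?_⟩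
  have h := hd _ _ _ ((E.mach i).outputsFun w).evals_in_steps (E.tm i).k₁
  have h' := ((E.mach i).outputsFun w).steps_le_m
  have h1 : ((haltList (E.tm i) (List.map (E.mach i).outputAlphabet.invFun (E.φ i w))).stk
      (E.tm i).k₁).length = (E.φ i w).length := by
    rw [haltList_stk, update_self, List.length_map]
  have h2 : ((initList (E.tm i) (List.map (E.mach i).inputAlphabet.invFun w)).stk
      (E.tm i).k₁).length ≤ w.length := by
    rw [initList_stk]
    by_cases hk : (E.tm i).k₁ = (E.tm i).k₀
    · rw [hk, update_self, List.length_map]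
    · rw [update_of_ne hk]; simp
  exact h1.symm.le.trans (h.trans (Nat.add_le_add h2 (Nat.mul_le_mul_left _ h')))

/-- A machine halts with all its stacks empty except the output stack, and reading the output
empties that one too. So a call leaves nothing behind. -/
theorem PolyTime.call (i : Fin 3) : PolyTime E (E.φ i) := by
  obtain ⟨d, hd⟩ := exists_output_length_le E i
  have hd' : ∀ w : Str, (E.φ i w).length ≤ size w + d * (E.mach i).time.eval (size w) := fun w =>
    (hd w).trans (Nat.add_le_add (length_le_size w)
      (Nat.mul_le_mul_left _ (polynomial_eval_mono _ (length_le_size w))))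
  refine .intro (.seq unlist (.seq (storeString (ext i (E.tm i).k₀) (E.mach i).inputAlphabet.invFun)
    (.seq (.run i) (.seq (fetchString (ext i (E.tm i).k₁) (E.mach i).outputAlphabet) relist))))
    (12 * Polynomial.X + 20 + (E.mach i).time +
      10 * (Polynomial.X + Polynomial.C d * (E.mach i).time))
    (4 * (Polynomial.X + Polynomial.C d * (E.mach i).time) + 1) (fun w => ?_) fun w => ?_
  · intro a b c e r
    obtain ⟨n, hn, h⟩ := exec_unlist (E := E) w r a b c e
    have h2 := exec_export (E := E) (k := ext i (E.tm i).k₀) (by simp)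
      (E.mach i).inputAlphabet.invFun w (some false) a b c e
    have h3 := Exec.run i none (update (stk ![a, b, c, e]) (ext i (E.tm i).k₀)
      (w.map (E.mach i).inputAlphabet.invFun)) (update (stk ![a, b, c, e]) (ext i (E.tm i).k₁)
      ((E.φ i w).map (E.mach i).outputAlphabet.invFun)) w (fun k => by
        rw [initList_stk]
        by_cases hk : k = (E.tm i).k₀
        · subst hk; rw [update_self, update_self]
        · rw [update_of_ne hk, update_of_ne (by simpa using hk)]; rfl) (fun k => by
        rw [haltList_stk]
        by_cases hk : k = (E.tm i).k₁
        · subst hk; rw [update_self, update_self]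
        · rw [update_of_ne hk, update_of_ne (by simpa using hk)]; rfl) (fun k hk => by
        rw [update_of_ne (hk _), update_of_ne (hk _)])
    have h4 := exec_import (E := E) (k := ext i (E.tm i).k₁) (by simp)
      (E.mach i).outputAlphabet ((E.φ i w).map (E.mach i).outputAlphabet.invFun) none a b c e
    have h5 : (((E.φ i w).map (E.mach i).outputAlphabet.invFun).map (E.mach i).outputAlphabet) =
        E.φ i w := by simp
    rw [h5, List.length_map] at h4
    obtain ⟨m, hm, h6⟩ := exec_relist (E := E) (E.φ i w) none a b c e
    refine ⟨_, _, ?_, h.seq (h2.seq (h3.seq (h4.seq h6)))⟩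
    have h7 := ((E.mach i).outputsFun w).steps_le_m
    have h8 := polynomial_eval_mono (E.mach i).time (length_le_size w)
    have h9 := hd' w
    have h10 := length_le_size w
    simp only [id] at h7
    simp
    omega
  · have h9 := hd' w
    refine (size_bools_le _).trans ?_
    simp
    omega

-- The code of the answer begins with the answer itself. Fetching this symbol puts it into the
-- register, where acceptance is decided; what remains on the stacks is irrelevant.
open Classical in
theorem polyTuringReduces_of_polyTime {L : Set Str} (h : PolyTime E fun x : Str => decide (x ∈ L)) :
    PolyTuringReduces L E.B := by
  obtain ⟨P, p, h⟩ := h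
  refine polyTuringReduces_of_exec
    (.seq (fetchString io fun b => b) (.seq relist (.seq P (fetch 0))))
    (10 * Polynomial.X + 20 + p.comp (4 * Polynomial.X + 1)) L fun x => ?_
  have h1 := exec_import (E := E) (k := io) (by simp) (fun b => b) x none [] [] [] []
  have h0 : stk (E := E) ![[], [], [], []] = fun _ => [] := by
    funext k
    rcases k with _ | j | ⟨i, k⟩
    · rfl
    · fin_cases j <;> rfl
    · rfl
  rw [h0, List.map_id'] at h1
  obtain ⟨n, hn, h2⟩ := exec_relist (E := E) x none [] [] [] []
  obtain ⟨r, t, ht, h3⟩ := (h x).1 [] [] [] [] none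
  have h4 : ∃ l, (code (decide (x ∈ L))) = decide (x ∈ L) :: l := by
    cases decide (x ∈ L)
    · exact ⟨_, code_false⟩
    · exact ⟨_, code_true⟩
  obtain ⟨l, hl⟩ := h4
  refine ⟨_, _, _, ?_, h1.seq (h2.seq (h3.seq (exec_fetch 0 _ (some (decide (x ∈ L))) _
    (l := l.map some) ?_))), ?_⟩
  · have h5 := polynomial_eval_mono p (size_bools_le x)
    simp
    omega
  · rw [hl]; simp
  · simp

end CircuitRice

/-! ### List operations, unary arithmetic and finite case distinctions in polynomial time -/

namespace CircuitRice

open Function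

variable {E : Env}

/-! ### A library of polynomial-time functions -/

/-- Numbers are coded in unary, as suits lengths and gate positions; large numbers are kept as lists
of binary digits instead. -/
instance : Data ℕ := ⟨fun n => Data.tree (List.replicate n ())⟩

instance {α : Type} [Data α] : Data (Option α) := ⟨fun o => Data.tree o.toList⟩

section

variable {α β γ : Type} [Data α] [Data β] [Data γ]

theorem code_nat (n : ℕ) : code n = code (List.replicate n ()) := rfl

theorem size_nat (n : ℕ) : size n = 2 * n + 1 := by
  rw [size, code_nat, ← size]
  induction n with
  | zero => rfl
  | succ n ih =>
    rw [List.replicate_succ, size_cons, ih]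
    simp [size, code_unit]
    ring

end

namespace PolyTime

variable {α β γ δ : Type} [Data α] [Data β] [Data γ] [Data δ]

/-- Folding over a list, if each step increases the size by a bounded amount. -/
theorem foldl_of_growth {f : α → List γ} {g : α → β} {h : α → β → γ → β} (hf : PolyTime E f)
    (hg : PolyTime E g) (hh : PolyTime E fun x : α × β × γ => h x.1 x.2.1 x.2.2)
    (q : Polynomial ℕ)
    (hq : ∀ a s c, size (h a s c) ≤ size s + q.eval (size a + size c)) :
    PolyTime E fun a => (f a).foldl (h a) (g a) := by
  obtain ⟨p, hp⟩ := hf.size_le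
  obtain ⟨r, hr⟩ := hg.size_le
  refine foldl hf hg hh (r + p * q.comp (Polynomial.X + p)) fun a l hl => ?_
  have key : ∀ (l : List γ) (s : β), (∀ c ∈ l, size c ≤ size (f a)) →
      size (l.foldl (h a) s) ≤ size s + l.length * q.eval (size a + size (f a)) := by
    intro l
    induction l with
    | nil => simp
    | cons c l ih =>
      intro s hc
      refine (ih _ fun c' hc' => hc c' (List.mem_cons_of_mem _ hc')).trans ?_
      have h1 := hq a s c
      have h2 := polynomial_eval_mono q
        (Nat.add_le_add_left (hc c List.mem_cons_self) (size a))
      rw [List.length_cons, Nat.succ_mul]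
      omega
  refine (key l _ fun c hc => size_le_of_mem (hl.subset hc)).trans ?_
  have h1 := hp a
  have h2 := polynomial_eval_mono q (Nat.add_le_add_left (hp a) (size a))
  have h3 : l.length ≤ p.eval (size a) :=
    hl.length_le.trans ((length_le_size _).trans (hp a))
  have h4 := Nat.mul_le_mul h3 h2
  have := hr a
  simp
  omega

@[fun_prop]
theorem reverse {f : α → List β} (hf : PolyTime E f) : PolyTime E fun a => (f a).reverse := by
  have := foldl_of_growth (g := fun _ : α => ([] : List β)) (h := fun _ s c => c :: s) hf (const _)
    (by fun_prop) (Polynomial.X + 1) (fun a s c => by rw [size_cons]; simp; omega)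
  simpa using this

@[fun_prop]
theorem append {f g : α → List β} (hf : PolyTime E f) (hg : PolyTime E g) :
    PolyTime E fun a => f a ++ g a := by
  have := foldl_of_growth (g := g) (h := fun _ s c => c :: s) hf.reverse hg
    (by fun_prop) (Polynomial.X + 1) (fun a s c => by rw [size_cons]; simp; omega)
  simpa using this

@[fun_prop]
theorem map {f : α → List β} {h : α → β → γ} (hf : PolyTime E f)
    (hh : PolyTime E fun x : α × β => h x.1 x.2) : PolyTime E fun a => (f a).map (h a) := by
  obtain ⟨p, hp⟩ := hh.size_le
  have := foldl_of_growth (g := fun _ : α => ([] : List γ)) (h := fun a s c => h a c :: s) hf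
    (const _) (.cons (.comp (f := fun x : α × β => h x.1 x.2) hh
      (g := fun x : α × List γ × β => (x.1, x.2.2)) (by fun_prop)) (by fun_prop))
      (p.comp (Polynomial.X + 1) + 1) (fun a s c => by
        have : size (h a c) ≤ _ := hp (a, c)
        rw [size_pair] at this
        rw [size_cons]
        simp
        omega)
  simpa using this.reverse

@[fun_prop]
theorem flatMap {f : α → List β} {h : α → β → List γ} (hf : PolyTime E f)
    (hh : PolyTime E fun x : α × β => h x.1 x.2) : PolyTime E fun a => (f a).flatMap (h a) := by
  obtain ⟨p, hp⟩ := hh.size_le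
  have := foldl_of_growth (g := fun _ : α => ([] : List γ)) (h := fun a s c => s ++ h a c) hf
    (const _) (.append (by fun_prop) (.comp (f := fun x : α × β => h x.1 x.2) hh
      (g := fun x : α × List γ × β => (x.1, x.2.2)) (by fun_prop)))
      (p.comp (Polynomial.X + 1)) (fun a s c => by
        have : size (h a c) ≤ _ := hp (a, c)
        have h2 := size_append s (h a c)
        rw [size_pair] at this
        simp
        omega)
  have key : ∀ (a : α) (l : List β) (s : List γ),
      l.foldl (fun s c => s ++ h a c) s = s ++ l.flatMap (h a) := by
    intro a l
    induction l with
    | nil => simp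
    | cons c l ih => intro s; simp [ih]
  simpa only [key, List.nil_append] using this

/-- A concatenation over a fixed list. -/
theorem flatMap_fixed {ι : Type*} (l : List ι) {h : ι → α → List γ} (hh : ∀ i, PolyTime E (h i)) :
    PolyTime E fun a => l.flatMap fun i => h i a := by
  induction l with
  | nil => simpa using const ([] : List γ)
  | cons i l ih => simpa using (hh i).append ih

@[fun_prop]
theorem tail {f : α → List β} (hf : PolyTime E f) : PolyTime E fun a => (f a).tail := by
  have := listCases (g := fun _ => []) (h := fun _ _ l => l) hf (const _) (by fun_prop)
  refine this.of_code_eq id (fun _ => rfl) fun a => ?_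
  simp only [id]
  cases f a <;> rfl

@[fun_prop]
theorem succ {f : α → ℕ} (hf : PolyTime E f) : PolyTime E fun a => f a + 1 :=
  (cons (const ()) (hf.of_code_eq (g := fun a => List.replicate (f a) ()) id (fun _ => rfl)
    fun _ => rfl)).of_code_eq id (fun _ => rfl) fun _ => rfl

theorem replicate_unit {f : α → ℕ} (hf : PolyTime E f) :
    PolyTime E fun a => List.replicate (f a) () :=
  hf.of_code_eq id (fun _ => rfl) fun _ => rfl

@[fun_prop]
theorem length {f : α → List β} (hf : PolyTime E f) : PolyTime E fun a => (f a).length :=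
  (hf.map (h := fun _ _ => ()) (const ())).of_code_eq id (fun _ => rfl) fun a => by
    simp [code_nat, List.map_const']

@[fun_prop]
theorem replicate {f : α → ℕ} {g : α → β} (hf : PolyTime E f) (hg : PolyTime E g) :
    PolyTime E fun a => List.replicate (f a) (g a) := by
  have := hf.replicate_unit.map (h := fun a _ => g a) (.comp hg .fst)
  simpa using this

@[fun_prop]
theorem add {f g : α → ℕ} (hf : PolyTime E f) (hg : PolyTime E g) :
    PolyTime E fun a => f a + g a := by
  have := (hf.replicate_unit.append hg.replicate_unit).length
  simpa using this

@[fun_prop]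
theorem mul {f g : α → ℕ} (hf : PolyTime E f) (hg : PolyTime E g) :
    PolyTime E fun a => f a * g a := by
  have := (hf.replicate_unit.flatMap (h := fun a _ => List.replicate (g a) ())
    (.comp hg.replicate_unit .fst)).length
  simpa using this

@[fun_prop]
theorem pred {f : α → ℕ} (hf : PolyTime E f) : PolyTime E fun a => f a - 1 := by
  have := hf.replicate_unit.tail.length
  simpa using this

theorem pow {f : α → ℕ} (hf : PolyTime E f) (k : ℕ) : PolyTime E fun a => f a ^ k := by
  induction k with
  | zero => simpa using const 1
  | succ k ih => simpa [_root_.pow_succ] using ih.mul hf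

theorem polynomial_eval {f : α → ℕ} (hf : PolyTime E f) (p : Polynomial ℕ) :
    PolyTime E fun a => p.eval (f a) := by
  induction p using Polynomial.induction_on' with
  | add p q hp hq => simpa using hp.add hq
  | monomial n c => simpa using (const c).mul (hf.pow n)

@[fun_prop]
theorem range {f : α → ℕ} (hf : PolyTime E f) : PolyTime E fun a => List.range (f a) := by
  obtain ⟨p, hp⟩ := hf.size_le
  -- The list under construction is its own counter: its length is the next element.
  have key : ∀ n, (List.replicate n ()).foldl (fun s _ => s.length :: s) [] =
      (List.range n).reverse := by
    intro n
    induction n with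
    | zero => rfl
    | succ n ih => rw [List.replicate_succ', List.foldl_append, ih, List.range_succ]; simp
  have hsize : ∀ n, size (List.range n).reverse ≤ n * (2 * n + 2) + 1 := by
    intro n
    induction n with
    | zero => simp [size_nil]
    | succ n ih =>
      rw [List.range_succ, List.reverse_append, List.reverse_singleton, List.singleton_append,
        size_cons, size_nat]
      nlinarith
  have := foldl (g := fun _ : α => ([] : List ℕ)) (h := fun _ s _ => s.length :: s)
    hf.replicate_unit (const _) (by fun_prop) (p * (2 * p + 2) + 1) (fun a l hl => by
      obtain ⟨m, hm, rfl⟩ : ∃ m, m ≤ f a ∧ l = List.replicate m () := by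
        refine ⟨l.length, ?_, ?_⟩
        · simpa using hl.length_le
        · exact List.eq_replicate_of_mem fun _ _ => rfl
      rw [key]
      refine (hsize m).trans ?_
      have h1 := hp a
      rw [size_nat] at h1
      have h2 : m ≤ p.eval (size a) := by omega
      simp only [Polynomial.eval_add, Polynomial.eval_mul, Polynomial.eval_ofNat,
        Polynomial.eval_one]
      gcongr)
  simp only [key] at this
  simpa using this.reverse

@[fun_prop]
theorem drop {f : α → ℕ} {g : α → List β} (hf : PolyTime E f) (hg : PolyTime E g) :
    PolyTime E fun a => (g a).drop (f a) := by
  have := foldl_of_growth (g := g) (h := fun _ s _ => s.tail) hf.replicate_unit hg (by fun_prop) 0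
    (fun a s c => by
      cases s with
      | nil => simp
      | cons x s => rw [List.tail_cons, size_cons]; omega)
  have key : ∀ n (l : List β), (List.replicate n ()).foldl (fun s _ => s.tail) l = l.drop n := by
    intro n
    induction n with
    | zero => simp
    | succ n ih => intro l; rw [List.replicate_succ, List.foldl_cons, ih]; simp
  simpa [key] using this

@[fun_prop]
theorem some {f : α → β} (hf : PolyTime E f) : PolyTime E fun a => Option.some (f a) :=
  (hf.cons (const [])).of_code_eq id (fun _ => rfl) fun _ => rfl

theorem optionCases {f : α → Option γ} {h : Option γ → α → β} (hf : PolyTime E f)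
    (hn : PolyTime E (h none)) (hs : PolyTime E fun x : α × γ => h (Option.some x.2) x.1) :
    PolyTime E fun a => h (f a) a := by
  have hl : PolyTime E fun a => (f a).toList := hf.of_code_eq id (fun _ => rfl) fun _ => rfl
  have := listCases (g := h none) (h := fun a c _ => h (Option.some c) a) hl hn
    (.comp (f := fun x : α × γ => h (Option.some x.2) x.1)
      (g := fun x : α × γ × List γ => (x.1, x.2.1)) hs
      (by fun_prop))
  refine this.of_code_eq id (fun _ => rfl) fun a => ?_
  simp only [id]
  cases f a <;> rfl

@[fun_prop]
theorem head? {f : α → List β} (hf : PolyTime E f) : PolyTime E fun a => (f a).head? := by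
  have := listCases (g := fun _ => none) (h := fun _ c _ => Option.some c) hf (const _)
    (by fun_prop)
  refine this.of_code_eq id (fun _ => rfl) fun a => ?_
  simp only [id]
  cases f a <;> rfl

@[fun_prop]
theorem getElem? {f : α → List β} {g : α → ℕ} (hf : PolyTime E f) (hg : PolyTime E g) :
    PolyTime E fun a => (f a)[g a]? := by
  have := (hg.drop hf).head?
  simpa using this

end PolyTime

/-- A data type on which arbitrary case distinctions are possible. -/
def FinData (E : Env) (γ : Type) [Data γ] : Prop :=
  ∀ {α β : Type} [Data α] [Data β] (f : α → γ) (g : γ → α → β), PolyTime E f →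
    (∀ c, PolyTime E (g c)) → PolyTime E fun a => g (f a) a

theorem finData_bool : FinData E Bool := fun f g hf hg => by
  have := hf.ite (hg true) (hg false)
  convert this using 2 with a
  cases f a <;> rfl

theorem FinData.option {γ : Type} [Data γ] (h : FinData E γ) : FinData E (Option γ) :=
  fun _ g hf hg => .optionCases hf (hg none)
    (h (fun x : _ × γ => x.2) (fun c x => g (some c) x.1) .snd fun c => .comp (hg (some c)) .fst)

theorem FinData.prod {γ δ : Type} [Data γ] [Data δ] (h : FinData E γ) (h' : FinData E δ) :
    FinData E (γ × δ) :=
  fun f g hf hg => h (fun a => (f a).1) (fun c a => g (c, (f a).2) a) (.comp .fst hf) fun c =>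
    h' (fun a => (f a).2) (fun d a => g (c, d) a) (.comp .snd hf) fun d => hg (c, d)

/-- A table lookup: a case distinction over all values reduces an arbitrary `g` to constants. -/
theorem FinData.comp {α β γ : Type} [Data α] [Data β] [Data γ] (h : FinData E γ) (g : γ → β)
    {f : α → γ} (hf : PolyTime E f) : PolyTime E fun a => g (f a) :=
  h f (fun c _ => g c) hf fun _ => .const _

end CircuitRice

/-! ### Gate values, concatenated blocks of gates, and decision-tree circuits -/

namespace CircuitRice

open Function

/-! ### Values of gates -/

/-- The value of a gate, given the input `x` and the values `w` of all gates. -/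
def Gate.value (x : List Bool) (w : ℕ → Bool) : Gate → Bool
  | input i => x.getD i false
  | const b => b
  | not i => !(w i)
  | and i j => w i && w j
  | or i j => w i || w j

/-- The value of the gate at position `k`. -/
def gateVal (x : List Bool) (gs : List Gate) (k : ℕ) : Bool := (gateValues x gs).getD k false

theorem gateValues_append_singleton (x : List Bool) (gs : List Gate) (g : Gate) :
    gateValues x (gs ++ [g]) = gateValues x gs ++ [g.eval x (gateValues x gs)] := by
  simp [gateValues]

theorem length_gateValues (x : List Bool) (gs : List Gate) :
    (gateValues x gs).length = gs.length := by
  induction gs using List.reverseRecOn with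
  | nil => rfl
  | append_singleton gs g ih => rw [gateValues_append_singleton]; simp [ih]

theorem gateVal_append_singleton_of_lt (x : List Bool) (gs : List Gate) (g : Gate) {k : ℕ}
    (hk : k < gs.length) : gateVal x (gs ++ [g]) k = gateVal x gs k := by
  rw [gateVal, gateVal, gateValues_append_singleton, List.getD_append]
  rwa [length_gateValues]

/-- All gates of a part of a circuit that begins at position `n` may stand there. -/
def ValidAt (a n : ℕ) (gs : List Gate) : Prop :=
  ∀ (j : ℕ) (g : Gate), gs[j]? = some g → g.Valid a (n + j)

theorem Gate.value_congr {x : List Bool} {w w' : ℕ → Bool} {g : Gate} {a k : ℕ}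
    (hg : g.Valid a k) (h : ∀ i < k, w i = w' i) : g.value x w = g.value x w' := by
  cases g with
  | input i => rfl
  | const b => rfl
  | not i => simp [Gate.value, h i hg]
  | and i j => simp [Gate.value, h i hg.1, h j hg.2]
  | or i j => simp [Gate.value, h i hg.1, h j hg.2]

theorem Gate.eval_eq_value (x w : List Bool) (g : Gate) :
    g.eval x w = g.value x fun i => w.getD i false := by
  cases g <;> rfl

/-- The values of the gates are consistent with each other. -/
theorem gateVal_eq {x : List Bool} {gs : List Gate} {a : ℕ} (h : ValidAt a 0 gs) {k : ℕ} {g : Gate}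
    (hk : gs[k]? = some g) : gateVal x gs k = g.value x (gateVal x gs) := by
  induction gs using List.reverseRecOn with
  | nil => simp at hk
  | append_singleton gs g' ih =>
    have hlt : k < gs.length + 1 := by
      have := (List.getElem?_eq_some_iff.1 hk).1
      simpa using this
    have hv := h k g hk
    rw [zero_add] at hv
    rw [Gate.value_congr (w' := gateVal x gs) hv fun i hi =>
      gateVal_append_singleton_of_lt _ _ _ (by omega)]
    rcases Nat.lt_succ_iff_lt_or_eq.1 hlt with hlt' | rfl
    · rw [gateVal_append_singleton_of_lt _ _ _ hlt']
      rw [List.getElem?_append_left hlt'] at hk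
      refine ih (fun j g hj => h j g ?_) hk
      rw [List.getElem?_append_left (List.getElem?_eq_some_iff.1 hj).1, hj]
    · simp only [List.getElem?_concat_length, Option.some.injEq] at hk
      subst hk
      rw [gateVal, gateValues_append_singleton, ← length_gateValues x gs]
      simp [Gate.eval_eq_value]
      rfl

/-- The list `blk` occurs in the list `gs` at position `n`. -/
def BlockAt (gs : List Gate) (n : ℕ) (blk : List Gate) : Prop :=
  ∀ (j : ℕ) (g : Gate), blk[j]? = some g → gs[n + j]? = some g

section Blocks

variable {gs a b : List Gate} {n m : ℕ}

theorem BlockAt.refl (gs : List Gate) : BlockAt gs 0 gs := fun j g h => by rwa [zero_add]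

theorem BlockAt.left (h : BlockAt gs n (a ++ b)) : BlockAt gs n a := fun j g hj => h j g (by
  rw [List.getElem?_append_left (List.getElem?_eq_some_iff.1 hj).1, hj])

theorem BlockAt.right (h : BlockAt gs n (a ++ b)) : BlockAt gs (n + a.length) b := fun j g hj => by
  rw [add_assoc]
  exact h _ g (by rw [List.getElem?_append_right (by omega), Nat.add_sub_cancel_left, hj])

theorem ValidAt.append {k : ℕ} (ha : ValidAt k n a) (hb : ValidAt k (n + a.length) b) :
    ValidAt k n (a ++ b) := fun j g hj => by
  rcases lt_or_ge j a.length with h | h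
  · rw [List.getElem?_append_left h] at hj
    exact ha j g hj
  · rw [List.getElem?_append_right h] at hj
    have := hb _ g hj
    rwa [add_assoc, Nat.add_sub_cancel' h] at this

theorem length_flatMap_const {ι : Type*} {l : List ι} {f : ι → List Gate} {L : ℕ}
    (hf : ∀ i, (f i).length = L) : (l.flatMap f).length = l.length * L := by
  simp [List.length_flatMap, hf]

/-- Blocks of a common length start at multiples of that length, so the positions of all wires are
explicit arithmetic expressions. -/
theorem BlockAt.flatMap {ι : Type*} {l : List ι} {f : ι → List Gate} {L : ℕ}
    (hf : ∀ i, (f i).length = L) (h : BlockAt gs n (l.flatMap f)) {k : ℕ} (hk : k < l.length) :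
    BlockAt gs (n + k * L) (f l[k]) := by
  induction l generalizing n k with
  | nil => simp at hk
  | cons i l ih =>
    rw [List.flatMap_cons] at h
    cases k with
    | zero => simpa using h.left
    | succ k =>
      have := ih (n := n + L) (by simpa [hf] using h.right) (k := k) (by simpa using hk)
      rw [List.getElem_cons_succ]
      convert this using 1
      ring

theorem ValidAt.flatMap {ι : Type*} {l : List ι} {f : ι → List Gate} {L d : ℕ}
    (hf : ∀ i, (f i).length = L)
    (h : ∀ (k : ℕ) (hk : k < l.length), ValidAt d (n + k * L) (f l[k])) :
    ValidAt d n (l.flatMap f) := by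
  induction l generalizing n with
  | nil => intro j g hj; simp at hj
  | cons i l ih =>
    rw [List.flatMap_cons]
    have h0 := h 0 (by simp)
    rw [zero_mul, add_zero] at h0
    refine ValidAt.append h0 (ih fun k hk => ?_)
    have := h (k + 1) (by simpa using hk)
    rw [List.getElem_cons_succ] at this
    convert this using 1
    rw [hf]
    ring

theorem BlockAt.flatMap_range {N : ℕ} {f : ℕ → List Gate} {L : ℕ} (hf : ∀ i, (f i).length = L)
    (h : BlockAt gs n ((List.range N).flatMap f)) {k : ℕ} (hk : k < N) :
    BlockAt gs (n + k * L) (f k) := by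
  have := h.flatMap hf (k := k) (by simpa using hk)
  simpa using this

theorem BlockAt.flatMap_finRange {N : ℕ} {f : Fin N → List Gate} {L : ℕ}
    (hf : ∀ i, (f i).length = L) (h : BlockAt gs n ((List.finRange N).flatMap f)) (k : Fin N) :
    BlockAt gs (n + k * L) (f k) := by
  have := h.flatMap hf (k := k) (by simp)
  simpa using this

theorem ValidAt.flatMap_range {N : ℕ} {f : ℕ → List Gate} {L d : ℕ} (hf : ∀ i, (f i).length = L)
    (h : ∀ k < N, ValidAt d (n + k * L) (f k)) : ValidAt d n ((List.range N).flatMap f) :=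
  .flatMap hf fun k hk => by simpa using h k (by simpa using hk)

theorem ValidAt.flatMap_finRange {N : ℕ} {f : Fin N → List Gate} {L d : ℕ}
    (hf : ∀ i, (f i).length = L) (h : ∀ k : Fin N, ValidAt d (n + k * L) (f k)) :
    ValidAt d n ((List.finRange N).flatMap f) :=
  .flatMap hf fun k hk => by simpa using h ⟨k, by simpa using hk⟩

end Blocks

/-! ### Circuits for arbitrary Boolean functions of a fixed number of variables -/

/-- The number of gates, minus one, of the circuit for a Boolean function of `m` variables. -/
def funSize : ℕ → ℕ
  | 0 => 0
  | m + 1 => 2 * funSize m + 5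

/-- Gates, to be put at position `n`, that compute the Boolean function `h` of the values of the
gates at the positions `ws j` by a decision tree over the variables `js`; the values of the other
variables are taken from `a`. -/
def funGates {J : Type} [DecidableEq J] (h : (J → Bool) → Bool) (ws : J → ℕ) :
    List J → (J → Bool) → ℕ → List Gate
  | [], a, _ => [.const (h a)]
  | j :: js, a, n =>
    let s := funSize js.length
    funGates h ws js (update a j false) n ++
      (funGates h ws js (update a j true) (n + (s + 1)) ++
        [.not (ws j), .and (n + (2 * s + 2)) (n + s), .and (ws j) (n + (2 * s + 1)),
          .or (n + (2 * s + 3)) (n + (2 * s + 4))])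

section FunGates

variable {J : Type} [DecidableEq J] (h : (J → Bool) → Bool) (ws : J → ℕ)

theorem length_funGates (js : List J) (a : J → Bool) (n : ℕ) :
    (funGates h ws js a n).length = funSize js.length + 1 := by
  induction js generalizing a n with
  | nil => rfl
  | cons j js ih => simp [funGates, ih, funSize]; ring

theorem validAt_funGates {d n₀ : ℕ} (hws : ∀ j, ws j < n₀) (js : List J) (a : J → Bool) {n : ℕ}
    (hn : n₀ ≤ n) : ValidAt d n (funGates h ws js a n) := by
  induction js generalizing a n with
  | nil =>
    intro j g hj
    cases j with
    | zero => simp [funGates] at hj; subst hj; trivial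
    | succ j => simp [funGates] at hj
  | cons j js ih =>
    refine (ih _ hn).append (.append ?_ ?_)
    · rw [length_funGates]
      exact ih _ (by omega)
    · rw [length_funGates, length_funGates]
      have := hws j
      intro i g hi
      rcases i with _ | _ | _ | _ | i <;> simp at hi <;> subst hi <;> simp [Gate.Valid] <;> omega

/-- Shannon expansion: `h` is `(¬w ∧ h₀) ∨ (w ∧ h₁)`, where `w` is the first variable and `h₀`, `h₁`
are the restrictions computed by the two sub-blocks. The four gates at the end implement this
formula, and the value appears at the last gate. -/
theorem gateVal_funGates {x : List Bool} {gs : List Gate} {d : ℕ} (hv : ValidAt d 0 gs)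
    (js : List J) (a : J → Bool) (n : ℕ) (hb : BlockAt gs n (funGates h ws js a n)) :
    gateVal x gs (n + funSize js.length) =
      h fun j => if j ∈ js then gateVal x gs (ws j) else a j := by
  induction js generalizing a n with
  | nil =>
    have := gateVal_eq (x := x) hv (hb 0 _ rfl)
    simpa [Gate.value, funSize] using this
  | cons j js ih =>
    rw [funGates] at hb
    have h0 := ih _ _ hb.left
    have hb1 := hb.right
    rw [length_funGates] at hb1
    have h1 := ih _ _ hb1.left
    have hb2 := hb1.right
    rw [length_funGates] at hb2
    have g0 := gateVal_eq (x := x) hv (hb2 0 _ rfl)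
    have g1 := gateVal_eq (x := x) hv (hb2 1 _ rfl)
    have g2 := gateVal_eq (x := x) hv (hb2 2 _ rfl)
    have g3 := gateVal_eq (x := x) hv (hb2 3 _ rfl)
    simp only [Gate.value] at g0 g1 g2 g3
    have hsz : funSize (j :: js).length = 2 * funSize js.length + 5 := rfl
    generalize funSize js.length = s at *
    have e0 : n + (s + 1) + (s + 1) + 0 = n + (2 * s + 2) := by ring
    have e1 : n + (s + 1) + (s + 1) + 1 = n + (2 * s + 3) := by ring
    have e2 : n + (s + 1) + (s + 1) + 2 = n + (2 * s + 4) := by ring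
    have e3 : n + (s + 1) + (s + 1) + 3 = n + (2 * s + 5) := by ring
    have e4 : n + (s + 1) + s = n + (2 * s + 1) := by ring
    rw [e0] at g0
    rw [e1, g0, h0] at g1
    rw [e4] at h1
    rw [e2, h1] at g2
    rw [e3, g1, g2] at g3
    rw [hsz, g3]
    have hb : ∀ b, gateVal x gs (ws j) = b →
        (h fun i => if i ∈ js then gateVal x gs (ws i) else update a j b i) =
          h fun i => if i ∈ j :: js then gateVal x gs (ws i) else a i := by
      intro b hb
      congr 1
      funext i
      by_cases hi : i ∈ js
      · simp [hi]
      · by_cases hij : i = j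
        · subst hij; simp [hi, hb]
        · simp [hi, hij]
    cases hw : gateVal x gs (ws j) with
    | false => simp [hb false hw]
    | true => simp [hb true hw]

end FunGates

end CircuitRice

/-! ### The tableau circuit of a system with a local rule -/

namespace CircuitRice

open Function

/-! ### Circuits for systems with local rules -/

/-- A system that makes one step for each input bit, and whose configurations are described by
rows of cells, such that the new content of a cell is determined by the first two cells and the
neighbours. -/
structure LocalSystem where
  Cfg : Type
  bits : ℕ
  step : Bool → Cfg → Cfg
  row : Cfg → ℕ → Fin bits
  rule : Bool → (Fin 5 → Fin bits) → Fin bits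
  row_step : ∀ y c i, row (step y c) i =
    rule y ![row c 0, row c 1, row c (i - 1), row c i, row c (i + 1)]
  accept : Fin bits → Bool

namespace LocalSystem

variable (S : LocalSystem)

/-- The configuration after reading a string. -/
def run (y : List Bool) (c : S.Cfg) : S.Cfg := y.foldl (fun c b => S.step b c) c

/-- The number of bit strings of length `t` that lead to acceptance. -/
def cnt : ℕ → S.Cfg → ℕ
  | 0, c => if S.accept (S.row c 0) then 1 else 0
  | t + 1, c => cnt t (S.step false c) + cnt t (S.step true c)

/-- Splitting off the first bit yields the recursion that defines `cnt`. -/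
theorem card_eq_cnt (t : ℕ) (c : S.Cfg) :
    (Finset.univ.filter fun y : Fin t → Bool =>
      S.accept (S.row (S.run (List.ofFn y) c) 0) = true).card = S.cnt t c := by
  induction t generalizing c with
  | zero =>
    rw [Finset.card_filter]
    simp [run, cnt]
  | succ t ih =>
    rw [cnt, ← ih, ← ih, Finset.card_filter, Finset.card_filter, Finset.card_filter,
      ← (Fin.consEquiv fun _ => Bool).sum_comp, Fintype.sum_prod_type]
    simp only [Fintype.sum_bool]
    rw [add_comm]
    simp only [← Finset.card_filter]
    simp [run, Fin.consEquiv, List.ofFn_succ]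
    rfl

/-- The one-hot encoding of the content of a cell. -/
def bit (e b : Fin S.bits) : Bool := decide (e = b)

/-- The decoding of the one-hot encoding. -/
noncomputable def unbit [Inhabited (Fin S.bits)] (w : Fin S.bits → Bool) : Fin S.bits :=
  invFun S.bit w

theorem unbit_bit [Inhabited (Fin S.bits)] (e : Fin S.bits) : S.unbit (S.bit e) = e := by
  refine leftInverse_invFun (fun a b h => ?_) e
  have := congrFun h a
  simpa [bit, eq_comm] using this

/-- The inputs of the circuit for a bit of a cell: the input bit, and the bits of five cells. -/
abbrev Wires : Type := Option (Fin 5 × Fin S.bits)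

/-- The number of gates for each bit of a cell. -/
noncomputable def gap : ℕ := funSize (Finset.univ.toList : List S.Wires).length + 1

/-- The position of the bit `b` of the cell `i` after `t` steps. -/
noncomputable def wire (T t i b : ℕ) : ℕ :=
  T + (t * ((T + 1) * (S.bits * S.gap)) + (i * (S.bits * S.gap) + b * S.gap)) +
    funSize (Finset.univ.toList : List S.Wires).length

/-- The positions of the inputs of the circuit for the cell `i` in the step after `t`. -/
noncomputable def wires (T t i : ℕ) : S.Wires → ℕ
  | none => t
  | some (k, b) => S.wire T t (![0, 1, i - 1, i, i + 1] k) b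

/-- Gates for the initial row. -/
noncomputable def initGates (T : ℕ) (r : ℕ → Fin S.bits) : List Gate :=
  (List.range (T + 1)).flatMap fun i => (List.finRange S.bits).flatMap fun b =>
    -- One gate would do; the repetition gives layer `0` the same spacing as the others, so that
    -- `wire` is uniform in `t`.
    List.replicate S.gap (.const (S.bit (r i) b))

theorem length_initGates (T : ℕ) (r : ℕ → Fin S.bits) :
    (S.initGates T r).length = (T + 1) * (S.bits * S.gap) := by
  rw [initGates, length_flatMap_const (L := S.bits * S.gap), List.length_range]
  intro i
  rw [length_flatMap_const (L := S.gap), List.length_finRange]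
  intro b
  simp

/-- The circuit is acyclic: a cell looks at most one place to the right in the previous layer, and a
layer has at least two cells because `1 ≤ T`. The right neighbour of the last cell does not exist;
its formal position is that of cell `0` of the next layer, which is still earlier than the cell in
question. -/
theorem wire_lt {T t i i' : ℕ} {b b' : ℕ} (hT : 1 ≤ T) (hb : b < S.bits) (hi : i' ≤ i + 1) :
    S.wire T t i' b < T + ((t + 1) * ((T + 1) * (S.bits * S.gap)) +
      (i * (S.bits * S.gap) + b' * S.gap)) := by
  have h1 : b * S.gap + S.gap ≤ S.bits * S.gap := by
    rw [← Nat.succ_mul]; exact Nat.mul_le_mul_right _ hb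
  have h2 : i' * (S.bits * S.gap) ≤ (i + 1) * (S.bits * S.gap) := Nat.mul_le_mul_right _ hi
  have h3 : 2 * (S.bits * S.gap) ≤ (T + 1) * (S.bits * S.gap) :=
    Nat.mul_le_mul_right _ (by omega)
  have h4 : S.gap = funSize (Finset.univ.toList : List S.Wires).length + 1 := rfl
  have h5 : (i + 1) * (S.bits * S.gap) = i * (S.bits * S.gap) + S.bits * S.gap := by ring
  have h6 : (t + 1) * ((T + 1) * (S.bits * S.gap)) =
    t * ((T + 1) * (S.bits * S.gap)) + (T + 1) * (S.bits * S.gap) := by ring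
  rw [wire, h6]
  rw [h5] at h2
  generalize S.bits * S.gap = K at *
  generalize (T + 1) * K = L at *
  omega

variable [Inhabited (Fin S.bits)]

/-- The rule as a Boolean function. -/
noncomputable def ruleFun (b : Fin S.bits) (w : S.Wires → Bool) : Bool :=
  S.bit (S.rule (w none) fun k => S.unbit fun b => w (some (k, b))) b

/-- The gates for the bit `b` of the cell `i` after `t + 1` steps. -/
noncomputable def cellGates (T t i : ℕ) (b : Fin S.bits) : List Gate :=
  funGates (S.ruleFun b) (S.wires T t i) Finset.univ.toList (fun _ => false)
    (T + ((t + 1) * ((T + 1) * (S.bits * S.gap)) + (i * (S.bits * S.gap) + b * S.gap)))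

/-- Gates for the acceptance condition. -/
noncomputable def acceptGates (T : ℕ) : List Gate :=
  funGates (fun w => S.accept (S.unbit w)) (fun b => S.wire T T 0 b)
    (Finset.univ.toList : List (Fin S.bits)) (fun _ => false)
    (T + (T + 1) * ((T + 1) * (S.bits * S.gap)))

/-- All gates. -/
noncomputable def gates (T : ℕ) (r : ℕ → Fin S.bits) : List Gate :=
  (List.range T).map .input ++ (S.initGates T r ++ ((List.range T).flatMap (fun t =>
    (List.range (T + 1)).flatMap fun i => (List.finRange S.bits).flatMap fun b =>
      S.cellGates T t i b) ++ S.acceptGates T))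

theorem length_cellGates (T t i : ℕ) (b : Fin S.bits) : (S.cellGates T t i b).length = S.gap := by
  rw [cellGates, length_funGates, gap]

theorem length_cell (T t i : ℕ) : ((List.finRange S.bits).flatMap fun b =>
    S.cellGates T t i b).length = S.bits * S.gap := by
  rw [length_flatMap_const (L := S.gap), List.length_finRange]
  exact S.length_cellGates T t i

theorem length_layer (T t : ℕ) : ((List.range (T + 1)).flatMap fun i =>
    (List.finRange S.bits).flatMap fun b => S.cellGates T t i b).length =
      (T + 1) * (S.bits * S.gap) := by
  rw [length_flatMap_const (L := S.bits * S.gap), List.length_range]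
  exact S.length_cell T t

theorem length_layers (T : ℕ) : ((List.range T).flatMap (fun t =>
    (List.range (T + 1)).flatMap fun i => (List.finRange S.bits).flatMap fun b =>
      S.cellGates T t i b)).length = T * ((T + 1) * (S.bits * S.gap)) := by
  rw [length_flatMap_const (L := (T + 1) * (S.bits * S.gap)), List.length_range]
  exact S.length_layer T

theorem validAt_gates {T : ℕ} (hT : 1 ≤ T) (r : ℕ → Fin S.bits) : ValidAt T 0 (S.gates T r) := by
  refine .append ?_ (.append ?_ (.append ?_ ?_))
  · intro j g hj
    simp only [List.getElem?_map, Option.map_eq_some_iff] at hj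
    obtain ⟨i, hi, rfl⟩ := hj
    obtain ⟨hlt, hij⟩ := List.getElem?_eq_some_iff.1 hi
    rw [List.getElem_range] at hij
    rw [List.length_range] at hlt
    subst hij
    simpa [Gate.Valid] using hlt
  · intro j g hj
    have := List.mem_of_getElem? hj
    simp only [initGates, List.mem_flatMap, List.mem_replicate] at this
    obtain ⟨_, _, _, _, _, rfl⟩ := this
    trivial
  · rw [S.length_initGates, List.length_map, List.length_range, zero_add]
    refine .flatMap_range (S.length_layer T) fun t ht =>
      .flatMap_range (S.length_cell T t) fun i hi =>
      .flatMap_finRange (S.length_cellGates T t i) fun b => ?_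
    have e : T + (T + 1) * (S.bits * S.gap) + t * ((T + 1) * (S.bits * S.gap)) +
        i * (S.bits * S.gap) + b * S.gap = T + ((t + 1) * ((T + 1) * (S.bits * S.gap)) +
          (i * (S.bits * S.gap) + b * S.gap)) := by ring
    rw [e]
    refine validAt_funGates _ _ (fun j => ?_) _ _ le_rfl
    rcases j with _ | ⟨k, b'⟩
    · simp only [wires]
      omega
    · refine S.wire_lt hT b'.2 ?_
      fin_cases k <;> simp
      omega
  · rw [S.length_initGates, S.length_layers, List.length_map, List.length_range, zero_add]
    have e : T + (T + 1) * (S.bits * S.gap) + T * ((T + 1) * (S.bits * S.gap)) =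
        T + (T + 1) * ((T + 1) * (S.bits * S.gap)) := by ring
    rw [e]
    refine validAt_funGates _ _ (fun b => ?_) _ _ le_rfl
    have := S.wire_lt (t := T) (i := 0) (i' := 0) (b' := 0) hT b.2 (by omega)
    simpa using this

theorem length_gates (T : ℕ) (r : ℕ → Fin S.bits) : (S.gates T r).length =
    T + (T + 1) * ((T + 1) * (S.bits * S.gap)) +
      funSize (Finset.univ.toList : List (Fin S.bits)).length + 1 := by
  rw [gates, List.length_append, List.length_append, List.length_append, S.length_initGates,
    S.length_layers, acceptGates, length_funGates, List.length_map, List.length_range]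
  ring

section Correctness

variable {S}
variable {T : ℕ} (hT : 1 ≤ T) (c : S.Cfg) (y : List Bool) (hy : y.length = T)

include hT hy

theorem gateVal_input {t : ℕ} (ht : t < T) (r : ℕ → Fin S.bits) :
    gateVal y (S.gates T r) t = y[t] := by
  have h1 : (S.gates T r)[t]? = some (.input t) := by
    rw [gates, List.getElem?_append_left (by simpa using ht)]
    simp [ht]
  rw [gateVal_eq (S.validAt_gates hT r) h1]
  simp [Gate.value, hy, ht]

/-- The wires carry the correct values, in a light cone. -/
theorem gateVal_wire {t : ℕ} (ht : t ≤ T) {i : ℕ} (hi : i + t ≤ T) (b : Fin S.bits) :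
    gateVal y (S.gates T (S.row c)) (S.wire T t i b) = S.bit (S.row (S.run (y.take t) c) i) b := by
  have hv := S.validAt_gates hT (S.row c)
  have hb := BlockAt.refl (S.gates T (S.row c))
  nth_rw 2 [gates] at hb
  have hb := hb.right
  rw [List.length_map, List.length_range, zero_add] at hb
  induction t generalizing i b with
  | zero =>
    have h1 := ((hb.left.flatMap_range (L := S.bits * S.gap) (k := i) (fun i => by
      rw [length_flatMap_const (L := S.gap), List.length_finRange]
      simp) (by omega)).flatMap_finRange (L := S.gap) (fun b => by simp) b)
    have h2 := gateVal_eq (x := y) hv (h1 (funSize (Finset.univ.toList : List S.Wires).length) _ (by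
      rw [List.getElem?_replicate, if_pos (by simp [gap])]))
    have e : S.wire T 0 i b = T + i * (S.bits * S.gap) + b * S.gap +
        funSize (Finset.univ.toList : List S.Wires).length := by
      rw [wire]; ring
    rw [e, h2]
    simp [Gate.value, run]
  | succ t ih =>
    have hb' := hb.right.left
    rw [S.length_initGates] at hb'
    have h1 := ((hb'.flatMap_range (S.length_layer T) (k := t) (by omega)).flatMap_range
      (S.length_cell T t) (k := i) (by omega)).flatMap_finRange (S.length_cellGates T t i) b
    have e : T + (T + 1) * (S.bits * S.gap) + t * ((T + 1) * (S.bits * S.gap)) +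
        i * (S.bits * S.gap) + b * S.gap = T + ((t + 1) * ((T + 1) * (S.bits * S.gap)) +
          (i * (S.bits * S.gap) + b * S.gap)) := by ring
    rw [e] at h1
    have h2 := gateVal_funGates (x := y) _ _ hv _ _ _ h1
    have e2 : S.wire T (t + 1) i b = T + ((t + 1) * ((T + 1) * (S.bits * S.gap)) +
          (i * (S.bits * S.gap) + b * S.gap)) +
        funSize (Finset.univ.toList : List S.Wires).length := rfl
    rw [e2, h2]
    have htk : y.take (t + 1) = y.take t ++ [y[t]] :=
      List.take_succ_eq_append_getElem (by omega)
    have hrun : S.run (y.take (t + 1)) c = S.step y[t] (S.run (y.take t) c) := by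
      rw [htk, run, List.foldl_append]
      rfl
    rw [hrun, S.row_step]
    simp only [Finset.mem_toList, Finset.mem_univ, if_true, ruleFun]
    have hin := gateVal_input hT y hy (t := t) (by omega) (S.row c)
    have hcell : ∀ k : Fin 5, (S.unbit fun b => gateVal y (S.gates T (S.row c))
        (S.wires T t i (some (k, b)))) =
          S.row (S.run (y.take t) c) (![0, 1, i - 1, i, i + 1] k) := by
      intro k
      have : (fun b => gateVal y (S.gates T (S.row c)) (S.wires T t i (some (k, b)))) =
          S.bit (S.row (S.run (y.take t) c) (![0, 1, i - 1, i, i + 1] k)) := by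
        funext b
        -- The rule reads cells up to `max 1 (i + 1)`, and `i + 1 + t ≤ T`. So the meaningless right
        -- neighbour of the last cell never enters the cone.
        refine ih (by omega) ?_ b
        fin_cases k <;> simp <;> omega
      rw [this, unbit_bit]
    simp only [hcell]
    rw [show S.wires T t i none = t from rfl, hin]
    congr 2
    funext k
    fin_cases k <;> rfl

/-- The last gate is the root of the acceptance block, which reads cell `0` of layer `T`, the tip of
the light cone. -/
theorem gateValues_getLastD :
    (gateValues y (S.gates T (S.row c))).getLastD false = S.accept (S.row (S.run y c) 0) := by
  have hv := S.validAt_gates hT (S.row c)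
  have hb := BlockAt.refl (S.gates T (S.row c))
  nth_rw 2 [gates] at hb
  have hb := hb.right.right.right
  rw [S.length_initGates, S.length_layers, List.length_map, List.length_range, zero_add] at hb
  have e : T + (T + 1) * (S.bits * S.gap) + T * ((T + 1) * (S.bits * S.gap)) =
      T + (T + 1) * ((T + 1) * (S.bits * S.gap)) := by ring
  rw [e] at hb
  have h2 := gateVal_funGates (x := y) _ _ hv _ _ _ hb
  have hl : (gateValues y (S.gates T (S.row c))).length - 1 =
      T + (T + 1) * ((T + 1) * (S.bits * S.gap)) +
        funSize (Finset.univ.toList : List (Fin S.bits)).length := by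
    rw [length_gateValues, length_gates, Nat.add_sub_cancel]
  have h3 : (gateValues y (S.gates T (S.row c))).getLastD false =
      gateVal y (S.gates T (S.row c)) ((gateValues y (S.gates T (S.row c))).length - 1) := by
    rw [gateVal, List.getLastD_eq_getLast?, List.getLast?_eq_getElem?, List.getD_eq_getElem?_getD]
  rw [h3, hl, h2]
  simp only [Finset.mem_toList, Finset.mem_univ, if_true]
  have : (fun b : Fin S.bits => gateVal y (S.gates T (S.row c)) (S.wire T T 0 b)) =
      S.bit (S.row (S.run y c) 0) := by
    funext b
    rw [gateVal_wire hT c y hy le_rfl (by omega), ← hy, List.take_length]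
  rw [this, unbit_bit]

end Correctness

/-- The circuit that simulates the system for `T` steps. -/
noncomputable def circuit (T : ℕ) (hT : 1 ≤ T) (c : S.Cfg) : Circuit where
  arity := T
  gates := S.gates T (S.row c)
  nonempty h := by
    have := S.length_gates T (S.row c)
    rw [h] at this
    simp at this
  valid k hk := by
    have := S.validAt_gates hT (S.row c) k _ (List.getElem?_eq_getElem hk)
    rwa [zero_add] at this

theorem count_circuit {T : ℕ} (hT : 1 ≤ T) (c : S.Cfg) :
    (S.circuit T hT c).count = S.cnt T c := by
  rw [← card_eq_cnt, Circuit.count]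
  congr 1
  refine Finset.filter_congr fun y _ => ?_
  have := gateValues_getLastD hT c (List.ofFn y) (List.length_ofFn ..)
  exact iff_of_eq (congrArg (· = true) this)

end LocalSystem

end CircuitRice

/-! ### Stack systems, and counting accepting paths plus a binary number -/

namespace CircuitRice

open Turing Function

/-! ### Stack systems are local systems -/

/-- An action on a stack. -/
inductive Act (A : Type) where
  | keep
  | pop
  | push (a : A)

/-- The effect of an action on a stack. -/
def Act.apply {A : Type} : Act A → List A → List A
  | keep, l => l
  | pop, l => l.tail
  | push a, l => a :: l

/-- A system with finitely many states and stacks that reads one bit in each step. -/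
structure StackSystem where
  Q : Type
  K : Type
  Γ : K → Type
  [finQ : Finite Q]
  [finK : Finite K]
  [finΓ : ∀ k, Finite (Γ k)]
  next : Q → Bool → (∀ k, Option (Γ k)) → Q × ∀ k, Act (Γ k)
  accept : Q → Bool

namespace StackSystem

attribute [instance] finQ finK finΓ

variable (S : StackSystem)

/-- A configuration. -/
abbrev Cfg : Type := S.Q × ∀ k, List (S.Γ k)

/-- The content of a cell: the state, or a symbol or nothing of each stack. -/
abbrev Cell : Type := S.Q ⊕ ∀ k, Option (S.Γ k)

/-- One step. -/
def step (y : Bool) (c : S.Cfg) : S.Cfg :=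
  let r := S.next c.1 y fun k => (c.2 k).head?
  (r.1, fun k => (r.2 k).apply (c.2 k))

/-- The row of cells that describes a configuration. -/
def cells (c : S.Cfg) : ℕ → S.Cell
  | 0 => .inl c.1
  | i + 1 => .inr fun k => (c.2 k)[i]?

/-- The local rule. -/
def rule (y : Bool) (w : Fin 5 → S.Cell) : S.Cell :=
  match w 0, w 1, w 3 with
  | .inl q, .inr top, .inl _ => .inl (S.next q y top).1
  | .inl q, .inr top, .inr c => .inr fun k =>
    match (S.next q y top).2 k with
    | .keep => c k
    | .pop => (w 4).elim (fun _ => none) fun c' => c' k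
    | .push a => (w 2).elim (fun _ => some a) fun c' => c' k
  | _, _, c => c

/-- The actions are determined by the state in cell `0` and the top symbols in cell `1`, and they
shift each stack by at most one place. So a new cell needs only its old content and its two
neighbours. -/
theorem cells_step (y : Bool) (c : S.Cfg) (i : ℕ) : S.cells (S.step y c) i =
    S.rule y ![S.cells c 0, S.cells c 1, S.cells c (i - 1), S.cells c i, S.cells c (i + 1)] := by
  have htop : (fun k => (c.2 k).head?) = fun k => (c.2 k)[0]? := by
    funext k
    rw [List.head?_eq_getElem?]
  rcases i with _ | i
  · simp [rule, cells, step, htop]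
  · simp only [rule, cells, step, htop, Matrix.cons_val, Sum.inr.injEq]
    funext k
    cases h : (S.next c.1 y fun k => (c.2 k)[0]?).2 k with
    | keep => rfl
    | pop => simp [Act.apply]
    -- At the top of the stack the left neighbour is the state cell; there the rule inserts the
    -- pushed symbol.
    | push a =>
      rcases i with _ | i
      · simp [Act.apply]
      · simp [Act.apply]

/-- The number of cell contents. -/
noncomputable def size : ℕ := (Finite.exists_equiv_fin S.Cell).choose

/-- A numbering of the cell contents. -/
noncomputable def num : S.Cell ≃ Fin S.size := (Finite.exists_equiv_fin S.Cell).choose_spec.some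

/-- The local system of a stack system. -/
noncomputable def toLocal : LocalSystem where
  Cfg := S.Cfg
  bits := S.size
  step := S.step
  row c i := S.num (S.cells c i)
  rule y w := S.num (S.rule y fun k => S.num.symm (w k))
  row_step y c i := by
    rw [cells_step]
    congr 2
    funext k
    fin_cases k <;> simp
  accept e := (S.num.symm e).elim S.accept fun _ => false

/-- The number of bit strings of length `t` that lead to acceptance. -/
noncomputable def cnt (t : ℕ) (c : S.Cfg) : ℕ := S.toLocal.cnt t c

theorem cnt_zero (c : S.Cfg) : S.cnt 0 c = if S.accept c.1 then 1 else 0 := by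
  simp [cnt, LocalSystem.cnt, toLocal, cells]

end StackSystem

/-! ### Nondeterministic machines and comparison with a binary number as a stack system -/

namespace NTM

variable (N : NTM)

open Classical in
/-- The statements that occur in the program. -/
noncomputable def stmts : Finset (TM2.Stmt N.tm.Γ N.tm.Λ N.tm.σ) :=
  Finset.univ.biUnion fun l => TM2.stmts₁ (N.tm.m l) ∪ (N.alt l).elim ∅ TM2.stmts₁

variable {N} in
theorem mem_stmts {q q' : TM2.Stmt N.tm.Γ N.tm.Λ N.tm.σ} (h : q' ∈ TM2.stmts₁ q)
    (hq : q ∈ N.stmts) : q' ∈ N.stmts := by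
  simp only [stmts, Finset.mem_biUnion, Finset.mem_union] at hq ⊢
  obtain ⟨l, hl, hq | hq⟩ := hq
  · exact ⟨l, hl, .inl (TM2.stmts₁_trans hq h)⟩
  · refine ⟨l, hl, .inr ?_⟩
    cases ha : N.alt l with
    | none => simp [ha] at hq
    | some r =>
      rw [ha] at hq
      exact TM2.stmts₁_trans hq h

theorem m_mem_stmts (l : N.tm.Λ) : N.tm.m l ∈ N.stmts := by
  simp only [stmts, Finset.mem_biUnion, Finset.mem_union]
  exact ⟨l, Finset.mem_univ _, .inl TM2.stmts₁_self⟩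

theorem alt_mem_stmts {l : N.tm.Λ} {q : TM2.Stmt N.tm.Γ N.tm.Λ N.tm.σ} (h : N.alt l = some q) :
    q ∈ N.stmts := by
  simp only [stmts, Finset.mem_biUnion, Finset.mem_union]
  exact ⟨l, Finset.mem_univ _, .inr (by rw [h]; exact TM2.stmts₁_self)⟩

/-- The states: a start state, in which the next bit decides between a simulation of the machine (if
this is enabled) and a comparison; a rejecting state; the states of the simulation; and the
states of the comparison. -/
inductive Ctl
  | start (enabled : Bool)
  | dead
  | lab (l : Option N.tm.Λ) (v : N.tm.σ)
  | stm (q : N.stmts) (v : N.tm.σ)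
  | cmp (b : Bool)

instance : Finite N.Ctl := by
  let f : N.Ctl → Bool ⊕ Unit ⊕ (Option N.tm.Λ × N.tm.σ) ⊕ (N.stmts × N.tm.σ) ⊕ Bool
    | .start b => .inl b
    | .dead => .inr (.inl ())
    | .lab l v => .inr (.inr (.inl (l, v)))
    | .stm q v => .inr (.inr (.inr (.inl (q, v))))
    | .cmp b => .inr (.inr (.inr (.inr b)))
  refine Finite.of_injective f fun a b h => ?_
  cases a <;> cases b <;> simp [f] at h <;> grind

/-- The stack alphabets: the stacks of the machine, and a stack for a binary number. -/
abbrev Γ' : Option N.tm.K → Type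
  | none => Bool
  | some k => N.tm.Γ k

instance (k : Option N.tm.K) : Finite (N.Γ' k) := by
  cases k with
  | none => exact inferInstanceAs (Finite Bool)
  | some k => exact N.finite_alphabet k

/-- No action. -/
abbrev idle (k : Option N.tm.K) : Act (N.Γ' k) := .keep

/-- The execution of one instruction. -/
def micro (top : ∀ k, Option (N.Γ' k)) (v : N.tm.σ) :
    (q : TM2.Stmt N.tm.Γ N.tm.Λ N.tm.σ) → q ∈ N.stmts → N.Ctl × ∀ k, Act (N.Γ' k)
  | .push k f q, h => (.stm ⟨q, mem_stmts (by simp [TM2.stmts₁, TM2.stmts₁_self]) h⟩ v,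
      update N.idle (some k) (.push (f v)))
  | .peek k f q, h => (.stm ⟨q, mem_stmts (by simp [TM2.stmts₁, TM2.stmts₁_self]) h⟩
      (f v (top (some k))), N.idle)
  | .pop k f q, h => (.stm ⟨q, mem_stmts (by simp [TM2.stmts₁, TM2.stmts₁_self]) h⟩
      (f v (top (some k))), update N.idle (some k) .pop)
  | .load a q, h => (.stm ⟨q, mem_stmts (by simp [TM2.stmts₁, TM2.stmts₁_self]) h⟩ (a v), N.idle)
  | .branch f q₁ q₂, h =>
    (bif f v then .stm ⟨q₁, mem_stmts (by simp [TM2.stmts₁, TM2.stmts₁_self]) h⟩ v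
      else .stm ⟨q₂, mem_stmts (by simp [TM2.stmts₁, TM2.stmts₁_self]) h⟩ v, N.idle)
  | .goto f, _ => (.lab (some (f v)) v, N.idle)
  | .halt, _ => (.lab none v, N.idle)

/-- The transition function. -/
def next : N.Ctl → Bool → (∀ k, Option (N.Γ' k)) → N.Ctl × ∀ k, Act (N.Γ' k)
  | .start true, false, _ => (.lab (some N.tm.main) N.tm.initialState, N.idle)
  | .start false, false, _ => (.dead, N.idle)
  | .start _, true, _ => (.cmp false, N.idle)
  | .dead, _, _ => (.dead, N.idle)
  | .lab none v, false, _ => (.lab none v, N.idle)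
  | .lab none _, true, _ => (.dead, N.idle)
  | .lab (some l) v, false, _ => (.stm ⟨N.tm.m l, N.m_mem_stmts l⟩ v, N.idle)
  | .lab (some l) v, true, _ => match h : N.alt l with
    | none => (.dead, N.idle)
    | some q => (.stm ⟨q, N.alt_mem_stmts h⟩ v, N.idle)
  | .stm q v, false, top => N.micro top v q.1 q.2
  | .stm _ _, true, _ => (.dead, N.idle)
  | .cmp b, y, top => match top none, y with
    | none, false => (.cmp b, N.idle)
    | none, true => (.dead, N.idle)
    | some true, y => (.cmp (!y || b), update N.idle none .pop)
    | some false, y => (.cmp (!y && b), update N.idle none .pop)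

/-- The stack system of a nondeterministic machine. -/
def system : StackSystem where
  Q := N.Ctl
  K := Option N.tm.K
  Γ := N.Γ'
  next := N.next
  accept
    | .lab none v => N.accept v
    | .cmp b => b
    | _ => false

/-- The number of bit strings of length `t` that lead to acceptance. -/
noncomputable def cnt (t : ℕ) (q : N.Ctl) (R : ∀ k, List (N.Γ' k)) : ℕ := N.system.cnt t (q, R)

/-- The contents of all stacks. -/
def allStacks (S : ∀ k, List (N.tm.Γ k)) (D : List Bool) : ∀ k, List (N.Γ' k)
  | none => D
  | some k => S k

end NTM

/-- The number with the given binary digits, the least significant digit first. -/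
def binVal : List Bool → ℕ
  | [] => 0
  | b :: l => b.toNat + 2 * binVal l

namespace NTM

variable {N : NTM} (S : ∀ k, List (N.tm.Γ k)) (D : List Bool)

theorem cnt_zero (q : N.Ctl) (R : ∀ k, List (N.Γ' k)) :
    N.cnt 0 q R = if N.system.accept q then 1 else 0 :=
  N.system.cnt_zero (q, R)

theorem cnt_succ (t : ℕ) (q : N.Ctl) (R : ∀ k, List (N.Γ' k)) : N.cnt (t + 1) q R =
    N.cnt t (N.next q false fun k => (R k).head?).1
      (fun k => ((N.next q false fun k => (R k).head?).2 k).apply (R k)) +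
    N.cnt t (N.next q true fun k => (R k).head?).1
      (fun k => ((N.next q true fun k => (R k).head?).2 k).apply (R k)) := rfl

theorem cnt_dead (t : ℕ) (R : ∀ k, List (N.Γ' k)) : N.cnt t .dead R = 0 := by
  induction t with
  | zero => rw [cnt_zero]; rfl
  | succ t ih =>
    change N.cnt t .dead R + N.cnt t .dead R = 0
    rw [ih]

/-- After halting only zero bits are admitted, so a path is counted once however much time is left.
-/
theorem cnt_halted (t : ℕ) (v : N.tm.σ) (R : ∀ k, List (N.Γ' k)) :
    N.cnt t (.lab none v) R = if N.accept v then 1 else 0 := by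
  induction t with
  | zero => rw [cnt_zero]; rfl
  | succ t ih =>
    change N.cnt t (.lab none v) R + N.cnt t .dead R = _
    rw [ih, cnt_dead, add_zero]

theorem apply_update (a : ∀ k, List (N.Γ' k)) (k : Option N.tm.K) (x : Act (N.Γ' k)) :
    (fun k' => (update N.idle k x k').apply (a k')) = update a k (x.apply (a k)) := by
  funext k'
  by_cases h : k' = k
  · subst h; simp
  · simp [h, Act.apply]

theorem update_allStacks (k : N.tm.K) (l : List (N.tm.Γ k)) :
    update (N.allStacks S D) (some k) l = N.allStacks (update S k l) D := by
  funext k'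
  rcases k' with _ | k'
  · rfl
  · by_cases h : k' = k
    · subst h; simp [allStacks]
    · rw [update_of_ne (by simpa using h)]
      simp [allStacks, h]

/-- The simulation of a statement. -/
theorem cnt_stm (q : TM2.Stmt N.tm.Γ N.tm.Λ N.tm.σ) (hq : q ∈ N.stmts) (v : N.tm.σ) :
    ∃ d ≤ stmtDepth q, ∀ t, N.cnt (t + d) (.stm ⟨q, hq⟩ v) (N.allStacks S D) =
      N.cnt t (.lab (TM2.stepAux q v S).l (TM2.stepAux q v S).var)
        (N.allStacks (TM2.stepAux q v S).stk D) := by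
  -- Within a statement there is no choice: the bit `1` leads to the rejecting state and contributes
  -- nothing.
  have key : ∀ (q : TM2.Stmt N.tm.Γ N.tm.Λ N.tm.σ) (hq : q ∈ N.stmts) v
      (R : ∀ k, List (N.Γ' k)) t,
      N.cnt (t + 1) (.stm ⟨q, hq⟩ v) R = N.cnt t (N.micro (fun k => (R k).head?) v q hq).1
        fun k => ((N.micro (fun k => (R k).head?) v q hq).2 k).apply (R k) := by
    intro q hq v R t
    change _ + N.cnt t .dead R = _
    rw [cnt_dead]
    rfl
  induction q generalizing v S with
  | push k f q ih =>
    obtain ⟨d, hd, h⟩ := ih (update S k (f v :: S k)) (mem_stmts (by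
      simp [TM2.stmts₁, TM2.stmts₁_self]) hq) v
    refine ⟨d + 1, by simp [stmtDepth, hd], fun t => ?_⟩
    rw [← add_assoc, key]
    rw [← update_allStacks] at h
    exact (congrArg (N.cnt _ _) (apply_update (N.allStacks S D) (some k) (.push (f v)))).trans (h t)
  | peek k f q ih =>
    obtain ⟨d, hd, h⟩ := ih S (mem_stmts (by
      simp [TM2.stmts₁, TM2.stmts₁_self]) hq) (f v (S k).head?)
    refine ⟨d + 1, by simp [stmtDepth, hd], fun t => ?_⟩
    rw [← add_assoc, key]
    exact h t
  | pop k f q ih =>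
    obtain ⟨d, hd, h⟩ := ih (update S k (S k).tail) (mem_stmts (by
      simp [TM2.stmts₁, TM2.stmts₁_self]) hq) (f v (S k).head?)
    refine ⟨d + 1, by simp [stmtDepth, hd], fun t => ?_⟩
    rw [← add_assoc, key]
    rw [← update_allStacks] at h
    exact (congrArg (N.cnt _ _) (apply_update (N.allStacks S D) (some k) .pop)).trans (h t)
  | load a q ih =>
    obtain ⟨d, hd, h⟩ := ih S (mem_stmts (by simp [TM2.stmts₁, TM2.stmts₁_self]) hq) (a v)
    refine ⟨d + 1, by simp [stmtDepth, hd], fun t => ?_⟩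
    rw [← add_assoc, key]
    exact h t
  | branch f q₁ q₂ ih₁ ih₂ =>
    obtain ⟨d₁, hd₁, h₁⟩ := ih₁ S (mem_stmts (by simp [TM2.stmts₁, TM2.stmts₁_self]) hq) v
    obtain ⟨d₂, hd₂, h₂⟩ := ih₂ S (mem_stmts (by simp [TM2.stmts₁, TM2.stmts₁_self]) hq) v
    cases hf : f v with
    | true =>
      refine ⟨d₁ + 1, by simp [stmtDepth, hd₁], fun t => ?_⟩
      rw [← add_assoc, key]
      simp only [micro, hf, TM2.stepAux, cond_true]
      exact h₁ t
    | false =>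
      refine ⟨d₂ + 1, by simp [stmtDepth, hd₂], fun t => ?_⟩
      rw [← add_assoc, key]
      simp only [micro, hf, TM2.stepAux, cond_false]
      exact h₂ t
  | goto f => exact ⟨1, le_rfl, fun t => by rw [key]; rfl⟩
  | halt => exact ⟨1, le_rfl, fun t => by rw [key]; rfl⟩

theorem cnt_lab (t : ℕ) (l : N.tm.Λ) (v : N.tm.σ) (R : ∀ k, List (N.Γ' k)) :
    N.cnt (t + 1) (.lab (some l) v) R =
      N.cnt t (.stm ⟨N.tm.m l, N.m_mem_stmts l⟩ v) R +
        N.cnt t (N.next (.lab (some l) v) true fun k => (R k).head?).1 R := by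
  have h : (N.next (.lab (some l) v) true fun k => (R k).head?).2 = N.idle := by
    simp only [next]
    split <;> rfl
  rw [cnt_succ, h]
  rfl

/-- A machine step takes one bit for the choice of a statement and at most `M` forced zero bits for
its instructions, hence the factor `M + 1`. Paths of different lengths may share one time bound
because surplus time does not change the count of a halted path. -/
theorem cnt_simulation (M : ℕ) (hM : ∀ q ∈ N.stmts, stmtDepth q ≤ M) (t : ℕ) (c : N.tm.Cfg)
    (h : N.HaltsIn t c) (t' : ℕ) (ht' : t * (M + 1) ≤ t') :
    N.cnt t' (.lab c.l c.var) (N.allStacks c.stk D) = N.accPaths t c := by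
  induction t generalizing c t' with
  | zero =>
    have h : c.l = none := h
    rw [h, cnt_halted]
    simp [accPaths, h]
  | succ t ih =>
    rcases c with ⟨l, v, S⟩
    cases l with
    | none => exact (cnt_halted _ _ _).trans (by simp [accPaths])
    | some l =>
      obtain ⟨u, rfl⟩ : ∃ u, t' = u + 1 := ⟨t' - 1, by rw [Nat.succ_mul] at ht'; omega⟩
      have hstm : ∀ q (hq : q ∈ N.stmts), q ∈ N.tm.m l :: (N.alt l).toList →
          N.cnt u (.stm ⟨q, hq⟩ v) (N.allStacks S D) =
            N.accPaths t (TM2.stepAux q v S) := by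
        intro q hq hsucc
        obtain ⟨d, hd, he⟩ := cnt_stm S D q hq v
        have hdM := hM q hq
        obtain ⟨w, rfl⟩ : ∃ w, u = w + d := ⟨u - d, by rw [Nat.succ_mul] at ht'; omega⟩
        rw [he]
        exact ih _ (h _ (List.mem_map_of_mem hsucc)) _ (by rw [Nat.succ_mul] at ht'; omega)
      refine (cnt_lab _ _ _ _).trans ?_
      have ha : N.accPaths (t + 1) ⟨some l, v, S⟩ =
          ((N.tm.m l :: (N.alt l).toList).map fun q => N.accPaths t (TM2.stepAux q v S)).sum :=
        congrArg List.sum (List.map_map (f := fun q => TM2.stepAux q v S))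
      rw [hstm _ _ (by simp), ha, List.map_cons, List.sum_cons]
      congr 1
      simp only [next]
      split
      · next hn => rw [cnt_dead]; simp [hn]
      · next q hq =>
        rw [hstm _ _ (by simp [hq])]
        simp [hq]

/-- The guessed string is read as a number, least significant digit first, and digits beyond those
of `D` must be zero. The flag says whether the part read so far is less than that of `D`; a
differing digit overrides it and equal digits keep it. So `b = false` counts the numbers below
`binVal D`, and `b = true` those up to and including `binVal D`. -/
theorem cnt_cmp (b : Bool) (t : ℕ) (ht : D.length ≤ t) :
    N.cnt t (.cmp b) (N.allStacks S D) = binVal D + b.toNat := by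
  induction D generalizing b t with
  | nil =>
    have : ∀ t, N.cnt t (.cmp b) (N.allStacks S []) = b.toNat := by
      intro t
      induction t with
      | zero => rw [cnt_zero]; cases b <;> rfl
      | succ t ih =>
        change N.cnt t (.cmp b) (N.allStacks S []) + N.cnt t .dead (N.allStacks S []) = _
        rw [ih, cnt_dead, add_zero]
    simp [this, binVal]
  | cons d D ih =>
    obtain ⟨t, rfl⟩ : ∃ u, t = u + 1 := ⟨t - 1, by simp at ht; omega⟩
    have e : update (N.allStacks S (d :: D)) none D = N.allStacks S D := by
      funext k
      rcases k with _ | k <;> rfl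
    have h : (fun k => (update N.idle none .pop k).apply (N.allStacks S (d :: D) k)) =
        N.allStacks S D := (apply_update (N.allStacks S (d :: D)) none .pop).trans e
    have h' : N.cnt (t + 1) (.cmp b) (N.allStacks S (d :: D)) =
        N.cnt t (.cmp (if d then true || b else true && b)) (N.allStacks S D) +
          N.cnt t (.cmp (if d then false || b else false && b)) (N.allStacks S D) := by
      rw [← h]
      cases d <;> rfl
    rw [h', ih _ _ (by simpa using ht), ih _ _ (by simpa using ht)]
    cases d <;> cases b <;> simp [binVal] <;> omega

/-- The number of accepting strings is the number of accepting paths (if enabled) plus the given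
binary number. -/
theorem cnt_start (M : ℕ) (hM : ∀ q ∈ N.stmts, stmtDepth q ≤ M) (enabled : Bool) (x : Str)
    (n T : ℕ) (hn : N.HaltsIn n (N.init x)) (hT : n * (M + 1) + D.length + 1 ≤ T) :
    N.cnt T (.start enabled) (N.allStacks (N.init x).stk D) =
      (if enabled then N.accPaths n (N.init x) else 0) + binVal D := by
  obtain ⟨t, rfl⟩ : ∃ t, T = t + 1 := ⟨T - 1, by omega⟩
  have h : N.cnt (t + 1) (.start enabled) (N.allStacks (N.init x).stk D) =
      (if enabled then N.cnt t (.lab (N.init x).l (N.init x).var) (N.allStacks (N.init x).stk D)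
        else N.cnt t .dead (N.allStacks (N.init x).stk D)) +
      N.cnt t (.cmp false) (N.allStacks (N.init x).stk D) := by
    cases enabled <;> rfl
  rw [h, cnt_cmp _ _ _ _ (by omega), cnt_dead, cnt_simulation D M hM n _ hn t (by omega)]
  rfl

end NTM

end CircuitRice

/-! ### Polynomial-time construction of the circuits -/

namespace CircuitRice

open Turing Function

variable {E : Env}

/-! ### The circuits are computed in polynomial time -/

/-- A gate is stored as its code word, so encoding is free and building a gate amounts to building a
string. -/
instance : Data Gate := ⟨fun g => Data.tree g.encode⟩

namespace PolyTime

variable {α β γ : Type} [Data α] [Data β] [Data γ]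

@[fun_prop]
theorem isZero {f : α → ℕ} (hf : PolyTime E f) : PolyTime E fun a => decide (f a = 0) := by
  have := listCases (g := fun _ => true) (h := fun _ _ _ => false) hf.replicate_unit (const _)
    (const _)
  refine this.of_code_eq id (fun _ => rfl) fun a => ?_
  simp only [id]
  cases f a <;> rfl

@[fun_prop]
theorem unary {f : α → ℕ} (hf : PolyTime E f) : PolyTime E fun a => unary (f a) := by
  unfold CircuitRice.unary
  fun_prop

@[fun_prop]
theorem gateEncode {f : α → Gate} (hf : PolyTime E f) : PolyTime E fun a => (f a).encode :=
  hf.of_code_eq id (fun _ => rfl) fun _ => rfl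

theorem flatMap_encode {f : α → List Gate} (hf : PolyTime E f) :
    PolyTime E fun a => (f a).flatMap Gate.encode :=
  flatMap (h := fun _ g => g.encode) hf (gateEncode .snd)

theorem of_gateEncode {f : α → Gate} (hf : PolyTime E fun a => (f a).encode) : PolyTime E f :=
  hf.of_code_eq id (fun _ => rfl) fun _ => rfl

@[fun_prop]
theorem gateInput {f : α → ℕ} (hf : PolyTime E f) : PolyTime E fun a => Gate.input (f a) := by
  refine of_gateEncode ?_
  simp only [Gate.encode]
  fun_prop

@[fun_prop]
theorem gateConst {f : α → Bool} (hf : PolyTime E f) : PolyTime E fun a => Gate.const (f a) := by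
  refine of_gateEncode ?_
  simp only [Gate.encode]
  fun_prop

@[fun_prop]
theorem gateNot {f : α → ℕ} (hf : PolyTime E f) : PolyTime E fun a => Gate.not (f a) := by
  refine of_gateEncode ?_
  simp only [Gate.encode]
  fun_prop

@[fun_prop]
theorem gateAnd {f g : α → ℕ} (hf : PolyTime E f) (hg : PolyTime E g) :
    PolyTime E fun a => Gate.and (f a) (g a) := by
  refine of_gateEncode ?_
  simp only [Gate.encode]
  fun_prop

@[fun_prop]
theorem gateOr {f g : α → ℕ} (hf : PolyTime E f) (hg : PolyTime E g) :
    PolyTime E fun a => Gate.or (f a) (g a) := by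
  refine of_gateEncode ?_
  simp only [Gate.encode]
  fun_prop

/-- The list of variables is fixed, so the recursion unfolds into a program that does not depend on
the input; only the positions are computed. -/
theorem funGates {J : Type} [DecidableEq J] (h : (J → Bool) → Bool) {ws : α → J → ℕ}
    (hws : ∀ j, PolyTime E fun x => ws x j) (js : List J) (a : J → Bool) {n : α → ℕ}
    (hn : PolyTime E n) : PolyTime E fun x => funGates h (ws x) js a (n x) := by
  induction js generalizing a n with
  | nil =>
    simp only [CircuitRice.funGates]
    fun_prop
  | cons j js ih =>
    have h1 := ih (update a j false) hn
    have h2 := ih (update a j true) (n := fun x => n x + (funSize js.length + 1)) (by fun_prop)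
    have h3 := hws j
    simp only [CircuitRice.funGates]
    fun_prop

section LocalSystem

variable (S : LocalSystem) {T : α → ℕ} (hT : PolyTime E T)

include hT

theorem wire {t i : α → ℕ} (ht : PolyTime E t) (hi : PolyTime E i) (b : ℕ) :
    PolyTime E fun a => S.wire (T a) (t a) (i a) b := by
  unfold LocalSystem.wire
  fun_prop

theorem wires {t i : α → ℕ} (ht : PolyTime E t) (hi : PolyTime E i) (j : S.Wires) :
    PolyTime E fun a => S.wires (T a) (t a) (i a) j := by
  rcases j with _ | ⟨k, b⟩
  · exact ht
  · refine wire S hT ht ?_ b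
    fin_cases k <;> simp <;> fun_prop

theorem initGates {r : α → ℕ → Fin S.bits}
    (hr : ∀ b, PolyTime E fun x : α × ℕ => S.bit (r x.1 x.2) b) :
    PolyTime E fun a => S.initGates (T a) (r a) := by
  unfold LocalSystem.initGates
  refine flatMap (f := fun a => List.range (T a + 1))
    (h := fun a i => (List.finRange S.bits).flatMap fun b =>
      List.replicate S.gap (Gate.const (S.bit (r a i) b))) (by fun_prop) ?_
  refine flatMap_fixed (h := fun b (x : α × ℕ) =>
    List.replicate S.gap (Gate.const (S.bit (r x.1 x.2) b))) _ fun b => ?_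
  exact replicate (const _) (gateConst (hr b))

variable [Inhabited (Fin S.bits)]

theorem cellGates {t i : α → ℕ} (ht : PolyTime E t) (hi : PolyTime E i) (b : Fin S.bits) :
    PolyTime E fun a => S.cellGates (T a) (t a) (i a) b := by
  unfold LocalSystem.cellGates
  exact funGates _ (wires S hT ht hi) _ _ (by fun_prop)

theorem acceptGates : PolyTime E fun a => S.acceptGates (T a) := by
  unfold LocalSystem.acceptGates
  refine funGates _ (ws := fun a (b : Fin S.bits) => S.wire (T a) (T a) 0 b)
    (fun b => wire S hT hT (const 0) b) _ _ ?_
  fun_prop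

theorem gates {r : α → ℕ → Fin S.bits}
    (hr : ∀ b, PolyTime E fun x : α × ℕ => S.bit (r x.1 x.2) b) :
    PolyTime E fun a => S.gates (T a) (r a) := by
  unfold LocalSystem.gates
  refine append (map (f := fun a => List.range (T a)) (h := fun _ i => Gate.input i) (by fun_prop)
    (by fun_prop))
    (append (initGates S hT hr) (append ?_ (acceptGates S hT)))
  refine flatMap (h := fun a t => (List.range (T a + 1)).flatMap fun i =>
    (List.finRange S.bits).flatMap fun b => S.cellGates (T a) t i b) (by fun_prop) ?_
  refine flatMap (h := fun (x : α × ℕ) i => (List.finRange S.bits).flatMap fun b =>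
    S.cellGates (T x.1) x.2 i b) (by fun_prop) (flatMap_fixed _ fun b => ?_)
  exact cellGates S (T := fun x : (α × ℕ) × ℕ => T x.1.1) (.comp hT (by fun_prop)) (by fun_prop)
    (by fun_prop) b

theorem circuitCode {r : α → ℕ → Fin S.bits}
    (hr : ∀ b, PolyTime E fun x : α × ℕ => S.bit (r x.1 x.2) b) :
    PolyTime E fun a => CircuitRice.unary (T a) ++ (S.gates (T a) (r a)).flatMap Gate.encode :=
  hT.unary.append (gates S hT hr).flatMap_encode

end LocalSystem

end PolyTime

namespace NTM

variable (N : NTM)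

/-- The initial configuration of the stack system. -/
def start (enabled : Bool) (x : Str) (D : List Bool) : N.system.Cfg :=
  (.start enabled, N.allStacks (N.init x).stk D)

/-- The content of a cell of the initial configuration, given whether the cell is the first one and
the symbols at the position. -/
def startCell (z : Bool × Bool × Option Bool × Option Bool) : N.system.Cell :=
  if z.1 then .inl (.start z.2.1) else .inr fun
    | none => z.2.2.2
    | some k => update (fun k => (none : Option (N.tm.Γ k))) N.tm.k₀
        (z.2.2.1.map N.inputAlphabet.symm) k

/-- An initial cell depends on the input only through finitely many possible values. The truncated
`i - 1` is harmless, since cell `0` holds the state and ignores the symbols. -/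
theorem cells_start (enabled : Bool) (x : Str) (D : List Bool) (i : ℕ) :
    N.system.cells (N.start enabled x D) i =
      N.startCell (decide (i = 0), enabled, x[i - 1]?, D[i - 1]?) := by
  rcases i with _ | i
  · rfl
  · refine congrArg Sum.inr (funext fun k => ?_)
    rcases k with _ | k
    · rfl
    · change ((N.init x).stk k)[i]? = update (fun k => (none : Option (N.tm.Γ k))) N.tm.k₀
        (x[i]?.map N.inputAlphabet.symm) k
      rw [init, initList_stk]
      by_cases h : k = N.tm.k₀
      · subst h; simp
      · simp [h]

noncomputable instance : Inhabited (Fin N.system.toLocal.bits) := ⟨N.system.num (.inl .dead)⟩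

/-- The circuit whose number of satisfying assignments is the number of accepting paths (if enabled)
plus a given binary number. -/
noncomputable def circuit (enabled : Bool) (x : Str) (D : List Bool) (T : ℕ) : Circuit :=
  N.system.toLocal.circuit (T + 1) (by omega) (N.start enabled x D)

/-- The numbering of the cell contents is chosen noncomputably, but it enters only through finite
tables, which `FinData.comp` hard-wires into the program. -/
theorem polyTime_circuit {α : Type} [Data α] {e : α → Bool} {x D : α → Str} {T : α → ℕ}
    (he : PolyTime E e) (hx : PolyTime E x) (hD : PolyTime E D) (hT : PolyTime E T) :
    PolyTime E fun a => (N.circuit (e a) (x a) (D a) (T a)).encode := by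
  refine PolyTime.circuitCode N.system.toLocal (T := fun a => T a + 1)
    (r := fun a => N.system.toLocal.row (N.start (e a) (x a) (D a))) (by fun_prop) fun b => ?_
  have h : ∀ y : α × ℕ, N.system.toLocal.row (N.start (e y.1) (x y.1) (D y.1)) y.2 =
      N.system.num (N.startCell (decide (y.2 = 0), e y.1, (x y.1)[y.2 - 1]?, (D y.1)[y.2 - 1]?)) :=
    fun y => congrArg N.system.num (N.cells_start _ _ _ _)
  simp only [h]
  refine FinData.comp (finData_bool.prod (finData_bool.prod (FinData.prod finData_bool.option
    finData_bool.option))) (fun z => N.system.toLocal.bit (N.system.num (N.startCell z)) b) ?_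
  fun_prop

theorem count_circuit (M : ℕ) (hM : ∀ q ∈ N.stmts, stmtDepth q ≤ M) (enabled : Bool) (x : Str)
    (D : List Bool) (n T : ℕ) (hn : N.HaltsIn n (N.init x)) (hT : n * (M + 1) + D.length ≤ T) :
    (N.circuit enabled x D T).count =
      (if enabled then N.accPaths n (N.init x) else 0) + binVal D :=
  (N.system.toLocal.count_circuit _ _).trans
    (cnt_start D M hM enabled x n (T + 1) hn (Nat.succ_le_succ hT))

end NTM

end CircuitRice

/-! ### Binary addition, halving, and the numbers of strings -/

namespace CircuitRice

variable {E : Env}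

/-! ### Binary arithmetic -/

theorem binVal_append (l m : List Bool) : binVal (l ++ m) = binVal l + 2 ^ l.length * binVal m := by
  induction l with
  | nil => simp [binVal]
  | cons b l ih => rw [List.cons_append, binVal, binVal, ih, List.length_cons]; ring

theorem binVal_lt (l : List Bool) : binVal l < 2 ^ l.length := by
  induction l with
  | nil => simp [binVal]
  | cons b l ih =>
    rw [binVal, List.length_cons, pow_succ]
    have := Bool.toNat_le b
    omega

theorem binVal_replicate_true (n : ℕ) : binVal (List.replicate n true) + 1 = 2 ^ n := by
  induction n with
  | zero => rfl
  | succ n ih =>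
    rw [List.replicate_succ, binVal, pow_succ, ← ih, Bool.toNat_true]
    omega

theorem binVal_replicate_false (n : ℕ) : binVal (List.replicate n false) = 0 := by
  induction n with
  | zero => rfl
  | succ n ih => rw [List.replicate_succ, binVal, ih]; rfl

theorem binVal_tail (l : List Bool) : binVal l.tail = binVal l / 2 := by
  cases l with
  | nil => rfl
  | cons b l =>
    have := Bool.toNat_lt b
    rw [List.tail_cons, binVal]
    omega

/-- The digits of a power of two. -/
def powTwo (n : ℕ) : List Bool := List.replicate n false ++ [true]

theorem binVal_powTwo (n : ℕ) : binVal (powTwo n) = 2 ^ n := by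
  simp [powTwo, binVal_append, binVal_replicate_false, binVal]

/-- The carry of an addition of two digits and a carry. -/
def addCarry (z : (Option Bool × Option Bool) × Bool) : Bool :=
  (z.1.1 == some true && z.1.2 == some true) || (z.2 && (z.1.1 == some true ^^ z.1.2 == some true))

/-- The digit of an addition of two digits and a carry. -/
def addDigit (z : (Option Bool × Option Bool) × Bool) : Bool :=
  (z.1.1 == some true ^^ z.1.2 == some true) ^^ z.2

/-- One step of an addition; the state consists of the remaining digits of the summands, the carry,
and the digits of the result so far. -/
def addStep (s : (List Bool × List Bool) × Bool × List Bool) :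
    (List Bool × List Bool) × Bool × List Bool :=
  ((s.1.1.tail, s.1.2.tail),
    addCarry ((s.1.1.head?, s.1.2.head?), s.2.1),
    s.2.2 ++ [addDigit ((s.1.1.head?, s.1.2.head?), s.2.1)])

/-- The sum of two numbers with at most `R` binary digits. -/
def addBits (R : ℕ) (a b : List Bool) : List Bool :=
  let s := (List.replicate R ()).foldl (fun s _ => addStep s) ((a, b), false, [])
  s.2.2 ++ [s.2.1]

/-- The value of the digits produced so far, plus `2` to their number times the sum of the remaining
summands and the carry, does not change. After `R` rounds the summands are used up and only the
carry remains. -/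
theorem foldl_addStep (R : ℕ) (a b : List Bool) (c : Bool) (l : List Bool) (ha : a.length ≤ R)
    (hb : b.length ≤ R) :
    ∃ c' l', (List.replicate R ()).foldl (fun s _ => addStep s) ((a, b), c, l) =
      (([], []), c', l') ∧ l'.length = l.length + R ∧
      binVal (l' ++ [c']) = binVal l + 2 ^ l.length * (binVal a + binVal b + c.toNat) := by
  induction R generalizing a b c l with
  | zero =>
    obtain rfl : a = [] := by simpa using ha
    obtain rfl : b = [] := by simpa using hb
    refine ⟨c, l, rfl, rfl, ?_⟩
    rw [binVal_append]
    simp [binVal]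
  | succ R ih =>
    obtain ⟨c', l', h1, h2, h3⟩ := ih a.tail b.tail _ _ (by simpa using ha) (by simpa using hb)
    refine ⟨c', l', h1, h2.trans ?_, h3.trans ?_⟩
    · simp only [List.length_append, List.length_singleton]
      omega
    · simp only
      rw [binVal_append, List.length_append, List.length_singleton, pow_succ, add_assoc, mul_assoc,
        ← mul_add]
      congr 2
      rcases a with _ | ⟨x, a⟩ <;> rcases b with _ | ⟨y, b⟩ <;> cases c <;>
        (try cases x) <;> (try cases y) <;> simp [binVal, addCarry, addDigit] <;> omega

theorem binVal_addBits {R : ℕ} {a b : List Bool} (ha : a.length ≤ R) (hb : b.length ≤ R) :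
    binVal (addBits R a b) = binVal a + binVal b := by
  obtain ⟨c, l, h1, -, h3⟩ := foldl_addStep R a b false [] ha hb
  rw [addBits, h1]
  simpa [binVal] using h3

theorem length_addBits {R : ℕ} {a b : List Bool} (ha : a.length ≤ R) (hb : b.length ≤ R) :
    (addBits R a b).length = R + 1 := by
  obtain ⟨c, l, h1, h2, -⟩ := foldl_addStep R a b false [] ha hb
  rw [addBits, h1]
  simpa using h2

/-- The digits of half of the sum, rounded down. -/
def midBits (R : ℕ) (a b : List Bool) : List Bool := (addBits R a b).tail

theorem binVal_midBits {R : ℕ} {a b : List Bool} (ha : a.length ≤ R) (hb : b.length ≤ R) :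
    binVal (midBits R a b) = (binVal a + binVal b) / 2 := by
  rw [midBits, binVal_tail, binVal_addBits ha hb]

/-- Halving removes the digit that the addition has added, so the width stays constant during the
search. -/
theorem length_midBits {R : ℕ} {a b : List Bool} (ha : a.length ≤ R) (hb : b.length ≤ R) :
    (midBits R a b).length = R := by
  rw [midBits, List.length_tail, length_addBits ha hb, Nat.add_sub_cancel]

/-- Putting a digit `1` in front of a string gives the binary expansion of its number plus one. -/
theorem strToNat_add_one (w : Str) : strToNat w + 1 = binVal w.reverse + 2 ^ w.length := by
  induction w using List.reverseRecOn with
  | nil => rfl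
  | append_singleton w b ih =>
    rw [strToNat_append, List.reverse_append, List.reverse_singleton, List.singleton_append,
      binVal, List.length_append, List.length_singleton, pow_succ]
    cases b <;> simp <;> omega

/-- The digits of the number of a string minus `2 ^ n`. -/
def shiftBits (R n : ℕ) (w : Str) : List Bool :=
  addBits R w.reverse
    (List.replicate n true ++ false :: List.replicate (w.drop (n + 1)).length true)

theorem length_shift {n : ℕ} {w : Str} (hw : n + 1 ≤ w.length) :
    (List.replicate n true ++ false :: List.replicate (w.drop (n + 1)).length true).length =
      w.length := by
  simp only [List.length_append, List.length_replicate, List.length_cons, List.length_drop]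
  omega

theorem length_shiftBits {R n : ℕ} {w : Str} (hw : n + 1 ≤ w.length) (hR : w.length ≤ R) :
    (shiftBits R n w).length = R + 1 :=
  length_addBits (by simpa using hR) (by rw [length_shift hw]; exact hR)

/-- Subtraction is avoided: by `strToNat_add_one` it suffices to add `2 ^ w.length - 1 - 2 ^ n` to
the reversed string. The digits of that number are all `1`, except for a `0` at position `n <
w.length`. -/
theorem binVal_shiftBits {R n : ℕ} {w : Str} (hw : n + 1 ≤ w.length) (hR : w.length ≤ R) :
    binVal (shiftBits R n w) + 2 ^ n = strToNat w := by
  have h1 := strToNat_add_one w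
  have h2 := binVal_replicate_true n
  have h3 := binVal_replicate_true (w.drop (n + 1)).length
  have h4 : 2 ^ w.length = 2 ^ n * (2 * 2 ^ (w.drop (n + 1)).length) := by
    rw [← pow_succ', ← pow_add, List.length_drop]
    congr 1
    omega
  rw [shiftBits, binVal_addBits (by simpa using hR) (by rw [length_shift hw]; exact hR),
    binVal_append, binVal, List.length_replicate, Bool.toNat_false, zero_add]
  rw [h4, ← h3] at h1
  have h5 : 2 ^ n * (2 * (binVal (List.replicate (w.drop (n + 1)).length true) + 1)) =
    2 ^ n * (2 * binVal (List.replicate (w.drop (n + 1)).length true)) + 2 * 2 ^ n := by ring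
  omega

namespace PolyTime

variable {α : Type} [Data α]

@[fun_prop]
theorem addBits {R : α → ℕ} {f g : α → List Bool} (hR : PolyTime E R) (hf : PolyTime E f)
    (hg : PolyTime E g) : PolyTime E fun a => addBits (R a) (f a) (g a) := by
  have hstep : PolyTime E addStep := by
    have hd : FinData E ((Option Bool × Option Bool) × Bool) :=
      FinData.prod (FinData.prod finData_bool.option finData_bool.option) finData_bool
    have h1 := FinData.comp hd addCarry
      (f := fun s : (List Bool × List Bool) × Bool × List Bool =>
        ((s.1.1.head?, s.1.2.head?), s.2.1)) (by fun_prop)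
    have h2 := FinData.comp hd addDigit
      (f := fun s : (List Bool × List Bool) × Bool × List Bool =>
        ((s.1.1.head?, s.1.2.head?), s.2.1)) (by fun_prop)
    unfold addStep
    fun_prop
  have hsize : ∀ l : List Bool, size l.tail ≤ size l := fun l => by
    cases l with
    | nil => rfl
    | cons b l => rw [List.tail_cons, size_cons]; omega
  have hb : ∀ b : Bool, 1 ≤ size b ∧ size b ≤ 3 := fun b => by
    cases b <;> exact ⟨by decide, by decide⟩
  have := foldl_of_growth (f := fun a => List.replicate (R a) ())
    (g := fun a => ((f a, g a), false, ([] : List Bool))) (h := fun _ s _ => addStep s)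
    (by fun_prop) (by fun_prop) (.comp hstep (by fun_prop)) 6 (fun a s c => by
      have h0 : size s = size s.1.1 + size s.1.2 + 1 + (size s.2.1 + size s.2.2 + 1) + 1 := by
        rw [← size_pair, ← size_pair, ← size_pair]
      simp only [addStep, size_pair]
      have h1 := size_append s.2.2 [addDigit ((s.1.1.head?, s.1.2.head?), s.2.1)]
      rw [size_cons, size_nil] at h1
      have h2 := hsize s.1.1
      have h3 := hsize s.1.2
      have h4 := (hb (addCarry ((s.1.1.head?, s.1.2.head?), s.2.1))).2
      have h5 := (hb s.2.1).1
      have h6 := (hb (addDigit ((s.1.1.head?, s.1.2.head?), s.2.1))).2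
      have h7 : Polynomial.eval (size a + size c) (6 : Polynomial ℕ) = 6 := by simp
      omega)
  unfold CircuitRice.addBits
  simp only
  fun_prop

@[fun_prop]
theorem midBits {R : α → ℕ} {f g : α → List Bool} (hR : PolyTime E R) (hf : PolyTime E f)
    (hg : PolyTime E g) : PolyTime E fun a => midBits (R a) (f a) (g a) := by
  unfold CircuitRice.midBits
  fun_prop

@[fun_prop]
theorem powTwo {n : α → ℕ} (hn : PolyTime E n) : PolyTime E fun a => powTwo (n a) := by
  unfold CircuitRice.powTwo
  fun_prop

@[fun_prop]
theorem shiftBits {R n : α → ℕ} {f : α → Str} (hR : PolyTime E R) (hn : PolyTime E n)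
    (hf : PolyTime E f) : PolyTime E fun a => shiftBits (R a) (n a) (f a) := by
  unfold CircuitRice.shiftBits
  fun_prop

end PolyTime

end CircuitRice

/-! ### Binary search with the oracle, and the reduction -/

namespace CircuitRice

variable {E : Env}

/-! ### Binary search with an oracle -/

namespace NTM

variable (N : NTM) (A : Set ℕ)

open Classical in
/-- One step of the binary search for neighbouring numbers `a` and `b` such that
`a + 2 ^ n ∈ A` and `b + 2 ^ n ∉ A`. -/
noncomputable def searchStep (x : Str) (R n T : ℕ) (s : List Bool × List Bool) :
    List Bool × List Bool :=
  if decide ((N.circuit false x (addBits R (midBits R s.1 s.2) (powTwo n)) T).encode ∈ Counting A)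
  then (midBits R s.1 s.2, s.2) else (s.1, midBits R s.1 s.2)

/-- The binary search. -/
noncomputable def search (x : Str) (R n T : ℕ) (s : List Bool × List Bool) :
    List Bool × List Bool :=
  (List.replicate R ()).foldl (fun s _ => N.searchStep A x R n T s) s

theorem encode_mem_counting {A : Set ℕ} {c : Circuit} : c.encode ∈ Counting A ↔ c.count ∈ A :=
  ⟨fun ⟨c', h, h'⟩ => by rwa [← Circuit.encode_injective h], fun h => ⟨c, rfl, h⟩⟩

variable {N A}

theorem length_searchStep {x : Str} {R n T : ℕ} {s : List Bool × List Bool}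
    (h : s.1.length = R ∧ s.2.length = R) :
    (N.searchStep A x R n T s).1.length = R ∧ (N.searchStep A x R n T s).2.length = R := by
  have := length_midBits h.1.le h.2.le
  rw [searchStep]
  split_ifs
  · exact ⟨this, h.2⟩
  · exact ⟨h.1, this⟩

/-- The state of the binary search. -/
structure SearchInv (A : Set ℕ) (R n k : ℕ) (s : List Bool × List Bool) : Prop where
  length_fst : s.1.length = R
  length_snd : s.2.length = R
  mem : binVal s.1 + 2 ^ n ∈ A
  notMem : binVal s.2 + 2 ^ n ∉ A
  fst_le : binVal s.1 ≤ binVal s.2 + 2 ^ k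
  snd_le : binVal s.2 ≤ binVal s.1 + 2 ^ k

section

variable {M : ℕ} (hM : ∀ q ∈ N.stmts, stmtDepth q ≤ M) {x : Str} {t T R n : ℕ}
  (ht : N.HaltsIn t (N.init x)) (hn : n + 1 ≤ R) (hT : t * (M + 1) + (R + 1) ≤ T)

include hM ht hn hT

/-- With the simulation disabled, the circuit has exactly the prescribed number of satisfying
assignments, so the oracle decides membership in `A`. -/
theorem circuit_add_powTwo_mem {a : List Bool} (ha : a.length = R) :
    (N.circuit false x (addBits R a (powTwo n)) T).encode ∈ Counting A ↔
      binVal a + 2 ^ n ∈ A := by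
  have hp : (powTwo n).length ≤ R := by simpa [powTwo] using hn
  rw [encode_mem_counting, N.count_circuit M hM false x _ t T ht (by
    rw [length_addBits ha.le hp]; exact hT), binVal_addBits ha.le hp, binVal_powTwo]
  simp

-- The midpoint replaces the end that lies on the same side of `A`. Even after rounding, it differs
-- from either end by at most half of `2 ^ (k + 1)`; the order of the ends plays no role.
open Classical in
theorem SearchInv.step {k : ℕ} {s : List Bool × List Bool} (h : SearchInv A R n (k + 1) s) :
    SearchInv A R n k (N.searchStep A x R n T s) := by
  have hm := binVal_midBits h.length_fst.le h.length_snd.le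
  have hl := length_midBits h.length_fst.le h.length_snd.le
  have hq := circuit_add_powTwo_mem (A := A) hM ht hn hT hl
  have h1 := h.fst_le
  have h2 := h.snd_le
  rw [pow_succ] at h1 h2
  rw [searchStep]
  split_ifs with hc
  · exact ⟨hl, h.length_snd, hq.1 (of_decide_eq_true hc), h.notMem, by simp only; omega,
      by simp only; omega⟩
  · exact ⟨h.length_fst, hl, h.mem, fun h' => hc (decide_eq_true (hq.2 h')), by simp only; omega,
      by simp only; omega⟩

theorem SearchInv.foldl {k : ℕ} {s : List Bool × List Bool} (h : SearchInv A R n k s) :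
    SearchInv A R n 0
      ((List.replicate k ()).foldl (fun s _ => N.searchStep A x R n T s) s) := by
  induction k generalizing s with
  | zero => exact h
  | succ k ih => exact ih (h.step hM ht hn hT)

theorem searchInv_search {s : List Bool × List Bool} (h1 : s.1.length = R) (h2 : s.2.length = R)
    (h3 : binVal s.1 + 2 ^ n ∈ A) (h4 : binVal s.2 + 2 ^ n ∉ A) :
    SearchInv A R n 0 (N.search A x R n T s) := by
  refine SearchInv.foldl hM ht hn hT ⟨h1, h2, h3, h4, ?_, ?_⟩
  · have := binVal_lt s.1
    rw [h1] at this
    omega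
  · have := binVal_lt s.2
    rw [h2] at this
    omega

open Classical in
/-- Distinction of the two possible numbers of accepting paths. -/
theorem distinguish {s : List Bool × List Bool} (h : SearchInv A R n 0 s)
    (hx : N.accPaths t (N.init x) = 2 ^ n ∨ N.accPaths t (N.init x) = 2 ^ n + 1) :
    ((decide ((N.circuit false x (addBits R (midBits R s.1 s.2) (powTwo n)) T).encode ∈
      Counting A) ^^ decide ((N.circuit true x (midBits R s.1 s.2) T).encode ∈ Counting A)) =
      true) ↔ N.accPaths t (N.init x) = 2 ^ n + 1 := by
  have hm := binVal_midBits h.length_fst.le h.length_snd.le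
  have hl := length_midBits h.length_fst.le h.length_snd.le
  have hq := circuit_add_powTwo_mem (A := A) hM ht hn hT hl
  have hq' : (N.circuit true x (midBits R s.1 s.2) T).encode ∈ Counting A ↔
      N.accPaths t (N.init x) + binVal (midBits R s.1 s.2) ∈ A := by
    rw [encode_mem_counting, N.count_circuit M hM true x _ t T ht (by omega)]
    simp
  have h1 := h.fst_le
  have h2 := h.snd_le
  have hne : binVal s.1 ≠ binVal s.2 := fun e => h.notMem (e ▸ h.mem)
  rw [pow_zero] at h1 h2
  rw [bne_iff_ne, Ne, decide_eq_decide, hq, hq']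
  rcases hx with hx | hx
  -- Both questions concern the same number, so the answers agree.
  · rw [hx, add_comm (2 ^ n)]
    simp
  · rw [hx]
    simp only [iff_true]
    intro hiff
    -- The ends are adjacent, so the rounded midpoint is the smaller end and its successor is the
    -- larger one. Shifted by `2 ^ n`, exactly one of them lies in `A`.
    rcases Nat.lt_or_gt_of_ne hne with hlt | hlt
    · have e1 : binVal (midBits R s.1 s.2) = binVal s.1 := by omega
      have e2 : 2 ^ n + 1 + binVal (midBits R s.1 s.2) = binVal s.2 + 2 ^ n := by omega
      rw [e2, e1] at hiff
      exact h.notMem (hiff.1 h.mem)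
    · have e1 : binVal (midBits R s.1 s.2) = binVal s.2 := by omega
      have e2 : 2 ^ n + 1 + binVal (midBits R s.1 s.2) = binVal s.1 + 2 ^ n := by omega
      rw [e2, e1] at hiff
      exact h.notMem (hiff.2 h.mem)

end

end NTM

open Classical in
/-- The reduction: whether the number of accepting paths is `2 ^ n + 1`, if it is `2 ^ n` or
`2 ^ n + 1`. -/
noncomputable def decision (N : NTM) (A : Set ℕ) (x : Str) (R n T : ℕ)
    (s : List Bool × List Bool) : Bool :=
  decide ((N.circuit false x (addBits R (midBits R s.1 s.2) (powTwo n)) T).encode ∈ Counting A) ^^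
    decide ((N.circuit true x (midBits R s.1 s.2) T).encode ∈ Counting A)

namespace PolyTime

variable {α : Type} [Data α]

open Classical in
theorem askCounting {A : Set ℕ} (hB : E.B = Counting A) {c : α → Circuit}
    (hc : PolyTime E fun a => (c a).encode) :
    PolyTime E fun a => decide ((c a).encode ∈ Counting A) := by
  rw [← hB]
  exact query.comp hc

theorem searchStep (N : NTM) {A : Set ℕ} (hB : E.B = Counting A) {x : α → Str} {R n T : α → ℕ}
    {s : α → List Bool × List Bool}
    (hx : PolyTime E x) (hR : PolyTime E R) (hn : PolyTime E n) (hT : PolyTime E T)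
    (hs : PolyTime E s) : PolyTime E fun a => N.searchStep A (x a) (R a) (n a) (T a) (s a) := by
  have h := askCounting hB (N.polyTime_circuit (const false) hx
    (D := fun a => CircuitRice.addBits (R a) (CircuitRice.midBits (R a) (s a).1 (s a).2)
      (CircuitRice.powTwo (n a))) (by fun_prop) hT)
  unfold NTM.searchStep
  exact h.ite (by fun_prop) (by fun_prop)

/-- Both ends keep `R` digits throughout, which is the bound on intermediate values that folding
requires. -/
theorem search (N : NTM) {A : Set ℕ} (hB : E.B = Counting A) {x : α → Str} {R n T : α → ℕ}
    {s : α → List Bool × List Bool}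
    (hx : PolyTime E x) (hR : PolyTime E R) (hn : PolyTime E n) (hT : PolyTime E T)
    (hs : PolyTime E s) (hl : ∀ a, (s a).1.length = R a ∧ (s a).2.length = R a) :
    PolyTime E fun a => N.search A (x a) (R a) (n a) (T a) (s a) := by
  obtain ⟨p, hp⟩ := hR.size_le
  refine foldl (f := fun a => List.replicate (R a) ())
    (h := fun a s _ => N.searchStep A (x a) (R a) (n a) (T a) s) (by fun_prop) hs
    (searchStep N hB (x := fun y : α × (List Bool × List Bool) × Unit => x y.1) (.comp hx .fst)
      (.comp hR .fst) (.comp hn .fst) (.comp hT .fst) (by fun_prop)) (8 * p + 3) fun a l _ => ?_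
  have hlen : ∀ (l : List Unit) (s : List Bool × List Bool), s.1.length = R a ∧ s.2.length = R a →
      (l.foldl (fun s _ => N.searchStep A (x a) (R a) (n a) (T a) s) s).1.length = R a ∧
      (l.foldl (fun s _ => N.searchStep A (x a) (R a) (n a) (T a) s) s).2.length = R a := by
    intro l
    induction l with
    | nil => exact fun s h => h
    | cons u l ih => exact fun s h => ih _ (NTM.length_searchStep h)
  have h := hlen l (s a) (hl a)
  have h1 := size_bools_le (l.foldl (fun s _ => N.searchStep A (x a) (R a) (n a) (T a) s) (s a)).1
  have h2 := size_bools_le (l.foldl (fun s _ => N.searchStep A (x a) (R a) (n a) (T a) s) (s a)).2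
  have h3 := hp a
  rw [size_nat] at h3
  rw [h.1] at h1
  rw [h.2] at h2
  have h4 : (8 * p + 3).eval (size a) = 8 * p.eval (size a) + 3 := by simp
  refine (size_pair _ _).trans_le ?_
  omega

theorem decision (N : NTM) {A : Set ℕ} (hB : E.B = Counting A) {x : α → Str} {R n T : α → ℕ}
    {s : α → List Bool × List Bool}
    (hx : PolyTime E x) (hR : PolyTime E R) (hn : PolyTime E n) (hT : PolyTime E T)
    (hs : PolyTime E s) : PolyTime E fun a => decision N A (x a) (R a) (n a) (T a) (s a) := by
  have h1 := askCounting hB (N.polyTime_circuit (const false) hx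
    (D := fun a => CircuitRice.addBits (R a) (CircuitRice.midBits (R a) (s a).1 (s a).2)
      (CircuitRice.powTwo (n a))) (by fun_prop) hT)
  have h2 := askCounting hB (N.polyTime_circuit (const true) hx
    (D := fun a => CircuitRice.midBits (R a) (s a).1 (s a).2) (by fun_prop) hT)
  unfold CircuitRice.decision
  exact FinData.comp (finData_bool.prod finData_bool) (fun z => z.1 ^^ z.2) (h1.prodMk h2)

end PolyTime

open Classical in
theorem polyTuringReduces_counting {A : Set ℕ} (hB : E.B = Counting A) {L : Set Str}
    {N : NTM} {p : Polynomial ℕ} {g u v : Str → Str} (hg : PolyTime E g) (hu : PolyTime E u)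
    (hv : PolyTime E v) (hN : ∀ x : Str, N.HaltsIn (p.eval x.length) (N.init x))
    (hL : ∀ x : Str, (x ∉ L ↔ N.accPaths (p.eval x.length) (N.init x) = 2 ^ (g x).length) ∧
      (x ∈ L ↔ N.accPaths (p.eval x.length) (N.init x) = 2 ^ (g x).length + 1))
    (hu1 : ∀ w, strToNat (u w) ∈ A) (hu2 : ∀ w, w.length ≤ (u w).length)
    (hv1 : ∀ w, strToNat (v w) ∉ A) (hv2 : ∀ w, w.length ≤ (v w).length) :
    PolyTuringReduces L (Counting A) := by
  obtain ⟨M, hM⟩ : ∃ M, ∀ q ∈ N.stmts, stmtDepth q ≤ M :=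
    ⟨N.stmts.sup stmtDepth, fun q hq => Finset.le_sup (f := stmtDepth) hq⟩
  let n : Str → ℕ := fun x => (g x).length
  -- An argument of length `n x + 1` forces a value of at least that length, as needed for
  -- subtracting `2 ^ n x` with `shiftBits`.
  let a : Str → Str := fun x => u (List.replicate (n x + 1) false)
  let b : Str → Str := fun x => v (List.replicate (n x + 1) false)
  let R : Str → ℕ := fun x => (a x).length + (b x).length
  -- The ends have `R x + 1` digits, and adding `2 ^ n x` for a query produces one more.
  let T : Str → ℕ := fun x => p.eval x.length * (M + 1) + (R x + 1 + 1)
  let s : Str → List Bool × List Bool := fun x =>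
    (shiftBits (R x) (n x) (a x), shiftBits (R x) (n x) (b x))
  have hn : PolyTime E n := .length hg
  have ha : PolyTime E a := .comp hu (by fun_prop)
  have hb : PolyTime E b := .comp hv (by fun_prop)
  have hR : PolyTime E R := by fun_prop
  have hT : PolyTime E T := by
    have : PolyTime E fun x : Str => p.eval x.length := PolyTime.polynomial_eval (by fun_prop) p
    fun_prop
  have hs : PolyTime E s := by fun_prop
  have han : ∀ x, n x + 1 ≤ (a x).length := fun x => by
    simpa using hu2 (List.replicate (n x + 1) false)
  have hbn : ∀ x, n x + 1 ≤ (b x).length := fun x => by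
    simpa using hv2 (List.replicate (n x + 1) false)
  have haR : ∀ x, (a x).length ≤ R x := fun x => Nat.le_add_right _ _
  have hbR : ∀ x, (b x).length ≤ R x := fun x => Nat.le_add_left _ _
  have hsl : ∀ x, (s x).1.length = R x + 1 ∧ (s x).2.length = R x + 1 := fun x =>
    ⟨length_shiftBits (han x) (haR x), length_shiftBits (hbn x) (hbR x)⟩
  have hR' : PolyTime E fun x => R x + 1 := .succ hR
  have key := PolyTime.decision N hB .id' hR' hn hT
    (PolyTime.search N hB .id' hR' hn hT hs hsl)
  rw [← hB]
  refine polyTuringReduces_of_polyTime ?_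
  convert key using 2 with x
  have hRn : n x + 1 ≤ R x + 1 := by
    have := han x
    have := haR x
    omega
  have hinv := NTM.searchInv_search (A := A) hM (hN x) hRn (T := T x) le_rfl (hsl x).1 (hsl x).2
    (by rw [binVal_shiftBits (han x) (haR x)]; exact hu1 _)
    (by rw [binVal_shiftBits (hbn x) (hbR x)]; exact hv1 _)
  have hd := NTM.distinguish hM (hN x) hRn (T := T x) le_rfl hinv (by
    by_cases hx : x ∈ L
    · exact .inr ((hL x).2.1 hx)
    · exact .inl ((hL x).1.1 hx))
  rw [Bool.eq_iff_iff, decide_eq_true_iff, (hL x).2]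
  exact hd.symm

end CircuitRice

theorem mainTheorem3 (A : Set ℕ) (hA : CircuitRice.PConstructiblyBiInfinite A) :
    CircuitRice.IsHard CircuitRice.SPP (CircuitRice.Counting A) := by
  obtain ⟨⟨u, ⟨Mu, hMu⟩, hu⟩, ⟨v, ⟨Mv, hMv⟩, hv⟩⟩ := hA
  rintro L ⟨f, ⟨N, p, hN⟩, g, ⟨Mg, hMg⟩, hL⟩
  let E : CircuitRice.Env :=
    { φ := ![g, u, v]
      mach := fun
        | 0 => Mg
        | 1 => Mu
        | 2 => Mv
      fin := fun
        | 0 => hMg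
        | 1 => hMu
        | 2 => hMv
      B := CircuitRice.Counting A }
  refine CircuitRice.polyTuringReduces_counting (E := E) rfl (.call 0) (.call 1) (.call 2)
    (fun x => (hN x).1) (fun x => ?_) (fun w => (hu w).1) (fun w => (hu w).2)
    (fun w => (hv w).1) (fun w => (hv w).2)
  rw [(hN x).2]
  exact hL x
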